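/- Let $0 \le \nu < 3$ and $\gamma \ge (3-\nu)/4$. There is a constant $C = C(\nu,\gamma) > 0$ such that the following holds for every non-negative function $V$ on $(0,\infty)$ for which $V(x)^{\gamma + (1+\nu)/4}\, x^{\nu}$ is integrable on $(0,\infty)$. The quadratic form $$u \mapsto \int_0^\infty \Big( |u''(x)|^2 - \frac{9}{16}\,\frac{|u(x)|^2}{x^4} - V(x)\,|u(x)|^2 \Big)\, dx$$ is well defined and lower semi-bounded on $C_0^\infty(0,\infty)$ (complex-valued functions, with respect to the norm of $L^2(0,\infty)$), and it is closable in $L^2(0,\infty)$. Let $H_0 - V$ be the self-adjoint operator in $L^2(0,\infty)$ associated with the closure of this form. Then the negative spectrum of $H_0 - V$ is discrete, that is, it consists of isolated points of the spectrum that are eigenvalues of finite multiplicity, and $$\operatorname{tr}\,(H_0 - V)_-^{\gamma} \le C \int_0^\infty V(x)^{\gamma + \frac{1+\nu}{4}}\, x^{\nu}\, dx,$$ where $\operatorname{tr}\,(H_0 - V)_-^{\gamma} = \sum_j |\lambda_j|^{\gamma}$ is the sum over the negative eigenvalues $\lambda_j$ of $H_0 - V$, repeated according to multiplicity. -/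

import Mathlib

open MeasureTheory Set Filter Topology TopologicalSpace
open scoped ENNReal InnerProductSpace Distributions

noncomputable section

namespace LiebThirring

/-! ### Sesquilinear forms and unbounded operators in a complex Hilbert space -/

section Abstract

variable {H : Type*} [NormedAddCommGroup H] [InnerProductSpace ℂ H]

/-- A (possibly unbounded) sesquilinear form in `H`: a linear subspace of `H` and a sesquilinear
form on it, conjugate-linear in the first argument like Mathlib's inner product. -/
structure Form (H : Type*) [NormedAddCommGroup H] [InnerProductSpace ℂ H] where
  /-- the form domain -/
  domain : Submodule ℂ H
  /-- the sesquilinear form -/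
  sesq : domain →ₗ⋆[ℂ] domain →ₗ[ℂ] ℂ

/-- The quadratic form `h[u] = h[u, u]`. -/
def Form.quad (h : Form H) (u : h.domain) : ℂ := h.sesq u u

/-- `h` is Hermitian. -/
def Form.IsHermitian (h : Form H) : Prop :=
  ∀ u v : h.domain, h.sesq u v = starRingEnd ℂ (h.sesq v u)

/-- `h` is lower semi-bounded. -/
def Form.IsSemibounded (h : Form H) : Prop :=
  ∃ c : ℝ, ∀ u : h.domain, c * ‖(u : H)‖ ^ 2 ≤ (h.quad u).re

/-- `h` is closed: if `φ n ∈ dom h` converges to `u` in `H` and `h[φ m - φ n] → 0`, then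
`u ∈ dom h` and `h[φ n - u] → 0`. -/
def Form.IsClosed (h : Form H) : Prop :=
  ∀ (φ : ℕ → h.domain) (u : H), Tendsto (fun n => (φ n : H)) atTop (𝓝 u) →
    Tendsto (fun p : ℕ × ℕ => h.quad (φ p.1 - φ p.2)) atTop (𝓝 0) →
    ∃ hu : u ∈ h.domain, Tendsto (fun n => h.quad (φ n - ⟨u, hu⟩)) atTop (𝓝 0)

/-- `h` is the closure of the quadratic form `q`, initially given on the subspace `j(E)` of `H`:
`h` is a closed semi-bounded Hermitian form that extends `q`, and `j(E)` is a core of `h`.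
There is at most one such `h`, and there is one only if `q` is closable. -/
structure Form.IsClosureOf {E : Type*} [AddCommGroup E] [Module ℂ E]
    (h : Form H) (j : E →ₗ[ℂ] H) (q : E → ℝ) : Prop where
  hermitian : h.IsHermitian
  semibounded : h.IsSemibounded
  closed : h.IsClosed
  extends_core : ∀ u : E, ∃ hu : j u ∈ h.domain, h.quad ⟨j u, hu⟩ = q u
  core_dense : ∀ u : h.domain, ∃ φ : ℕ → E, ∃ hφ : ∀ n, j (φ n) ∈ h.domain,
    Tendsto (fun n => j (φ n)) atTop (𝓝 (u : H)) ∧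
    Tendsto (fun n => h.quad (⟨j (φ n), hφ n⟩ - u)) atTop (𝓝 0)

/-- `T` is the operator associated with the form `h`: `u ∈ dom T` and `T u = f` if and only if
`u ∈ dom h` and `h[v, u] = ⟪v, f⟫` for all `v ∈ dom h`. -/
def IsAssociated (T : H →ₗ.[ℂ] H) (h : Form H) : Prop :=
  ∀ u f : H, (u, f) ∈ T.graph ↔
    ∃ hu : u ∈ h.domain, ∀ v : h.domain, h.sesq v ⟨u, hu⟩ = ⟪(v : H), f⟫_ℂ

/-- The resolvent set of `T`: those `z` for which `T - z` is a bijection of `dom T` onto `H` with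
bounded inverse. -/
def resolventSet (T : H →ₗ.[ℂ] H) : Set ℂ :=
  {z | ∃ R : H →L[ℂ] H,
    (∀ f : H, ∃ hf : R f ∈ T.domain, T ⟨R f, hf⟩ - z • R f = f) ∧
    ∀ u : T.domain, R (T u - z • (u : H)) = u}

/-- The spectrum of `T`. -/
def spec (T : H →ₗ.[ℂ] H) : Set ℂ := (resolventSet T)ᶜ

/-- The eigenspace `ker (T - z)`. -/
def eigenspace (T : H →ₗ.[ℂ] H) (z : ℂ) : Submodule ℂ T.domain :=
  LinearMap.ker (T.toFun - z • T.domain.subtype)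

/-- The negative spectrum of `T` is discrete: every negative point of the spectrum is isolated in
the spectrum and is an eigenvalue of finite multiplicity. -/
def HasDiscreteNegSpectrum (T : H →ₗ.[ℂ] H) : Prop :=
  ∀ r : ℝ, r < 0 → (r : ℂ) ∈ spec T →
    (∃ ε > 0, ∀ z ∈ spec T, ‖z - r‖ < ε → z = r) ∧
    eigenspace T r ≠ ⊥ ∧ FiniteDimensional ℂ (eigenspace T r)

/-- `tr T_-^γ` for an operator with discrete negative spectrum: the sum of `|r|^γ` over the negative
eigenvalues `r` of `T`, each counted with its multiplicity. (Points `r` that are not eigenvalues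
have multiplicity `0`.) -/
def negTrace (T : H →ₗ.[ℂ] H) (γ : ℝ) : ℝ≥0∞ :=
  ∑' r : {r : ℝ // r < 0},
    ((Cardinal.toENat (Module.rank ℂ (eigenspace T (r : ℝ)))) : ℝ≥0∞) *
      ENNReal.ofReal (|(r : ℝ)| ^ γ)

end Abstract

/-! ### The fourth-order operator on the half-line -/

/-- The open half-line `(0, ∞)`. -/
def halfLine : Opens ℝ := ⟨Ioi 0, isOpen_Ioi⟩

/-- The Hilbert space `L²(0, ∞)`. -/
abbrev L2 : Type := Lp ℂ 2 ((volume : Measure ℝ).restrict (Ioi 0))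

theorem memLp_test (u : 𝓓(halfLine, ℂ)) :
    MemLp u 2 ((volume : Measure ℝ).restrict (Ioi 0)) :=
  u.continuous.memLp_of_hasCompactSupport u.hasCompactSupport

/-- The inclusion of `C₀^∞(0, ∞)` into `L²(0, ∞)`. -/
def toL2 : 𝓓(halfLine, ℂ) →ₗ[ℂ] L2 where
  toFun u := (memLp_test u).toLp u
  map_add' _ _ := rfl
  map_smul' _ _ := rfl

/-- The sharp constant in the Hardy–Rellich inequality
`∫ |u''|² ≥ C ∫ |u|² / x⁴` for `u ∈ C₀^∞(0, ∞)`. -/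
def hardyRellichConst : ℝ := 9 / 16

/-- The integrand `|u''|² - (9/16) |u|² / x⁴ - V |u|²`. -/
def energyDensity (V : ℝ → ℝ) (u : ℝ → ℂ) (x : ℝ) : ℝ :=
  ‖deriv (deriv u) x‖ ^ 2 - hardyRellichConst * (‖u x‖ ^ 2 / x ^ 4) - V x * ‖u x‖ ^ 2

/-- The quadratic form `∫₀^∞ (|u''|² - (9/16) |u|² / x⁴ - V |u|²) dx` on `C₀^∞(0, ∞)`. -/
def energy (V : ℝ → ℝ) (u : 𝓓(halfLine, ℂ)) : ℝ :=
  ∫ x in Ioi (0 : ℝ), energyDensity V u x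

end LiebThirring

end

/-! Put u = x^(3/2) w, s = log x and D = d/ds = x d/dx. Then u'' corresponds to (D + 3/2)(D + 1/2)
w, and (ξ² + 9/4)(ξ² + 1/4) = ξ⁴ + (5/2) ξ² + 9/16. So subtracting the Hardy–Rellich term leaves
exactly ∫ (|D² w|² + (5/2) |D w|²) ds (`integral_hardyDensity`), and the form becomes a difference
of squares, ‖`hardyOp` u‖² - ‖`potOp` u‖².

The decisive local estimate (`norm_sq_le_on_interval`) is |u(x)|² ≤ K x^ν |I|^(3-ν) (∫_I density +
|I|^(-3) (|u(p)|² + |u(q)|²)), with p, q in the outer thirds of I and K independent of the position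
of I, even if I touches the origin. Far from the origin it is a Sobolev inequality in s that uses D²
w. Near the origin D w still allows w to grow logarithmically, and the factor x^(3-ν) absorbs this;
here ν < 3 is essential.

Cut the half-line into intervals I_k with K |I_k|^(3-ν) ∫_{I_k} V x^ν = 1 (`exists_partition`, after
an arbitrarily small positive addition to the weight). Then ∫_{I_k} V |u|² is at most the energy on
I_k plus |I_k|^(-3) times two squared point values or, after averaging over p and q, plus 6
|I_k|^(-4) ∫_{I_k} |u|². Averages on the intervals with 6 |I_k|^(-4) ≤ τ and point values on the
others show that the form is at least -τ up to a correction of rank 2 #{k : 6 |I_k|^(-4) > τ}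
(`exists_partition_bound`). This rank bounds the number of eigenvalues below -τ
(`sum_finrank_eigenspace_le`).

By construction the sum of |I_k|^(-(3-ν)) is at most K ∫ V x^ν, up to the small addition. For γ =
(3-ν)/4, integrating the count against γ τ^(γ-1) dτ gives 2 ∑ (6 |I_k|^(-4))^γ, which is this sum up
to a constant. For larger γ the partition is made at each τ for (V - τ/2)_+ instead, the short
intervals are counted by Chebyshev's inequality, and the resulting bound is integrated in τ.

On the operator side, the form domain is realised as a Hilbert space G, the closed graph of
`hardyOp`, with an injection J of dense range into L². The form is ⟪x, A y⟫ with A bounded and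
self-adjoint on G, and T - z is inverted through A - z J†J by Lax–Milgram. The finite rank
corrections that count eigenvalues also give discreteness of the negative spectrum. -/

namespace LiebThirring

noncomputable section

/-! ### The operator of a coercive form, represented on a Hilbert space of its own -/

section AbstractForm

variable {H G : Type*} [NormedAddCommGroup H] [InnerProductSpace ℂ H]
  [NormedAddCommGroup G] [InnerProductSpace ℂ G]

/-- The form `(J x, J y) ↦ ⟪x, A y⟫` on the range of the injective operator `J`. -/
def formOf (J : G →L[ℂ] H) (hJ : Function.Injective J) (A : G →L[ℂ] G) : Form H where
  domain := LinearMap.range J.toLinearMap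
  sesq := LinearMap.mk₂'ₛₗ (starRingEnd ℂ) (RingHom.id ℂ)
    (fun u v => ⟪(LinearEquiv.ofInjective J.toLinearMap hJ).symm u,
      A ((LinearEquiv.ofInjective J.toLinearMap hJ).symm v)⟫_ℂ)
    (fun u u' v => by simp)
    (fun c u v => by simp [mul_comm])
    (fun u v v' => by simp)
    (fun c u v => by simp)

variable {J : G →L[ℂ] H} (hJ : Function.Injective J) {A : G →L[ℂ] G}

theorem formOf_sesq (x y : G) (hx : J x ∈ (formOf J hJ A).domain)
    (hy : J y ∈ (formOf J hJ A).domain) :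
    (formOf J hJ A).sesq ⟨J x, hx⟩ ⟨J y, hy⟩ = ⟪x, A y⟫_ℂ := by
  have key : ∀ (z : G) (hz : J z ∈ LinearMap.range J.toLinearMap),
      (LinearEquiv.ofInjective J.toLinearMap hJ).symm ⟨J z, hz⟩ = z := fun z hz => by
    rw [LinearEquiv.symm_apply_eq]; ext; simp
  exact congrArg₂ (fun a b => ⟪a, A b⟫_ℂ) (key x hx) (key y hy)

theorem formOf_quad (x : G) (hx : J x ∈ (formOf J hJ A).domain) :
    (formOf J hJ A).quad ⟨J x, hx⟩ = ⟪x, A x⟫_ℂ :=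
  formOf_sesq hJ x x hx hx

variable {κ c : ℝ}

theorem formOf_isSemibounded (hκ : 0 < κ)
    (hc : ∀ x, κ * ‖x‖ ^ 2 ≤ (⟪x, A x⟫_ℂ).re + c * ‖J x‖ ^ 2) :
    (formOf J hJ A).IsSemibounded := by
  refine ⟨-c, ?_⟩
  rintro ⟨_, x, rfl⟩
  have h1 := formOf_quad hJ (A := A) x ⟨x, rfl⟩
  have h2 := hc x
  have h3 : 0 ≤ κ * ‖x‖ ^ 2 := by positivity
  change -c * ‖J x‖ ^ 2 ≤ ((formOf J hJ A).quad ⟨J x, _⟩).re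
  rw [h1]
  linarith

variable [CompleteSpace G]

theorem formOf_isHermitian (hA : IsSelfAdjoint A) : (formOf J hJ A).IsHermitian := by
  rintro ⟨_, x, rfl⟩ ⟨_, y, rfl⟩
  refine (formOf_sesq hJ x y _ _).trans ?_
  refine Eq.trans ?_ (congrArg _ (formOf_sesq hJ y x ⟨y, rfl⟩ ⟨x, rfl⟩).symm)
  rw [inner_conj_symm, ← ContinuousLinearMap.adjoint_inner_left, hA.adjoint_eq]

/-- By coercivity, convergence of `J (x n)` together with smallness of the form on differences makes
`x n` Cauchy in the complete space `G`; its limit represents `u`. -/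
theorem formOf_isClosed (hκ : 0 < κ)
    (hc : ∀ x, κ * ‖x‖ ^ 2 ≤ (⟪x, A x⟫_ℂ).re + c * ‖J x‖ ^ 2) :
    (formOf J hJ A).IsClosed := by
  intro φ u hφu hφ
  choose x hx using fun n => (φ n).2
  have hx' : ∀ n, φ n = ⟨J (x n), ⟨x n, rfl⟩⟩ := fun n => Subtype.ext (hx n).symm
  have hq : ∀ p : ℕ × ℕ, (formOf J hJ A).quad (φ p.1 - φ p.2) =
      ⟪x p.1 - x p.2, A (x p.1 - x p.2)⟫_ℂ := by
    intro p
    rw [← formOf_quad hJ (A := A) (x p.1 - x p.2) ⟨_, rfl⟩, hx' p.1, hx' p.2]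
    congr 1
    exact Subtype.ext (by simp)
  have hJx : Tendsto (fun n => J (x n)) atTop (𝓝 u) := by
    refine hφu.congr fun n => (hx n).symm
  have hJ2 : Tendsto (fun p : ℕ × ℕ => ‖J (x p.1 - x p.2)‖) atTop (𝓝 0) := by
    have h1 : Tendsto (fun p : ℕ × ℕ => J (x p.1) - J (x p.2)) atTop (𝓝 (u - u)) := by
      rw [← prod_atTop_atTop_eq]
      exact (hJx.comp tendsto_fst).sub (hJx.comp tendsto_snd)
    simpa using h1.norm
  have hR : Tendsto (fun p : ℕ × ℕ => ((⟪x p.1 - x p.2, A (x p.1 - x p.2)⟫_ℂ).re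
      + c * ‖J (x p.1 - x p.2)‖ ^ 2) / κ) atTop (𝓝 0) := by
    have h1 : Tendsto (fun p : ℕ × ℕ => (⟪x p.1 - x p.2, A (x p.1 - x p.2)⟫_ℂ).re) atTop
        (𝓝 (0 : ℂ).re) :=
      (Complex.continuous_re.tendsto _).comp (hφ.congr hq)
    simpa using (h1.add ((hJ2.pow 2).const_mul c)).div_const κ
  have hN : Tendsto (fun p : ℕ × ℕ => ‖x p.1 - x p.2‖ ^ 2) atTop (𝓝 0) := by
    refine squeeze_zero (fun _ => by positivity) (fun p => ?_) hR
    rw [le_div_iff₀ hκ, mul_comm]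
    exact hc _
  have hN' : Tendsto (fun p : ℕ × ℕ => ‖x p.1 - x p.2‖) atTop (𝓝 0) := by
    have := hN.sqrt
    simpa [Real.sqrt_sq] using this
  have hcau : CauchySeq x := by
    rw [cauchySeq_iff_tendsto_dist_atTop_0]
    simpa [dist_eq_norm] using hN'
  obtain ⟨y, hy⟩ := cauchySeq_tendsto_of_complete hcau
  have huy : J y = u := tendsto_nhds_unique ((J.continuous.tendsto y).comp hy) hJx
  refine ⟨⟨y, huy⟩, ?_⟩
  have hlim : Tendsto (fun n => ⟪x n - y, A (x n - y)⟫_ℂ) atTop (𝓝 0) := by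
    have h1 : Tendsto (fun n => x n - y) atTop (𝓝 0) := by
      simpa using hy.sub_const y
    have h2 := h1.inner (𝕜 := ℂ) ((A.continuous.tendsto 0).comp h1)
    simpa only [map_zero, inner_zero_left, Function.comp_apply] using h2
  refine hlim.congr fun n => ?_
  rw [← formOf_quad hJ (A := A) (x n - y) ⟨_, rfl⟩, hx' n]
  congr 1
  exact Subtype.ext (by simp [huy])

variable [CompleteSpace H]

/-- The graph of the operator associated with `formOf J hJ A`. -/
def opGraph (J : G →L[ℂ] H) (A : G →L[ℂ] G) : Submodule ℂ (H × H) where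
  carrier := {p | ∃ x, J x = p.1 ∧ A x = J.adjoint p.2}
  add_mem' := by
    rintro ⟨_, f⟩ ⟨_, g⟩ ⟨x, rfl, hx⟩ ⟨y, rfl, hy⟩
    exact ⟨x + y, by simp, by simp_all⟩
  zero_mem' := ⟨0, by simp, by simp⟩
  smul_mem' := by
    rintro a ⟨_, f⟩ ⟨x, rfl, hx⟩
    exact ⟨a • x, by simp, by simp_all⟩

/-- The operator associated with `formOf J hJ A`. -/
def opOf (J : G →L[ℂ] H) (A : G →L[ℂ] G) : H →ₗ.[ℂ] H := (opGraph J A).toLinearPMap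

/-- This makes the relation `opGraph` single-valued: if `J x = 0`, then `x = 0`, so `J† f = 0`,
which has to force `f = 0`. -/
theorem adjoint_injective_of_denseRange (hJd : DenseRange J) :
    Function.Injective J.adjoint := by
  rw [injective_iff_map_eq_zero]
  intro f hf
  refine hJd.eq_zero_of_inner_left ℂ (x := f) ?_
  intro x
  rw [← ContinuousLinearMap.adjoint_inner_left, hf, inner_zero_left]

include hJ in
theorem mem_graph_opOf (hJd : DenseRange J) (u f : H) :
    (u, f) ∈ (opOf J A).graph ↔ ∃ x, J x = u ∧ A x = J.adjoint f := by
  rw [opOf, Submodule.toLinearPMap_graph_eq]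
  · rfl
  · rintro ⟨u, f⟩ ⟨x, hx, hf⟩ (rfl : u = 0)
    have : x = 0 := hJ (by simpa using hx)
    subst this
    exact adjoint_injective_of_denseRange hJd (by simpa using hf.symm)

/-- Paired with all `y`, the equation `A x = J† f` reads `⟪y, A x⟫ = ⟪J y, f⟫`, the weak formulation
that defines the associated operator. -/
theorem opOf_isAssociated (hJd : DenseRange J) : IsAssociated (opOf J A) (formOf J hJ A) := by
  intro u f
  rw [mem_graph_opOf hJ hJd]
  constructor
  · rintro ⟨x, rfl, hx⟩
    refine ⟨⟨x, rfl⟩, ?_⟩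
    rintro ⟨_, y, rfl⟩
    refine (formOf_sesq hJ y x ⟨y, rfl⟩ ⟨x, rfl⟩).trans ?_
    rw [hx, ContinuousLinearMap.adjoint_inner_right]
    rfl
  · rintro ⟨⟨x, rfl⟩, h⟩
    refine ⟨x, rfl, ?_⟩
    refine ext_inner_left ℂ fun y => ?_
    rw [ContinuousLinearMap.adjoint_inner_right, ← formOf_sesq hJ y x ⟨y, rfl⟩ ⟨x, rfl⟩]
    exact h ⟨J y, ⟨y, rfl⟩⟩

/-- The operator pencil `A - z J† J`. -/
def pencil (J : G →L[ℂ] H) (A : G →L[ℂ] G) (z : ℂ) : G →L[ℂ] G := A - z • (J.adjoint ∘L J)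

theorem pencil_apply (z : ℂ) (x : G) : pencil J A z x = A x - z • J.adjoint (J x) := rfl

theorem inner_pencil (z : ℂ) (x y : G) :
    ⟪x, pencil J A z y⟫_ℂ = ⟪x, A y⟫_ℂ - z * ⟪J x, J y⟫_ℂ := by
  rw [pencil_apply, inner_sub_right, inner_smul_right, ContinuousLinearMap.adjoint_inner_right]

include hJ in
theorem opOf_domain_exists (hJd : DenseRange J) (u : (opOf J A).domain) :
    ∃ x, J x = u ∧ A x = J.adjoint (opOf J A u) :=
  (mem_graph_opOf hJ hJd _ _).1 (LinearPMap.mem_graph _ u)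

include hJ in
theorem exists_mem_domain_opOf (hJd : DenseRange J) {x : G} {f : H} (h : A x = J.adjoint f) :
    ∃ hx : J x ∈ (opOf J A).domain, opOf J A ⟨J x, hx⟩ = f := by
  have h1 : (J x, f) ∈ (opOf J A).graph := (mem_graph_opOf hJ hJd _ _).2 ⟨x, rfl, h⟩
  have h2 := LinearPMap.mem_domain_of_mem_graph h1
  exact ⟨h2, ((LinearPMap.image_iff h2).2 h1).symm⟩

include hJ in
-- The resolvent is `J ∘ (A - z J†J)⁻¹ ∘ J†`.
theorem mem_resolventSet_of_isUnit_pencil (hJd : DenseRange J) {z : ℂ}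
    (hz : IsUnit (pencil J A z)) : z ∈ resolventSet (opOf J A) := by
  obtain ⟨⟨L, L', h1, h2⟩, rfl : L = _⟩ := hz
  refine ⟨J ∘L L' ∘L J.adjoint, fun f => ?_, fun u => ?_⟩
  · have h3 : A (L' (J.adjoint f)) = J.adjoint (f + z • J (L' (J.adjoint f))) := by
      have h4 : pencil J A z (L' (J.adjoint f)) = J.adjoint f := by
        simpa using congrArg (fun M : G →L[ℂ] G => M (J.adjoint f)) h1
      rw [pencil_apply] at h4
      rw [map_add, map_smul]
      exact sub_eq_iff_eq_add.1 h4
    obtain ⟨hx, hT⟩ := exists_mem_domain_opOf hJ hJd h3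
    exact ⟨hx, sub_eq_iff_eq_add.2 hT⟩
  · obtain ⟨x, hx, hAx⟩ := opOf_domain_exists hJ hJd u
    have h4 : L' (pencil J A z x) = x := by
      simpa using congrArg (fun M : G →L[ℂ] G => M x) h2
    rw [pencil_apply, hAx, hx, ← map_smul, ← map_sub] at h4
    simp only [ContinuousLinearMap.comp_apply]
    rw [h4, hx]

/-- An operator `L` on a Hilbert space with `θ ‖x‖² ≤ |⟪x, L x⟫|` is invertible. -/
theorem isUnit_of_le_norm_inner {L : G →L[ℂ] G} {θ : ℝ} (hθ : 0 < θ)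
    (h : ∀ x, θ * ‖x‖ ^ 2 ≤ ‖⟪x, L x⟫_ℂ‖) : IsUnit L := by
  refine ContinuousLinearMap.isUnit_of_forall_le_norm_inner_map L (c := ⟨θ, hθ.le⟩) hθ fun x => ?_
  rw [norm_inner_symm, mul_comm]
  exact h x

theorem isUnit_pencil_of_re_neg (hκ : 0 < κ)
    (hc : ∀ x, κ * ‖x‖ ^ 2 ≤ (⟪x, A x⟫_ℂ).re + c * ‖J x‖ ^ 2) :
    IsUnit (pencil J A (-c : ℝ)) := by
  refine isUnit_of_le_norm_inner hκ fun x => ?_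
  refine le_trans ?_ (Complex.re_le_norm _)
  rw [inner_pencil, inner_self_eq_norm_sq_to_K]
  have := hc x
  simpa [← Complex.ofReal_pow] using this

/-- The imaginary part of `⟪x, (A - z J†J) x⟫` is `-Im z ‖J x‖²` and so controls `‖J x‖²`; the real
part, by coercivity, then controls `‖x‖²`. -/
theorem isUnit_pencil_of_im_ne_zero (hA : IsSelfAdjoint A) (hκ : 0 < κ)
    (hc : ∀ x, κ * ‖x‖ ^ 2 ≤ (⟪x, A x⟫_ℂ).re + c * ‖J x‖ ^ 2) {z : ℂ} (hz : z.im ≠ 0) :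
    IsUnit (pencil J A z) := by
  set m := |c + z.re| + |z.im| with hm
  have hz' : 0 < |z.im| := abs_pos.2 hz
  have hm0 : 0 < m := by positivity
  refine isUnit_of_le_norm_inner (θ := κ * |z.im| / (m + m)) (by positivity) fun x => ?_
  set w := ⟪x, pencil J A z x⟫_ℂ with hw
  have him : (⟪x, A x⟫_ℂ).im = 0 := by
    have := inner_conj_symm (𝕜 := ℂ) x (A x)
    rw [← ContinuousLinearMap.adjoint_inner_right, hA.adjoint_eq] at this
    exact Complex.conj_eq_iff_im.1 this
  have hwe : w = ⟪x, A x⟫_ℂ - z * ((‖J x‖ ^ 2 : ℝ) : ℂ) := by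
    rw [hw, inner_pencil, inner_self_eq_norm_sq_to_K]; norm_cast
  have h1 : |z.im| * ‖J x‖ ^ 2 ≤ ‖w‖ := by
    refine le_trans (le_of_eq ?_) (Complex.abs_im_le_norm w)
    rw [hwe, Complex.sub_im, him, Complex.im_mul_ofReal, zero_sub, abs_neg, abs_mul,
      abs_of_nonneg (sq_nonneg ‖J x‖)]
  have h2 : (⟪x, A x⟫_ℂ).re - z.re * ‖J x‖ ^ 2 ≤ ‖w‖ := by
    refine le_trans (le_of_eq ?_) (Complex.re_le_norm w)
    rw [hwe, Complex.sub_re, Complex.re_mul_ofReal]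
  have h3 := hc x
  have h4 : κ * ‖x‖ ^ 2 ≤ ‖w‖ + |c + z.re| * ‖J x‖ ^ 2 := by
    have : (c + z.re) * ‖J x‖ ^ 2 ≤ |c + z.re| * ‖J x‖ ^ 2 := by
      gcongr; exact le_abs_self _
    linarith
  have h5 : |z.im| * (κ * ‖x‖ ^ 2) ≤ m * ‖w‖ := by
    have h6 : |c + z.re| * (|z.im| * ‖J x‖ ^ 2) ≤ |c + z.re| * ‖w‖ := by gcongr
    calc |z.im| * (κ * ‖x‖ ^ 2) ≤ |z.im| * (‖w‖ + |c + z.re| * ‖J x‖ ^ 2) := by gcongr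
      _ ≤ m * ‖w‖ := by rw [hm]; linarith
  rw [div_mul_eq_mul_div, div_le_iff₀ (by positivity)]
  have : 0 ≤ m * ‖w‖ := by positivity
  linarith

include hJ in
theorem opOf_symmetric (hJd : DenseRange J) (hA : IsSelfAdjoint A) :
    (opOf J A).IsFormalAdjoint (opOf J A) := by
  intro u v
  obtain ⟨x, hx, hAx⟩ := opOf_domain_exists hJ hJd u
  obtain ⟨y, hy, hAy⟩ := opOf_domain_exists hJ hJd v
  rw [← hx, ← hy, ← ContinuousLinearMap.adjoint_inner_left, ← hAx,
    ← ContinuousLinearMap.adjoint_inner_right J, ← hAy,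
    ← ContinuousLinearMap.adjoint_inner_right, hA.adjoint_eq]

include hJ in
-- A symmetric operator with a real point in its resolvent set is self-adjoint. The point here is `s
-- = -c`, with resolvent `R`. A vector orthogonal to the domain is killed by the symmetric,
-- injective `R`, so the domain is dense.
theorem opOf_isSelfAdjoint (hJd : DenseRange J) (hA : IsSelfAdjoint A) (hκ : 0 < κ)
    (hc : ∀ x, κ * ‖x‖ ^ 2 ≤ (⟪x, A x⟫_ℂ).re + c * ‖J x‖ ^ 2) : IsSelfAdjoint (opOf J A) := by
  obtain ⟨R, hR1, hR2⟩ := mem_resolventSet_of_isUnit_pencil hJ hJd (isUnit_pencil_of_re_neg hκ hc)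
  have hsymm := opOf_symmetric hJ hJd hA
  choose hRd hRT using hR1
  have hdense : Dense ((opOf J A).domain : Set H) := by
    rw [← Submodule.dense_iff_topologicalClosure_eq_top.symm.trans Iff.rfl,
      Submodule.topologicalClosure_eq_top_iff, Submodule.eq_bot_iff]
    intro y hy
    rw [Submodule.mem_orthogonal] at hy
    have h1 : R y = 0 := by
      refine ext_inner_right ℂ fun f => ?_
      have h2 := hsymm ⟨R y, hRd y⟩ ⟨R f, hRd f⟩
      have h3 : opOf J A ⟨R y, hRd y⟩ = y + ((-c : ℝ) : ℂ) • R y := by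
        rw [← sub_eq_iff_eq_add]; exact hRT y
      have h4 : opOf J A ⟨R f, hRd f⟩ = f + ((-c : ℝ) : ℂ) • R f := by
        rw [← sub_eq_iff_eq_add]; exact hRT f
      rw [h3, h4, inner_add_left, inner_add_right, inner_smul_left, inner_smul_right,
        Complex.conj_ofReal, add_left_inj] at h2
      rw [inner_zero_left, ← h2, ← inner_conj_symm, hy _ (hRd f), map_zero]
    have h3 := hRT y
    rw [← h3]
    have h4 : (⟨R y, hRd y⟩ : (opOf J A).domain) = 0 := Subtype.ext h1
    rw [h4, h1]
    simp
  rw [LinearPMap.isSelfAdjoint_def]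
  refine le_antisymm ?_ (LinearPMap.IsFormalAdjoint.le_adjoint hdense hsymm)
  refine LinearPMap.le_of_le_graph ?_
  rintro ⟨y, g⟩ hyg
  rw [LinearPMap.mem_graph_iff] at hyg
  obtain ⟨y', hy' : (y' : H) = y, hg⟩ := hyg
  subst hy'
  change (opOf J A).adjoint y' = g at hg
  subst hg
  set s : ℂ := ((-c : ℝ) : ℂ) with hs
  set f := (opOf J A).adjoint y' - s • (y' : H) with hf
  -- Symmetry of `R` identifies every element `y'` of the adjoint domain with `R (T† y' - s y')`, so
  -- the adjoint does not extend the operator properly.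
  have key : R f = y' := by
    refine ext_inner_right ℂ fun k => ?_
    have e1 := LinearPMap.adjoint_isFormalAdjoint hdense y' ⟨R k, hRd k⟩
    have e2 := hsymm ⟨R f, hRd f⟩ ⟨R k, hRd k⟩
    have h3 : opOf J A ⟨R f, hRd f⟩ = f + s • R f := by
      rw [← sub_eq_iff_eq_add]; exact hRT f
    have h4 : opOf J A ⟨R k, hRd k⟩ = k + s • R k := by
      rw [← sub_eq_iff_eq_add]; exact hRT k
    have hss : starRingEnd ℂ s = s := Complex.conj_ofReal _
    rw [h3, h4, inner_add_left, inner_add_right, inner_smul_left, inner_smul_right, hss,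
      add_left_inj] at e2
    rw [h4, inner_add_right, inner_smul_right] at e1
    rw [← e2, hf, inner_sub_left, inner_smul_left, hss, e1]
    simp
  rw [LinearPMap.mem_graph_iff]
  refine ⟨⟨R f, hRd f⟩, key, ?_⟩
  have h3 : opOf J A ⟨R f, hRd f⟩ = f + s • R f := by
    rw [← sub_eq_iff_eq_add]; exact hRT f
  change opOf J A ⟨R f, hRd f⟩ = _
  rw [h3, key, hf, sub_add_cancel]

end AbstractForm

/-! ### Discreteness and counting of eigenvalues from finite rank corrections -/

section DiscreteSpectrum

variable {H G : Type*} [NormedAddCommGroup H] [InnerProductSpace ℂ H] [CompleteSpace H]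
  [NormedAddCommGroup G] [InnerProductSpace ℂ G] [CompleteSpace G]
  {J : G →L[ℂ] H} (hJ : Function.Injective J) {A : G →L[ℂ] G} {κ c τ : ℝ}
  {ι : Type*} [Fintype ι] {Λ : G →L[ℂ] EuclideanSpace ℂ ι}

/-- If `A + τ J† J + Λ† Λ ≥ 0` with `Λ` of finite rank, then below `-τ` the pencil is invertible
as soon as it is injective. -/
theorem isUnit_pencil_of_injective (hκ : 0 < κ)
    (hc : ∀ x, κ * ‖x‖ ^ 2 ≤ (⟪x, A x⟫_ℂ).re + c * ‖J x‖ ^ 2)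
    (hΛ : ∀ x, 0 ≤ (⟪x, A x⟫_ℂ).re + τ * ‖J x‖ ^ 2 + ‖Λ x‖ ^ 2) {r : ℝ} (hr : r < -τ)
    (hker : ∀ x, pencil J A r x = 0 → x = 0) : IsUnit (pencil J A r) := by
  set d := -r - τ with hd
  have hd0 : 0 < d := by linarith
  set M : G →L[ℂ] G := pencil J A r + Λ.adjoint ∘L Λ with hM
  -- The hypothesis `hΛ` bounds the form of `M` below by `d ‖J x‖²`, and coercivity bounds it by `κ
  -- ‖x‖² - |c + r| ‖J x‖²`. The combination with weights `|c + r|` and `d` eliminates `‖J x‖²`.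
  have hMu : IsUnit M := by
    set m := |c + r| + d with hm
    have hm0 : 0 < m := by positivity
    refine isUnit_of_le_norm_inner (θ := κ * d / m) (by positivity) fun x => ?_
    refine le_trans ?_ (Complex.re_le_norm _)
    have hre : (⟪x, M x⟫_ℂ).re = (⟪x, A x⟫_ℂ).re - r * ‖J x‖ ^ 2 + ‖Λ x‖ ^ 2 := by
      rw [hM, add_apply, inner_add_right, inner_pencil,
        ContinuousLinearMap.comp_apply, ContinuousLinearMap.adjoint_inner_right,
        inner_self_eq_norm_sq_to_K, inner_self_eq_norm_sq_to_K]
      simp [← Complex.ofReal_pow]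
    rw [hre, div_mul_eq_mul_div, div_le_iff₀ hm0]
    set X := (⟪x, A x⟫_ℂ).re
    have h1 := hc x
    have h2 := hΛ x
    have h3 : d * ‖J x‖ ^ 2 ≤ X - r * ‖J x‖ ^ 2 + ‖Λ x‖ ^ 2 := by rw [hd]; linarith
    have h4 : κ * ‖x‖ ^ 2 ≤ X - r * ‖J x‖ ^ 2 + ‖Λ x‖ ^ 2 + |c + r| * ‖J x‖ ^ 2 := by
      have : (c + r) * ‖J x‖ ^ 2 ≤ |c + r| * ‖J x‖ ^ 2 := by gcongr; exact le_abs_self _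
      have : 0 ≤ ‖Λ x‖ ^ 2 := by positivity
      linarith
    have h5 := mul_le_mul_of_nonneg_left h4 hd0.le
    have h6 := mul_le_mul_of_nonneg_left h3 (abs_nonneg (c + r))
    rw [hm]
    linarith
  obtain ⟨⟨_, M', h1, h2⟩, rfl⟩ := hMu
  have hM1 : ∀ x, M (M' x) = x := fun x => congrArg (fun S : G →L[ℂ] G => S x) h1
  have hM2 : ∀ x, M' (M x) = x := fun x => congrArg (fun S : G →L[ℂ] G => S x) h2
  have hMa : ∀ x, M x = pencil J A r x + Λ.adjoint (Λ x) := fun x => rfl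
  -- Solving `(M - Λ†Λ) x = g` amounts to `Y y = Λ M⁻¹ g` for `y = Λ x`. This is a
  -- finite-dimensional system, so injectivity gives solvability.
  let Y : EuclideanSpace ℂ ι →ₗ[ℂ] EuclideanSpace ℂ ι :=
    LinearMap.id - (Λ ∘L M' ∘L Λ.adjoint).toLinearMap
  have hY : ∀ y, Y y = y - Λ (M' (Λ.adjoint y)) := fun y => rfl
  have hYi : Function.Injective Y := by
    rw [injective_iff_map_eq_zero]
    intro y hy
    rw [hY, sub_eq_zero] at hy
    have h3 : pencil J A r (M' (Λ.adjoint y)) = 0 := by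
      have h4 := hMa (M' (Λ.adjoint y))
      rw [hM1, ← hy] at h4
      simpa using h4
    rw [hker _ h3, map_zero] at hy
    exact hy
  have hYs := LinearMap.injective_iff_surjective.1 hYi
  have hbij : Function.Bijective (pencil J A r) := by
    constructor
    · rw [injective_iff_map_eq_zero]; exact hker
    · intro g
      obtain ⟨y, hy⟩ := hYs (Λ (M' g))
      rw [hY] at hy
      refine ⟨M' (g + Λ.adjoint y), ?_⟩
      have h4 := hMa (M' (g + Λ.adjoint y))
      rw [hM1, map_add M', map_add Λ, ← hy, sub_add_cancel, ← map_add] at h4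
      exact (add_right_cancel h4).symm
  rw [ContinuousLinearMap.isUnit_iff_bijective]
  exact hbij

/-- The element of `G` that represents an element of the operator domain. -/
def domLift (hJd : DenseRange J) : (opOf J A).domain →ₗ[ℂ] G :=
  (LinearEquiv.ofInjective J.toLinearMap hJ).symm.toLinearMap ∘ₗ
    Submodule.inclusion (fun u hu => by
      obtain ⟨x, hx, -⟩ := opOf_domain_exists hJ hJd ⟨u, hu⟩
      exact ⟨x, hx⟩)

theorem apply_domLift (hJd : DenseRange J) (u : (opOf J A).domain) :
    J (domLift hJ hJd u) = u := by
  have := (LinearEquiv.ofInjective J.toLinearMap hJ).apply_symm_apply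
    (Submodule.inclusion (fun u hu => by
      obtain ⟨x, hx, -⟩ := opOf_domain_exists hJ hJd ⟨u, hu⟩
      exact ⟨x, hx⟩) u)
  exact congrArg Subtype.val this

theorem pencil_domLift (hJd : DenseRange J) {z : ℂ} (u : eigenspace (opOf J A) z) :
    A (domLift hJ hJd (u : (opOf J A).domain)) =
      z • J.adjoint (J (domLift hJ hJd (u : (opOf J A).domain))) := by
  obtain ⟨x, hx, hAx⟩ := opOf_domain_exists hJ hJd (u : (opOf J A).domain)
  have hxl : domLift hJ hJd (u : (opOf J A).domain) = x := hJ (by rw [apply_domLift, hx])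
  have hu : opOf J A u = z • ((u : (opOf J A).domain) : H) := by
    have := LinearMap.mem_ker.1 u.2
    exact sub_eq_zero.1 this
  rw [hxl, hAx, hu, hx, map_smul]

include hJ in
theorem eigenspace_ne_bot (hJd : DenseRange J) {z : ℂ} {x : G} (hx : x ≠ 0)
    (h : pencil J A z x = 0) : eigenspace (opOf J A) z ≠ ⊥ := by
  rw [pencil_apply, sub_eq_zero, ← map_smul] at h
  obtain ⟨hd, hT⟩ := exists_mem_domain_opOf hJ hJd h
  rw [Submodule.ne_bot_iff]
  refine ⟨⟨J x, hd⟩, ?_, ?_⟩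
  · rw [eigenspace, LinearMap.mem_ker]
    exact sub_eq_zero.2 hT
  · intro h0
    exact hx (hJ (by simpa using congrArg Subtype.val h0))

include hJ in
/-- If `A + τ J† J + Λ† Λ ≥ 0`, then the eigenvalues below `-τ`, with their multiplicities, number
at most the dimension of the target of `Λ`. -/
theorem sum_finrank_eigenspace_le (hJd : DenseRange J) (hA : IsSelfAdjoint A)
    (hΛ : ∀ x, 0 ≤ (⟪x, A x⟫_ℂ).re + τ * ‖J x‖ ^ 2 + ‖Λ x‖ ^ 2)
    (s : Finset ℝ) (hs : ∀ r ∈ s, r < -τ) :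
    (∀ r ∈ s, FiniteDimensional ℂ (eigenspace (opOf J A) (r : ℝ))) ∧
      ∑ r ∈ s, Module.finrank ℂ (eigenspace (opOf J A) (r : ℝ)) ≤ Fintype.card ι := by
  classical
  let S : (∀ r : s, eigenspace (opOf J A) ((r : ℝ) : ℂ)) →ₗ[ℂ] G :=
    ∑ r : s, domLift hJ hJd ∘ₗ (eigenspace (opOf J A) ((r : ℝ) : ℂ)).subtype ∘ₗ LinearMap.proj r
  -- Eigenvectors for distinct eigenvalues are orthogonal both in `H` and for the form. If `Λ (S v)
  -- = 0`, then `hΛ` gives `∑ (r + τ) ‖J x_r‖² ≥ 0`, where every coefficient is negative; hence all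
  -- `x_r` vanish.
  have hinj : Function.Injective (Λ.toLinearMap ∘ₗ S) := by
    rw [injective_iff_map_eq_zero]
    intro v hv
    set x : s → G := fun r => domLift hJ hJd (v r : (opOf J A).domain) with hx
    have hSv : S v = ∑ r, x r := by simp [S, hx]
    have hAx : ∀ r, A (x r) = ((r : ℝ) : ℂ) • J.adjoint (J (x r)) := fun r =>
      pencil_domLift hJ hJd (v r)
    have hin : ∀ r r' : s, ⟪x r, A (x r')⟫_ℂ = ((r' : ℝ) : ℂ) * ⟪J (x r), J (x r')⟫_ℂ := by
      intro r r'
      rw [hAx, inner_smul_right, ContinuousLinearMap.adjoint_inner_right]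
    have horth : ∀ r r' : s, r ≠ r' → ⟪J (x r), J (x r')⟫_ℂ = 0 := by
      intro r r' hne
      have h1 := hin r r'
      rw [← ContinuousLinearMap.adjoint_inner_left, hA.adjoint_eq, hAx r, inner_smul_left,
        ContinuousLinearMap.adjoint_inner_left, Complex.conj_ofReal] at h1
      have h2 : (((r : ℝ) : ℂ) - ((r' : ℝ) : ℂ)) * ⟪J (x r), J (x r')⟫_ℂ = 0 := by
        rw [sub_mul, h1, sub_self]
      refine (mul_eq_zero.1 h2).resolve_left ?_
      exact fun h => hne (Subtype.ext (Complex.ofReal_injective (sub_eq_zero.1 h)))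
    have hq : (⟪S v, A (S v)⟫_ℂ).re = ∑ r : s, (r : ℝ) * ‖J (x r)‖ ^ 2 := by
      rw [hSv, map_sum, sum_inner, Complex.re_sum]
      refine Finset.sum_congr rfl fun r _ => ?_
      rw [inner_sum, Finset.sum_eq_single r, hin, inner_self_eq_norm_sq_to_K]
      · simp [← Complex.ofReal_pow]
      · intro r' _ hne
        rw [hin, horth r r' hne.symm, mul_zero]
      · simp
    have hn : ‖J (S v)‖ ^ 2 = ∑ r : s, ‖J (x r)‖ ^ 2 := by
      rw [← inner_self_eq_norm_sq (𝕜 := ℂ), hSv, map_sum, sum_inner, map_sum]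
      refine Finset.sum_congr rfl fun r _ => ?_
      rw [inner_sum, Finset.sum_eq_single r, inner_self_eq_norm_sq]
      · intro r' _ hne
        rw [horth r r' hne.symm]
      · simp
    have h0 := hΛ (S v)
    have hv' : Λ (S v) = 0 := hv
    rw [hv', norm_zero, hq, hn, Finset.mul_sum, zero_pow two_ne_zero, add_zero,
      ← Finset.sum_add_distrib] at h0
    have hle : ∀ r ∈ (Finset.univ : Finset s),
        (r : ℝ) * ‖J (x r)‖ ^ 2 + τ * ‖J (x r)‖ ^ 2 ≤ 0 := by
      intro r _
      have := hs r r.2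
      rw [← add_mul]
      exact mul_nonpos_of_nonpos_of_nonneg (by linarith) (by positivity)
    have hall := (Finset.sum_eq_zero_iff_of_nonpos hle).1 (le_antisymm (Finset.sum_nonpos hle) h0)
    funext r
    have h1 := hall r (Finset.mem_univ r)
    rw [← add_mul, mul_eq_zero] at h1
    have h2 := h1.resolve_left (by have := hs r r.2; linarith)
    have h3 : J (x r) = 0 := by simpa using h2
    rw [hx, apply_domLift] at h3
    exact Subtype.ext (Subtype.ext h3)
  have hfin : ∀ r : s, FiniteDimensional ℂ (eigenspace (opOf J A) ((r : ℝ) : ℂ)) := by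
    intro r
    refine FiniteDimensional.of_injective
      ((Λ.toLinearMap ∘ₗ S) ∘ₗ LinearMap.single ℂ
        (fun r : s => eigenspace (opOf J A) ((r : ℝ) : ℂ)) r) ?_
    exact hinj.comp (Pi.single_injective (M := fun r : s => eigenspace (opOf J A) ((r : ℝ) : ℂ)) r)
  refine ⟨fun r hr => hfin ⟨r, hr⟩, ?_⟩
  have := LinearMap.finrank_le_finrank_of_injective hinj
  rw [finrank_euclideanSpace, Module.finrank_pi_fintype] at this
  rwa [← Finset.sum_coe_sort s (fun r => Module.finrank ℂ (eigenspace (opOf J A) (r : ℝ)))]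

include hJ in
/-- If for every `τ > 0` there is a finite rank operator `Λ` with `A + τ J† J + Λ† Λ ≥ 0`, then the
negative spectrum of the operator is discrete. -/
theorem opOf_hasDiscreteNegSpectrum (hJd : DenseRange J) (hA : IsSelfAdjoint A) (hκ : 0 < κ)
    (hc : ∀ x, κ * ‖x‖ ^ 2 ≤ (⟪x, A x⟫_ℂ).re + c * ‖J x‖ ^ 2)
    (hΛ : ∀ τ : ℝ, 0 < τ → ∃ (n : ℕ) (Λ : G →L[ℂ] EuclideanSpace ℂ (Fin n)),
      ∀ x, 0 ≤ (⟪x, A x⟫_ℂ).re + τ * ‖J x‖ ^ 2 + ‖Λ x‖ ^ 2) :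
    HasDiscreteNegSpectrum (opOf J A) := by
  intro r hr hspec
  -- The threshold `r / 2` lies strictly above `r`, so the count also covers a neighbourhood of `r`.
  obtain ⟨n, Λ, hΛ⟩ := hΛ (-r / 2) (by linarith)
  have heig : ∀ r' : ℝ, r' < -(-r / 2) → (r' : ℂ) ∈ spec (opOf J A) →
      eigenspace (opOf J A) r' ≠ ⊥ := by
    intro r' hr' hs'
    by_contra hbot
    refine hs' (mem_resolventSet_of_isUnit_pencil hJ hJd
      (isUnit_pencil_of_injective hκ hc hΛ hr' fun x hx => ?_))
    by_contra hx0
    exact eigenspace_ne_bot hJ hJd hx0 hx hbot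
  have hr2 : r < -(-r / 2) := by linarith
  refine ⟨?_, heig r hr2 hspec, ?_⟩
  -- Each point of the spectrum below `r / 2` is an eigenvalue, so `n + 1` of them would have total
  -- multiplicity above `n`.
  · have hfin : {r' : ℝ | r' < -(-r / 2) ∧ (r' : ℂ) ∈ spec (opOf J A)}.Finite := by
      by_contra hinf
      obtain ⟨s, hs, hcard⟩ := Set.Infinite.exists_subset_card_eq hinf (n + 1)
      obtain ⟨h1, h2⟩ := sum_finrank_eigenspace_le hJ hJd hA hΛ s (fun r' hr' => (hs hr').1)
      have h3 : ∑ r' ∈ s, 1 ≤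
          ∑ r' ∈ s, Module.finrank ℂ (eigenspace (opOf J A) (r' : ℝ)) := by
        refine Finset.sum_le_sum fun r' hr' => ?_
        have := h1 r' hr'
        have hne := heig r' (hs hr').1 (hs hr').2
        rw [Nat.one_le_iff_ne_zero]
        exact fun h => hne (Submodule.finrank_eq_zero.1 h)
      simp only [Finset.sum_const, smul_eq_mul, mul_one, hcard] at h3
      simp only [Fintype.card_fin] at h2
      omega
    have hcl := (hfin.subset (sdiff_subset (t := {r}))).isClosed
    have hmem : ({r' : ℝ | r' < -(-r / 2) ∧ (r' : ℂ) ∈ spec (opOf J A)} \ {r})ᶜ ∈ 𝓝 r :=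
      hcl.isOpen_compl.mem_nhds (by simp)
    obtain ⟨ε, hε, hball⟩ := Metric.mem_nhds_iff.1 hmem
    refine ⟨min ε (-r / 2), lt_min hε (by linarith), fun z hz hzr => ?_⟩
    have him : z.im = 0 := by
      by_contra him
      exact hz (mem_resolventSet_of_isUnit_pencil hJ hJd (isUnit_pencil_of_im_ne_zero hA hκ hc him))
    have hzre : z = (z.re : ℂ) := Complex.ext rfl (by simp [him])
    rw [hzre] at hzr hz ⊢
    have hab : |z.re - r| < min ε (-r / 2) := by
      rw [← Complex.ofReal_sub, Complex.norm_real] at hzr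
      exact hzr
    by_contra hne
    have hne' : z.re ≠ r := fun h => hne (by rw [h])
    have hmb : z.re ∈ Metric.ball r ε := by
      rw [Metric.mem_ball, Real.dist_eq]
      exact hab.trans_le (min_le_left _ _)
    have hlt := (abs_lt.1 (hab.trans_le (min_le_right _ _))).2
    exact hball hmb ⟨⟨by linarith, hz⟩, hne'⟩
  · exact (sum_finrank_eigenspace_le hJ hJd hA hΛ {r} (by simpa using hr2)).1 r (by simp)

end DiscreteSpectrum

/-! ### Closure of a form `‖A u‖² - ‖B u‖²` with relatively bounded `B` -/

section Closure

variable {H K K' E : Type*} [NormedAddCommGroup H] [InnerProductSpace ℂ H]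
  [NormedAddCommGroup K] [InnerProductSpace ℂ K]
  [NormedAddCommGroup K'] [InnerProductSpace ℂ K']
  [AddCommGroup E] [Module ℂ E]

/-- Up to a finite rank correction of rank `n`, continuous in the form norm, the form
`‖A u‖² - ‖B u‖²` is bounded below by `-τ ‖j u‖²`. -/
def BoundedBelowUpToRank (j : E →ₗ[ℂ] H) (A : E →ₗ[ℂ] K) (B : E →ₗ[ℂ] K') (τ : ℝ) (n : ℕ) : Prop :=
  ∃ ℓ : E →ₗ[ℂ] EuclideanSpace ℂ (Fin n),
    (∃ C, ∀ u, ‖ℓ u‖ ^ 2 ≤ C * (‖j u‖ ^ 2 + ‖A u‖ ^ 2)) ∧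
    ∀ u, ‖B u‖ ^ 2 ≤ ‖A u‖ ^ 2 + τ * ‖j u‖ ^ 2 + ‖ℓ u‖ ^ 2

/-- The map `u ↦ (j u, A u)`. -/
def graphMap (j : E →ₗ[ℂ] H) (A : E →ₗ[ℂ] K) : E →ₗ[ℂ] WithLp 2 (H × K) :=
  (WithLp.linearEquiv 2 ℂ (H × K)).symm.toLinearMap ∘ₗ (j.prod A)

/-- The Hilbert space obtained by closing the graph of `j u ↦ A u`. -/
abbrev GraphSpace (j : E →ₗ[ℂ] H) (A : E →ₗ[ℂ] K) : Submodule ℂ (WithLp 2 (H × K)) :=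
  (LinearMap.range (graphMap j A)).topologicalClosure

/-- The map `u ↦ (j u, A u)` into the closed graph. -/
def toGraphSpace (j : E →ₗ[ℂ] H) (A : E →ₗ[ℂ] K) : E →ₗ[ℂ] GraphSpace j A :=
  (graphMap j A).codRestrict _ fun u => Submodule.le_topologicalClosure _ ⟨u, rfl⟩

variable {j : E →ₗ[ℂ] H} {A : E →ₗ[ℂ] K} {B : E →ₗ[ℂ] K'}

theorem denseRange_toGraphSpace : DenseRange (toGraphSpace j A) := by
  rw [DenseRange, Subtype.dense_iff]
  intro x hx
  have h1 : x ∈ closure (LinearMap.range (graphMap j A) : Set (WithLp 2 (H × K))) := hx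
  refine closure_mono ?_ h1
  rintro _ ⟨u, rfl⟩
  exact ⟨toGraphSpace j A u, ⟨u, rfl⟩, rfl⟩

theorem norm_sq_toGraphSpace (u : E) : ‖toGraphSpace j A u‖ ^ 2 = ‖j u‖ ^ 2 + ‖A u‖ ^ 2 :=
  WithLp.prod_norm_sq_eq_of_L2 (graphMap j A u)

/-- This is the bound that `extendOfNorm` needs in order to extend `f` to the closed graph. `C` may
be negative, hence `√|C|`. -/
theorem exists_bound_toGraphSpace {F : Type*} [NormedAddCommGroup F] [NormedSpace ℂ F]
    (f : E →ₗ[ℂ] F) {C : ℝ} (h : ∀ u, ‖f u‖ ^ 2 ≤ C * (‖j u‖ ^ 2 + ‖A u‖ ^ 2)) :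
    ∃ C, ∀ u, ‖f u‖ ≤ C * ‖toGraphSpace j A u‖ := by
  refine ⟨√|C|, fun u => ?_⟩
  rw [← abs_of_nonneg (norm_nonneg (f u)), ← abs_of_nonneg (norm_nonneg (toGraphSpace j A u)),
    ← abs_of_nonneg (Real.sqrt_nonneg |C|), ← abs_mul, ← sq_le_sq, mul_pow, norm_sq_toGraphSpace,
    Real.sq_sqrt (abs_nonneg C)]
  exact (h u).trans (by gcongr; exact le_abs_self C)

theorem isSelfAdjoint_adjoint_comp_sub {G : Type*} [NormedAddCommGroup G] [InnerProductSpace ℂ G]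
    [CompleteSpace G] [CompleteSpace K] [CompleteSpace K'] (S : G →L[ℂ] K) (R : G →L[ℂ] K') :
    IsSelfAdjoint (S.adjoint ∘L S - R.adjoint ∘L R) := by
  rw [ContinuousLinearMap.isSelfAdjoint_iff']
  simp [map_sub, ContinuousLinearMap.adjoint_comp]

/-- The form `‖A u‖² - ‖B u‖²`, with `j u ↦ A u` closable and `B` relatively bounded with respect
to `A`, has a closure. The associated operator is self-adjoint; its negative spectrum is discrete
and the number of eigenvalues below `-τ` is at most the rank of a correction that makes the form
bounded below by `-τ`. -/
theorem exists_closure_and_operator [CompleteSpace H] [CompleteSpace K] [CompleteSpace K']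
    {q : E → ℝ} (hq : ∀ u, q u = ‖A u‖ ^ 2 - ‖B u‖ ^ 2) (hj : DenseRange j)
    (hcl : ∀ (φ : ℕ → E) (f : K), Tendsto (fun n => j (φ n)) atTop (𝓝 0) →
      Tendsto (fun n => A (φ n)) atTop (𝓝 f) → f = 0)
    {c : ℝ} (hB : ∀ u, ‖B u‖ ^ 2 ≤ (1 / 2) * ‖A u‖ ^ 2 + c * ‖j u‖ ^ 2)
    (hdisc : ∀ τ : ℝ, 0 < τ → ∃ n, BoundedBelowUpToRank j A B τ n) :
    ∃ (h : Form H) (T : H →ₗ.[ℂ] H), h.IsClosureOf j q ∧ IsAssociated T h ∧ IsSelfAdjoint T ∧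
      HasDiscreteNegSpectrum T ∧
      ∀ (τ : ℝ) (n : ℕ), BoundedBelowUpToRank j A B τ n → ∀ s : Finset ℝ, (∀ r ∈ s, r < -τ) →
        (∀ r ∈ s, FiniteDimensional ℂ (eigenspace T (r : ℝ))) ∧
          ∑ r ∈ s, Module.finrank ℂ (eigenspace T (r : ℝ)) ≤ n := by
  have hcomp : CompleteSpace (GraphSpace j A) :=
    (Submodule.isClosed_topologicalClosure _).completeSpace_coe
  set e := toGraphSpace j A with he
  have hde : DenseRange e := denseRange_toGraphSpace
  let J : GraphSpace j A →L[ℂ] H := WithLp.fstL 2 ℂ H K ∘L (GraphSpace j A).subtypeL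
  let A' : GraphSpace j A →L[ℂ] K := WithLp.sndL 2 ℂ H K ∘L (GraphSpace j A).subtypeL
  have hJe : ∀ u, J (e u) = j u := fun u => rfl
  have hAe : ∀ u, A' (e u) = A u := fun u => rfl
  have hn : ∀ x : GraphSpace j A, ‖x‖ ^ 2 = ‖J x‖ ^ 2 + ‖A' x‖ ^ 2 := fun x =>
    WithLp.prod_norm_sq_eq_of_L2 (x : WithLp 2 (H × K))
  have hBb := exists_bound_toGraphSpace B (j := j) (A := A) (C := 1 / 2 + |c|) (fun u => by
    refine (hB u).trans ?_
    have h1 : c * ‖j u‖ ^ 2 ≤ |c| * ‖j u‖ ^ 2 := by gcongr; exact le_abs_self c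
    have h2 : 0 ≤ |c| * ‖A u‖ ^ 2 := by positivity
    have h3 : 0 ≤ ‖j u‖ ^ 2 := by positivity
    linarith)
  let B' : GraphSpace j A →L[ℂ] K' := B.extendOfNorm e
  have hBe : ∀ u, B' (e u) = B u := LinearMap.extendOfNorm_eq hde hBb
  let M : GraphSpace j A →L[ℂ] GraphSpace j A := A'.adjoint ∘L A' - B'.adjoint ∘L B'
  have hMi : ∀ x, ⟪x, M x⟫_ℂ = ((‖A' x‖ ^ 2 - ‖B' x‖ ^ 2 : ℝ) : ℂ) := by
    intro x
    change ⟪x, A'.adjoint (A' x) - B'.adjoint (B' x)⟫_ℂ = _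
    rw [inner_sub_right, ContinuousLinearMap.adjoint_inner_right,
      ContinuousLinearMap.adjoint_inner_right, inner_self_eq_norm_sq_to_K,
      inner_self_eq_norm_sq_to_K]
    simp
  have hMr : ∀ x, (⟪x, M x⟫_ℂ).re = ‖A' x‖ ^ 2 - ‖B' x‖ ^ 2 := fun x => by
    rw [hMi, Complex.ofReal_re]
  have hMs : IsSelfAdjoint M := isSelfAdjoint_adjoint_comp_sub A' B'
  -- Closability is injectivity of the first projection on the closed graph: a kernel element is a
  -- limit of pairs `(j (φ n), A (φ n))` with `j (φ n) → 0`.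
  have hJinj : Function.Injective J := by
    rw [injective_iff_map_eq_zero]
    intro x hx
    obtain ⟨φ, hφ⟩ : ∃ φ : ℕ → E, Tendsto (fun n => e (φ n)) atTop (𝓝 x) := by
      obtain ⟨y, hy, hlim⟩ := mem_closure_iff_seq_limit.1 (hde x)
      choose φ hφ using hy
      exact ⟨φ, by simpa [hφ] using hlim⟩
    have h1 : Tendsto (fun n => j (φ n)) atTop (𝓝 0) := by
      rw [← hx]; exact (J.continuous.tendsto x).comp hφ
    have h2 : Tendsto (fun n => A (φ n)) atTop (𝓝 (A' x)) := (A'.continuous.tendsto x).comp hφ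
    have h3 := hcl φ _ h1 h2
    have h4 := hn x
    rw [hx, h3] at h4
    simpa using h4
  have hJd : DenseRange J := by
    refine hj.mono ?_
    rintro _ ⟨u, rfl⟩
    exact ⟨e u, rfl⟩
  have hB' : ∀ x, ‖B' x‖ ^ 2 ≤ (1 / 2) * ‖A' x‖ ^ 2 + c * ‖J x‖ ^ 2 := by
    intro x
    refine hde.induction_on (p := fun x => ‖B' x‖ ^ 2 ≤ (1 / 2) * ‖A' x‖ ^ 2 + c * ‖J x‖ ^ 2) x
      (isClosed_le (by fun_prop) (by fun_prop)) fun u => ?_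
    rw [hBe, hAe, hJe]
    exact hB u
  -- `B'` uses up at most half of `‖A' x‖²`; the other half and the added `(1/2) ‖J x‖²` make half
  -- of the graph norm squared.
  have hc : ∀ x, 1 / 2 * ‖x‖ ^ 2 ≤ (⟪x, M x⟫_ℂ).re + (c + 1 / 2) * ‖J x‖ ^ 2 := by
    intro x
    rw [hMr, hn]
    have := hB' x
    linarith
  have hΛ : ∀ (τ : ℝ) (n : ℕ), BoundedBelowUpToRank j A B τ n →
      ∃ Λ : GraphSpace j A →L[ℂ] EuclideanSpace ℂ (Fin n),
        ∀ x, 0 ≤ (⟪x, M x⟫_ℂ).re + τ * ‖J x‖ ^ 2 + ‖Λ x‖ ^ 2 := by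
    rintro τ n ⟨ℓ, ⟨C, hC⟩, hℓ⟩
    have hb := exists_bound_toGraphSpace ℓ hC
    let Λ : GraphSpace j A →L[ℂ] EuclideanSpace ℂ (Fin n) := ℓ.extendOfNorm e
    have hΛe : ∀ u, Λ (e u) = ℓ u := LinearMap.extendOfNorm_eq hde hb
    refine ⟨Λ, fun x => ?_⟩
    rw [hMr]
    refine hde.induction_on
      (p := fun x => 0 ≤ ‖A' x‖ ^ 2 - ‖B' x‖ ^ 2 + τ * ‖J x‖ ^ 2 + ‖Λ x‖ ^ 2) x
      (isClosed_le (by fun_prop) (by fun_prop)) fun u => ?_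
    rw [hBe, hAe, hJe, hΛe]
    have := hℓ u
    linarith
  refine ⟨formOf J hJinj M, opOf J M, ⟨formOf_isHermitian hJinj hMs,
    formOf_isSemibounded hJinj one_half_pos hc, formOf_isClosed hJinj one_half_pos hc, ?_, ?_⟩,
    opOf_isAssociated hJinj hJd, opOf_isSelfAdjoint hJinj hJd hMs one_half_pos hc, ?_, ?_⟩
  · intro u
    refine ⟨⟨e u, rfl⟩, ?_⟩
    refine (formOf_quad hJinj (e u) ⟨e u, rfl⟩).trans ?_
    rw [hMi, hAe, hBe, hq]
  · rintro ⟨_, x, rfl⟩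
    obtain ⟨φ, hφ⟩ : ∃ φ : ℕ → E, Tendsto (fun n => e (φ n)) atTop (𝓝 x) := by
      obtain ⟨y, hy, hlim⟩ := mem_closure_iff_seq_limit.1 (hde x)
      choose φ hφ using hy
      exact ⟨φ, by simpa [hφ] using hlim⟩
    refine ⟨φ, fun n => ⟨e (φ n), rfl⟩, (J.continuous.tendsto x).comp hφ, ?_⟩
    have hlim : Tendsto (fun n => ⟪e (φ n) - x, M (e (φ n) - x)⟫_ℂ) atTop (𝓝 0) := by
      have h1 : Tendsto (fun n => e (φ n) - x) atTop (𝓝 0) := by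
        simpa using hφ.sub_const x
      have h2 := h1.inner (𝕜 := ℂ) ((M.continuous.tendsto 0).comp h1)
      simpa only [map_zero, inner_zero_left, Function.comp_apply] using h2
    refine hlim.congr fun n => ?_
    rw [← formOf_quad hJinj (A := M) (e (φ n) - x) ⟨_, rfl⟩]
    congr 1
  · refine opOf_hasDiscreteNegSpectrum hJinj hJd hMs one_half_pos hc fun τ hτ => ?_
    obtain ⟨n, hn⟩ := hdisc τ hτ
    exact ⟨n, hΛ τ n hn⟩
  · intro τ n hτn s hs
    obtain ⟨Λ, hΛ⟩ := hΛ τ n hτn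
    simpa using sum_finrank_eigenspace_le hJinj hJd hMs hΛ s hs

end Closure

/-! ### Test functions on the half-line -/

section TestFunctions

theorem exists_support_Ioo {S : Set ℝ} (hS : IsCompact S) (hS0 : S ⊆ Ioi 0) :
    ∃ m R : ℝ, 0 < m ∧ m < R ∧ S ⊆ Ioo m R := by
  rcases S.eq_empty_or_nonempty with rfl | hne
  · exact ⟨1, 2, by norm_num, by norm_num, by simp⟩
  · obtain ⟨a, haS, ha⟩ := hS.exists_isLeast hne
    obtain ⟨b, hbS, hb⟩ := hS.exists_isGreatest hne
    have ha0 : 0 < a := hS0 haS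
    have hab : a ≤ b := ha hbS
    refine ⟨a / 2, b + 1, by linarith, by linarith, fun x hx => ⟨?_, ?_⟩⟩
    · have := ha hx; linarith
    · have := hb hx; linarith

variable {F : Type*} [NormedAddCommGroup F] [NormedSpace ℝ F]

theorem integral_Ioi_eq_intervalIntegral {f : ℝ → F} {m R : ℝ} (hm : 0 ≤ m) (hmR : m ≤ R)
    (hf : ∀ x, x ∉ Ioo m R → f x = 0) : ∫ x in Ioi 0, f x = ∫ x in m..R, f x := by
  rw [intervalIntegral.integral_of_le hmR]
  refine (setIntegral_eq_of_subset_of_forall_sdiff_eq_zero measurableSet_Ioi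
    (fun x hx => lt_of_le_of_lt hm hx.1) fun x hx => hf x fun h => hx.2 ⟨h.1, h.2.le⟩)

/-- The integral of the derivative of a function with compact support in `(0, ∞)` vanishes. -/
theorem integral_Ioi_deriv_eq_zero [CompleteSpace F] {G G' : ℝ → F} {S : Set ℝ} (hS : IsCompact S)
    (hS0 : S ⊆ Ioi 0) (hG : ∀ x ∉ S, G x = 0) (hd : ∀ x, 0 < x → HasDerivAt G (G' x) x)
    (hG' : ∀ x ∉ S, G' x = 0) (hc : ContinuousOn G' (Ioi 0)) : ∫ x in Ioi 0, G' x = 0 := by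
  obtain ⟨m, R, hm, hmR, hsub⟩ := exists_support_Ioo hS hS0
  rw [integral_Ioi_eq_intervalIntegral hm.le hmR.le fun x hx => hG' x fun h => hx (hsub h)]
  have hpos : ∀ x ∈ uIcc m R, 0 < x := fun x hx => by
    rw [uIcc_of_le hmR.le] at hx
    exact hm.trans_le hx.1
  rw [intervalIntegral.integral_eq_sub_of_hasDerivAt (fun x hx => hd x (hpos x hx))
    (hc.mono fun x hx => hpos x hx).intervalIntegrable,
    hG R fun h => lt_irrefl _ (hsub h).2, hG m fun h => lt_irrefl _ (hsub h).1, sub_zero]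

/-- Multiplication by a coefficient that is continuous on `(0, ∞)` preserves continuity of
functions supported in `(0, ∞)`. -/
theorem continuous_smul_of_tsupport {c : ℝ → ℝ} (hc : ContinuousOn c (Ioi 0)) {g : ℝ → F}
    (hg : Continuous g) (hs : tsupport g ⊆ Ioi 0) : Continuous fun x => c x • g x := by
  refine continuous_of_tsupport fun x hx => ?_
  have hx' : x ∈ tsupport g := tsupport_smul_subset_right c g hx
  exact (hc.continuousAt (Ioi_mem_nhds (hs hx'))).smul hg.continuousAt

variable (u v : 𝓓(halfLine, ℂ))

theorem tsupport_test : tsupport u ⊆ Ioi 0 := u.tsupport_subset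

theorem tsupport_deriv_test : tsupport (deriv u) ⊆ Ioi 0 :=
  (tsupport_deriv_subset (𝕜 := ℝ)).trans (tsupport_test u)

theorem contDiff_test : ContDiff ℝ 2 u := contDiff_infty.1 u.contDiff 2

theorem contDiff_deriv_test : ContDiff ℝ 1 (deriv u) := by
  have := contDiff_test u
  rw [show (2 : WithTop ℕ∞) = 1 + 1 by norm_num, contDiff_succ_iff_deriv] at this
  exact this.2.2

theorem continuous_deriv_test : Continuous (deriv u) := (contDiff_deriv_test u).continuous

theorem continuous_deriv_deriv_test : Continuous (deriv (deriv u)) :=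
  (contDiff_deriv_test u).continuous_deriv le_rfl

theorem hasDerivAt_test (x : ℝ) : HasDerivAt u (deriv u x) x :=
  ((contDiff_test u).differentiable (by norm_num) x).hasDerivAt

theorem hasDerivAt_deriv_test (x : ℝ) : HasDerivAt (deriv u) (deriv (deriv u) x) x :=
  ((contDiff_deriv_test u).differentiable (by norm_num) x).hasDerivAt

theorem deriv_add_test : deriv ⇑(u + v) = deriv u + deriv v := by
  funext x
  exact ((hasDerivAt_test u x).add (hasDerivAt_test v x)).deriv

theorem deriv_smul_test (c : ℂ) : deriv ⇑(c • u) = c • deriv u := by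
  funext x
  exact ((hasDerivAt_test u x).const_smul c).deriv

theorem deriv_deriv_add_test :
    deriv (deriv ⇑(u + v)) = deriv (deriv u) + deriv (deriv v) := by
  rw [deriv_add_test]
  funext x
  exact ((hasDerivAt_deriv_test u x).add (hasDerivAt_deriv_test v x)).deriv

theorem deriv_deriv_smul_test (c : ℂ) : deriv (deriv ⇑(c • u)) = c • deriv (deriv u) := by
  rw [deriv_smul_test]
  funext x
  exact ((hasDerivAt_deriv_test u x).const_smul c).deriv

variable {u} in
theorem test_eq_zero {x : ℝ} (hx : x ∉ tsupport u) : u x = 0 := image_eq_zero_of_notMem_tsupport hx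

variable {u} in
theorem deriv_test_eq_zero {x : ℝ} (hx : x ∉ tsupport u) : deriv u x = 0 :=
  image_eq_zero_of_notMem_tsupport fun h => hx (tsupport_deriv_subset (𝕜 := ℝ) h)

variable {u} in
theorem deriv_deriv_test_eq_zero {x : ℝ} (hx : x ∉ tsupport u) : deriv (deriv u) x = 0 :=
  image_eq_zero_of_notMem_tsupport fun h =>
    hx (tsupport_deriv_subset (𝕜 := ℝ) (tsupport_deriv_subset (𝕜 := ℝ) h))

/-- The linear map into `L²(0, ∞)` given by a linear operator on test functions whose values are
square integrable. -/
def toL2Of (D : 𝓓(halfLine, ℂ) → ℝ → ℂ) (hadd : ∀ u v, D (u + v) = D u + D v)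
    (hsmul : ∀ (c : ℂ) u, D (c • u) = c • D u)
    (hmem : ∀ u, MemLp (D u) 2 ((volume : Measure ℝ).restrict (Ioi 0))) :
    𝓓(halfLine, ℂ) →ₗ[ℂ] L2 where
  toFun u := (hmem u).toLp (D u)
  map_add' u v := by
    rw [← MemLp.toLp_add]
    exact MemLp.toLp_congr _ _ (by rw [hadd])
  map_smul' c u := by
    rw [RingHom.id_apply, ← MemLp.toLp_const_smul]
    exact MemLp.toLp_congr _ _ (by rw [hsmul])

theorem inner_toLp {f g : ℝ → ℂ} (hf : MemLp f 2 ((volume : Measure ℝ).restrict (Ioi 0)))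
    (hg : MemLp g 2 ((volume : Measure ℝ).restrict (Ioi 0))) :
    ⟪hf.toLp f, hg.toLp g⟫_ℂ = ∫ x in Ioi 0, starRingEnd ℂ (f x) * g x := by
  rw [L2.inner_def]
  refine integral_congr_ae ?_
  filter_upwards [hf.coeFn_toLp, hg.coeFn_toLp] with x hx hy
  rw [hx, hy, RCLike.inner_apply, mul_comm]

theorem norm_sq_toLp {f : ℝ → ℂ} (hf : MemLp f 2 ((volume : Measure ℝ).restrict (Ioi 0))) :
    ‖hf.toLp f‖ ^ 2 = ∫ x in Ioi 0, ‖f x‖ ^ 2 := by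
  have h : ((‖hf.toLp f‖ ^ 2 : ℝ) : ℂ) = ((∫ x in Ioi 0, ‖f x‖ ^ 2 : ℝ) : ℂ) := by
    rw [← integral_complex_ofReal, Complex.ofReal_pow]
    refine (inner_self_eq_norm_sq_to_K (𝕜 := ℂ) (hf.toLp f)).symm.trans ?_
    rw [inner_toLp]
    refine integral_congr_ae (Eventually.of_forall fun x => ?_)
    simp only
    rw [← Complex.normSq_eq_conj_mul_self, Complex.normSq_eq_norm_sq]
  exact_mod_cast h

theorem norm_sq_toL2 : ‖toL2 u‖ ^ 2 = ∫ x in Ioi 0, ‖u x‖ ^ 2 :=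
  norm_sq_toLp (memLp_test u)

/-- An element of `L²(0, ∞)` that is orthogonal to all test functions vanishes. -/
theorem eq_zero_of_inner_toL2 {f : L2} (h : ∀ u, ⟪toL2 u, f⟫_ℂ = 0) : f = 0 := by
  rw [Lp.eq_zero_iff_ae_eq_zero]
  have hloc : LocallyIntegrableOn f (Ioi 0) ((volume : Measure ℝ).restrict (Ioi 0)) :=
    ((Lp.memLp f).locallyIntegrable (by norm_num)).locallyIntegrableOn _
  have h0 := isOpen_Ioi.ae_eq_zero_of_integral_contDiff_smul_eq_zero hloc fun g hg hgc hgs => by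
    let φ : 𝓓(halfLine, ℂ) :=
      ⟨fun x => (g x : ℂ), Complex.ofRealCLM.contDiff.comp hg,
        hgc.comp_left (g := fun r : ℝ => (r : ℂ)) Complex.ofReal_zero,
        (closure_mono (fun x hx => by
          simpa using hx)).trans hgs⟩
    have h1 := h φ
    have h2 : toL2 φ = (memLp_test φ).toLp φ := rfl
    rw [h2, ← Lp.toLp_coeFn f (Lp.memLp f), inner_toLp] at h1
    rw [← h1]
    refine integral_congr_ae (Eventually.of_forall fun x => ?_)
    change g x • f x = starRingEnd ℂ (g x : ℂ) * f x
    rw [Complex.conj_ofReal, Complex.real_smul]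
  filter_upwards [h0, ae_restrict_mem measurableSet_Ioi] with x hx hx'
  exact hx hx'

theorem denseRange_toL2 : DenseRange toL2 := by
  have : Dense (LinearMap.range toL2 : Set L2) := by
    rw [Submodule.dense_iff_topologicalClosure_eq_top, Submodule.topologicalClosure_eq_top_iff,
      Submodule.eq_bot_iff]
    intro f hf
    rw [Submodule.mem_orthogonal] at hf
    exact eq_zero_of_inner_toL2 fun u => hf _ ⟨u, rfl⟩
  exact this

end TestFunctions

/-! ### The ground state representation of the Hardy–Rellich form

With `w = x ^ (-3/2) u` and `D = x d/dx` one has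
`∫ (|u''|² - (9/16) |u|² / x⁴) dx = ∫ (|D² w|² + (5/2) |D w|²) dx / x`. -/

section GroundState

/-- `x ^ (-1/2) D² w` with `w = x ^ (-3/2) u` and `D = x d/dx`. -/
def secondOrder (u : ℝ → ℂ) (x : ℝ) : ℂ :=
  deriv (deriv u) x - (2 / x) • deriv u x + (9 / 4 / x ^ 2) • u x

/-- `x ^ (-1/2) D w` with `w = x ^ (-3/2) u` and `D = x d/dx`. -/
def firstOrder (u : ℝ → ℂ) (x : ℝ) : ℂ := (1 / x) • deriv u x - (3 / 2 / x ^ 2) • u x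

theorem continuousOn_div_pow (c : ℝ) (n : ℕ) : ContinuousOn (fun x : ℝ => c / x ^ n) (Ioi 0) :=
  continuousOn_const.div (continuousOn_id.pow n) fun _ hx => pow_ne_zero n (ne_of_gt hx)

variable (u v : 𝓓(halfLine, ℂ))

theorem continuous_div_pow_smul_test (c : ℝ) (n : ℕ) : Continuous fun x => (c / x ^ n) • u x :=
  continuous_smul_of_tsupport (continuousOn_div_pow c n) u.continuous (tsupport_test u)

theorem continuous_div_pow_smul_deriv_test (c : ℝ) (n : ℕ) :
    Continuous fun x => (c / x ^ n) • deriv u x :=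
  continuous_smul_of_tsupport (continuousOn_div_pow c n) (continuous_deriv_test u)
    (tsupport_deriv_test u)

theorem continuous_secondOrder : Continuous (secondOrder u) := by
  have h1 := continuous_div_pow_smul_deriv_test u 2 1
  simp only [pow_one] at h1
  exact ((continuous_deriv_deriv_test u).sub h1).add (continuous_div_pow_smul_test u _ 2)

theorem continuous_firstOrder : Continuous (firstOrder u) := by
  have h1 := continuous_div_pow_smul_deriv_test u 1 1
  simp only [pow_one] at h1
  exact h1.sub (continuous_div_pow_smul_test u _ 2)

variable {u} in
theorem secondOrder_eq_zero {x : ℝ} (hx : x ∉ tsupport u) : secondOrder u x = 0 := by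
  simp [secondOrder, test_eq_zero hx, deriv_test_eq_zero hx, deriv_deriv_test_eq_zero hx]

variable {u} in
theorem firstOrder_eq_zero {x : ℝ} (hx : x ∉ tsupport u) : firstOrder u x = 0 := by
  simp [firstOrder, test_eq_zero hx, deriv_test_eq_zero hx]

theorem hasCompactSupport_secondOrder : HasCompactSupport (secondOrder u) :=
  HasCompactSupport.intro u.hasCompactSupport fun _ hx => secondOrder_eq_zero hx

theorem hasCompactSupport_firstOrder : HasCompactSupport (firstOrder u) :=
  HasCompactSupport.intro u.hasCompactSupport fun _ hx => firstOrder_eq_zero hx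

theorem memLp_secondOrder : MemLp (secondOrder u) 2 ((volume : Measure ℝ).restrict (Ioi 0)) :=
  (continuous_secondOrder u).memLp_of_hasCompactSupport (hasCompactSupport_secondOrder u)

theorem memLp_firstOrder : MemLp (firstOrder u) 2 ((volume : Measure ℝ).restrict (Ioi 0)) :=
  (continuous_firstOrder u).memLp_of_hasCompactSupport (hasCompactSupport_firstOrder u)

/-- The operator `u ↦ x ^ (-1/2) D² w` from test functions to `L²(0, ∞)`. -/
def secondOrderL2 : 𝓓(halfLine, ℂ) →ₗ[ℂ] L2 :=
  toL2Of (fun u => secondOrder u)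
    (fun u v => by
      funext x
      rw [secondOrder, deriv_deriv_add_test, deriv_add_test]
      simp only [secondOrder, Pi.add_apply, add_apply, smul_add]
      ring)
    (fun c u => by
      funext x
      rw [secondOrder, deriv_deriv_smul_test, deriv_smul_test]
      simp only [secondOrder, Pi.smul_apply, smul_apply, smul_eq_mul, Complex.real_smul]
      ring)
    memLp_secondOrder

/-- The operator `u ↦ (5/2) ^ (1/2) x ^ (-1/2) D w` from test functions to `L²(0, ∞)`. -/
def firstOrderL2 : 𝓓(halfLine, ℂ) →ₗ[ℂ] L2 :=
  ((√(5 / 2) : ℝ) : ℂ) • toL2Of (fun u => firstOrder u)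
    (fun u v => by
      funext x
      simp only [firstOrder, deriv_add_test, Pi.add_apply, add_apply, smul_add]
      ring)
    (fun c u => by
      funext x
      simp only [firstOrder, deriv_smul_test, Pi.smul_apply, smul_apply,
        smul_eq_mul, Complex.real_smul]
      ring)
    memLp_firstOrder

theorem norm_sq_secondOrderL2 :
    ‖secondOrderL2 u‖ ^ 2 = ∫ x in Ioi 0, ‖secondOrder u x‖ ^ 2 :=
  norm_sq_toLp (memLp_secondOrder u)

theorem norm_sq_firstOrderL2 :
    ‖firstOrderL2 u‖ ^ 2 = 5 / 2 * ∫ x in Ioi 0, ‖firstOrder u x‖ ^ 2 := by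
  have h : firstOrderL2 u =
      ((√(5 / 2) : ℝ) : ℂ) • (memLp_firstOrder u).toLp (firstOrder u) := rfl
  rw [h, norm_smul, mul_pow, norm_sq_toLp, Complex.norm_real, Real.norm_eq_abs, sq_abs,
    Real.sq_sqrt (by norm_num)]

/-- The operator `u ↦ x ^ (-1/2) (D² w, (5/2) ^ (1/2) D w)`. -/
def hardyOp : 𝓓(halfLine, ℂ) →ₗ[ℂ] WithLp 2 (L2 × L2) := graphMap secondOrderL2 firstOrderL2

/-- The density `|x ^ (-1/2) D² w|² + (5/2) |x ^ (-1/2) D w|²`. -/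
def hardyDensity (u : ℝ → ℂ) (x : ℝ) : ℝ := ‖secondOrder u x‖ ^ 2 + 5 / 2 * ‖firstOrder u x‖ ^ 2

theorem hardyDensity_nonneg (u : ℝ → ℂ) (x : ℝ) : 0 ≤ hardyDensity u x := by
  rw [hardyDensity]; positivity

theorem continuous_hardyDensity : Continuous (hardyDensity u) := by
  have h1 := continuous_secondOrder u
  have h2 := continuous_firstOrder u
  unfold hardyDensity
  fun_prop

variable {u} in
theorem hardyDensity_eq_zero {x : ℝ} (hx : x ∉ tsupport u) : hardyDensity u x = 0 := by
  simp [hardyDensity, secondOrder_eq_zero hx, firstOrder_eq_zero hx]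

theorem hasCompactSupport_hardyDensity : HasCompactSupport (hardyDensity u) :=
  HasCompactSupport.intro u.hasCompactSupport fun _ hx => hardyDensity_eq_zero hx

theorem integrable_hardyDensity : Integrable (hardyDensity u) :=
  (continuous_hardyDensity u).integrable_of_hasCompactSupport (hasCompactSupport_hardyDensity u)

theorem integrableOn_norm_sq {f : ℝ → ℂ}
    (hf : MemLp f 2 ((volume : Measure ℝ).restrict (Ioi 0))) :
    IntegrableOn (fun x => ‖f x‖ ^ 2) (Ioi 0) := by
  exact (memLp_two_iff_integrable_sq_norm hf.1).1 hf

theorem norm_sq_hardyOp : ‖hardyOp u‖ ^ 2 = ∫ x in Ioi 0, hardyDensity u x := by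
  have h : ‖hardyOp u‖ ^ 2 = ‖secondOrderL2 u‖ ^ 2 + ‖firstOrderL2 u‖ ^ 2 :=
    WithLp.prod_norm_sq_eq_of_L2 (hardyOp u)
  rw [h, norm_sq_secondOrderL2, norm_sq_firstOrderL2, ← integral_const_mul, ← integral_add]
  · rfl
  · exact integrableOn_norm_sq (memLp_secondOrder u)
  · exact (integrableOn_norm_sq (memLp_firstOrder u)).const_mul _

/-- The boundary term of the ground state representation, for a real function with derivatives
`a₁`, `a₂`. -/
theorem hasDerivAt_boundary {a a₁ : ℝ → ℝ} {b c x : ℝ} (hx : x ≠ 0) (ha : HasDerivAt a b x)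
    (hb : b = a₁ x) (ha₁ : HasDerivAt a₁ c x) :
    HasDerivAt (fun x => 2 * a₁ x ^ 2 / x - 9 / 2 * (a₁ x * a x) / x ^ 2 + 15 / 4 * a x ^ 2 / x ^ 3)
      (c ^ 2 - 9 / 16 * (a x ^ 2 / x ^ 4) - ((c - 2 / x * a₁ x + 9 / 4 / x ^ 2 * a x) ^ 2
        + 5 / 2 * (1 / x * a₁ x - 3 / 2 / x ^ 2 * a x) ^ 2)) x := by
  subst hb
  have h1 := ((ha₁.pow 2).const_mul 2).div (hasDerivAt_id x) hx
  have h2 := (((ha₁.mul ha).const_mul (9 / 2)).div ((hasDerivAt_id x).pow 2) (pow_ne_zero 2 hx))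
  have h3 := (((ha.pow 2).const_mul (15 / 4)).div ((hasDerivAt_id x).pow 3) (pow_ne_zero 3 hx))
  convert! (h1.sub h2).add h3 using 1
  simp only [id, Pi.pow_apply, Pi.mul_apply]
  field_simp
  ring

theorem continuous_hardyRellich : Continuous fun x : ℝ => ‖deriv (deriv u) x‖ ^ 2
    - hardyRellichConst * (‖u x‖ ^ 2 / x ^ 4) := by
  have h1 := continuous_deriv_deriv_test u
  have h2 := (continuous_div_pow_smul_test u 1 2).norm
  have h3 : (fun x : ℝ => ‖u x‖ ^ 2 / x ^ 4) = fun x => ‖(1 / x ^ 2) • u x‖ ^ 2 := by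
    funext x
    rw [norm_smul, mul_pow, Real.norm_eq_abs, sq_abs, div_pow, ← pow_mul]
    ring
  have h4 : Continuous fun x : ℝ => ‖u x‖ ^ 2 / x ^ 4 := by
    rw [h3]; fun_prop
  fun_prop

variable {u} in
theorem hardyRellich_eq_zero {x : ℝ} (hx : x ∉ tsupport u) :
    ‖deriv (deriv u) x‖ ^ 2 - hardyRellichConst * (‖u x‖ ^ 2 / x ^ 4) = 0 := by
  simp [test_eq_zero hx, deriv_deriv_test_eq_zero hx]

theorem integrable_hardyRellich : Integrable fun x : ℝ => ‖deriv (deriv u) x‖ ^ 2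
    - hardyRellichConst * (‖u x‖ ^ 2 / x ^ 4) :=
  (continuous_hardyRellich u).integrable_of_hasCompactSupport
    (HasCompactSupport.intro u.hasCompactSupport fun _ hx => hardyRellich_eq_zero hx)

/-- The two densities differ by the exact derivative computed in `hasDerivAt_boundary`, applied to
the real and imaginary parts. The boundary term has compact support in `(0, ∞)`, so its derivative
integrates to zero. -/
theorem integral_hardyDensity :
    ∫ x in Ioi 0, (‖deriv (deriv u) x‖ ^ 2 - hardyRellichConst * (‖u x‖ ^ 2 / x ^ 4)) =
      ∫ x in Ioi 0, hardyDensity u x := by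
  rw [← sub_eq_zero, ← integral_sub (integrable_hardyRellich u).integrableOn
    (integrable_hardyDensity u).integrableOn]
  refine integral_Ioi_deriv_eq_zero (S := tsupport u) (G := fun x =>
    (2 * (deriv u x).re ^ 2 / x - 9 / 2 * ((deriv u x).re * (u x).re) / x ^ 2
      + 15 / 4 * (u x).re ^ 2 / x ^ 3) +
    (2 * (deriv u x).im ^ 2 / x - 9 / 2 * ((deriv u x).im * (u x).im) / x ^ 2
      + 15 / 4 * (u x).im ^ 2 / x ^ 3)) u.hasCompactSupport (tsupport_test u) ?_ ?_ ?_ ?_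
  · intro x hx
    simp [test_eq_zero hx, deriv_test_eq_zero hx]
  · intro x hx
    have r0 := Complex.reCLM.hasFDerivAt.comp_hasDerivAt x (hasDerivAt_test u x)
    have r1 := Complex.reCLM.hasFDerivAt.comp_hasDerivAt x (hasDerivAt_deriv_test u x)
    have i0 := Complex.imCLM.hasFDerivAt.comp_hasDerivAt x (hasDerivAt_test u x)
    have i1 := Complex.imCLM.hasFDerivAt.comp_hasDerivAt x (hasDerivAt_deriv_test u x)
    have hr := hasDerivAt_boundary hx.ne' r0 (a₁ := Complex.reCLM ∘ deriv u) rfl r1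
    have hi := hasDerivAt_boundary hx.ne' i0 (a₁ := Complex.imCLM ∘ deriv u) rfl i1
    convert! hr.add hi using 1
    simp only [hardyDensity, secondOrder, firstOrder, hardyRellichConst, Complex.sq_norm,
      Complex.normSq_apply, Complex.add_re, Complex.sub_re, Complex.smul_re, Complex.add_im,
      Complex.sub_im, Complex.smul_im, Function.comp_apply, Complex.reCLM_apply,
      Complex.imCLM_apply, smul_eq_mul]
    ring
  · intro x hx
    rw [hardyRellich_eq_zero hx, hardyDensity_eq_zero hx, sub_zero]
  · exact ((continuous_hardyRellich u).sub (continuous_hardyDensity u)).continuousOn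

theorem hasDerivAt_conj {f : ℝ → ℂ} {f' : ℂ} {x : ℝ} (hf : HasDerivAt f f' x) :
    HasDerivAt (fun x => starRingEnd ℂ (f x)) (starRingEnd ℂ f') x := hf.star

/-- The formal adjoint of `secondOrder`. -/
theorem integral_conj_mul_secondOrder (φ : 𝓓(halfLine, ℂ)) :
    ∃ g : ℝ → ℂ, MemLp g 2 ((volume : Measure ℝ).restrict (Ioi 0)) ∧ ∀ u : 𝓓(halfLine, ℂ),
      ∫ x in Ioi 0, starRingEnd ℂ (φ x) * secondOrder u x =
        ∫ x in Ioi 0, starRingEnd ℂ (g x) * u x := by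
  set g : ℝ → ℂ := fun x => deriv (deriv φ) x + (2 / x) • deriv φ x + (1 / 4 / x ^ 2) • φ x with hg
  have hgc : Continuous g := by
    have h1 := continuous_div_pow_smul_deriv_test φ 2 1
    simp only [pow_one] at h1
    exact ((continuous_deriv_deriv_test φ).add h1).add (continuous_div_pow_smul_test φ _ 2)
  have hgz : ∀ x ∉ tsupport φ, g x = 0 := fun x hx => by
    simp [hg, test_eq_zero hx, deriv_test_eq_zero hx, deriv_deriv_test_eq_zero hx]
  refine ⟨g, hgc.memLp_of_hasCompactSupport (HasCompactSupport.intro φ.hasCompactSupport hgz),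
    fun u => ?_⟩
  have hc1 : Continuous fun x => starRingEnd ℂ (φ x) * secondOrder u x :=
    (Complex.continuous_conj.comp φ.continuous).mul (continuous_secondOrder u)
  have hc2 : Continuous fun x => starRingEnd ℂ (g x) * u x :=
    (Complex.continuous_conj.comp hgc).mul u.continuous
  have hi1 := hc1.integrable_of_hasCompactSupport (μ := volume)
    (hasCompactSupport_secondOrder u).mul_left
  have hi2 := hc2.integrable_of_hasCompactSupport (μ := volume) u.hasCompactSupport.mul_left
  rw [← sub_eq_zero, ← integral_sub hi1.integrableOn hi2.integrableOn]
  refine integral_Ioi_deriv_eq_zero (S := tsupport u) (G := fun x =>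
    starRingEnd ℂ (φ x) * deriv u x - starRingEnd ℂ (deriv φ x) * u x
      - 2 * (starRingEnd ℂ (φ x) * u x) / (x : ℂ)) u.hasCompactSupport (tsupport_test u) ?_ ?_ ?_ ?_
  · intro x hx
    simp [test_eq_zero hx, deriv_test_eq_zero hx]
  · intro x hx
    have hx0 : (x : ℂ) ≠ 0 := by exact_mod_cast hx.ne'
    have p0 := hasDerivAt_conj (hasDerivAt_test φ x)
    have p1 := hasDerivAt_conj (hasDerivAt_deriv_test φ x)
    have u0 := hasDerivAt_test u x
    have u1 := hasDerivAt_deriv_test u x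
    have hX : HasDerivAt (fun x : ℝ => (x : ℂ)) 1 x := Complex.ofRealCLM.hasDerivAt
    convert! ((p0.mul u1).sub (p1.mul u0)).sub (((p0.mul u0).const_mul 2).div hX hx0) using 1
    simp only [hg, secondOrder, map_add, Complex.real_smul, map_mul, Complex.conj_ofReal,
      Pi.mul_apply]
    push_cast
    field_simp
    ring
  · intro x hx
    rw [secondOrder_eq_zero hx, test_eq_zero hx]
    simp
  · exact (hc1.sub hc2).continuousOn

/-- The formal adjoint of `firstOrder`. -/
theorem integral_conj_mul_firstOrder (φ : 𝓓(halfLine, ℂ)) :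
    ∃ g : ℝ → ℂ, MemLp g 2 ((volume : Measure ℝ).restrict (Ioi 0)) ∧ ∀ u : 𝓓(halfLine, ℂ),
      ∫ x in Ioi 0, starRingEnd ℂ (φ x) * firstOrder u x =
        ∫ x in Ioi 0, starRingEnd ℂ (g x) * u x := by
  set g : ℝ → ℂ := fun x => -((1 / x) • deriv φ x) - (1 / 2 / x ^ 2) • φ x with hg
  have hgc : Continuous g := by
    have h1 := continuous_div_pow_smul_deriv_test φ 1 1
    simp only [pow_one] at h1
    exact h1.neg.sub (continuous_div_pow_smul_test φ _ 2)
  have hgz : ∀ x ∉ tsupport φ, g x = 0 := fun x hx => by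
    simp [hg, test_eq_zero hx, deriv_test_eq_zero hx]
  refine ⟨g, hgc.memLp_of_hasCompactSupport (HasCompactSupport.intro φ.hasCompactSupport hgz),
    fun u => ?_⟩
  have hc1 : Continuous fun x => starRingEnd ℂ (φ x) * firstOrder u x :=
    (Complex.continuous_conj.comp φ.continuous).mul (continuous_firstOrder u)
  have hc2 : Continuous fun x => starRingEnd ℂ (g x) * u x :=
    (Complex.continuous_conj.comp hgc).mul u.continuous
  have hi1 := hc1.integrable_of_hasCompactSupport (μ := volume)
    (hasCompactSupport_firstOrder u).mul_left
  have hi2 := hc2.integrable_of_hasCompactSupport (μ := volume) u.hasCompactSupport.mul_left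
  rw [← sub_eq_zero, ← integral_sub hi1.integrableOn hi2.integrableOn]
  refine integral_Ioi_deriv_eq_zero (S := tsupport u) (G := fun x =>
    starRingEnd ℂ (φ x) * u x / (x : ℂ)) u.hasCompactSupport (tsupport_test u) ?_ ?_ ?_ ?_
  · intro x hx
    simp [test_eq_zero hx]
  · intro x hx
    have hx0 : (x : ℂ) ≠ 0 := by exact_mod_cast hx.ne'
    have p0 := hasDerivAt_conj (hasDerivAt_test φ x)
    have u0 := hasDerivAt_test u x
    have hX : HasDerivAt (fun x : ℝ => (x : ℂ)) 1 x := Complex.ofRealCLM.hasDerivAt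
    convert! (p0.mul u0).div hX hx0 using 1
    simp only [hg, firstOrder, map_sub, map_neg, Complex.real_smul, map_mul, Complex.conj_ofReal,
      Pi.mul_apply]
    push_cast
    field_simp
    ring
  · intro x hx
    rw [firstOrder_eq_zero hx, test_eq_zero hx]
    simp
  · exact (hc1.sub hc2).continuousOn

/-- An operator on test functions with a densely defined formal adjoint is closable. -/
theorem eq_zero_of_tendsto_toLp {D : 𝓓(halfLine, ℂ) → ℝ → ℂ}
    (hmem : ∀ u, MemLp (D u) 2 ((volume : Measure ℝ).restrict (Ioi 0)))
    (hadj : ∀ φ : 𝓓(halfLine, ℂ), ∃ g : ℝ → ℂ,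
      MemLp g 2 ((volume : Measure ℝ).restrict (Ioi 0)) ∧ ∀ u : 𝓓(halfLine, ℂ),
        ∫ x in Ioi 0, starRingEnd ℂ (φ x) * D u x = ∫ x in Ioi 0, starRingEnd ℂ (g x) * u x)
    {ψ : ℕ → 𝓓(halfLine, ℂ)} {f : L2} (h0 : Tendsto (fun n => toL2 (ψ n)) atTop (𝓝 0))
    (hf : Tendsto (fun n => (hmem (ψ n)).toLp (D (ψ n))) atTop (𝓝 f)) : f = 0 := by
  refine eq_zero_of_inner_toL2 fun φ => ?_
  obtain ⟨g, hg, hgu⟩ := hadj φ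
  have h1 : Tendsto (fun n => ⟪toL2 φ, (hmem (ψ n)).toLp (D (ψ n))⟫_ℂ) atTop
      (𝓝 ⟪toL2 φ, f⟫_ℂ) := tendsto_const_nhds.inner hf
  have h2 : Tendsto (fun n => ⟪hg.toLp g, toL2 (ψ n)⟫_ℂ) atTop (𝓝 ⟪hg.toLp g, (0 : L2)⟫_ℂ) :=
    tendsto_const_nhds.inner h0
  rw [inner_zero_right] at h2
  refine tendsto_nhds_unique h1 (h2.congr fun n => ?_)
  refine (inner_toLp hg (memLp_test (ψ n))).trans ((hgu (ψ n)).symm.trans ?_)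
  exact (inner_toLp (memLp_test φ) (hmem (ψ n))).symm

/-- Both components have formal adjoints defined on all test functions, which are dense; the factor
`√(5/2)` is divided out first. -/
theorem hardyOp_closable (ψ : ℕ → 𝓓(halfLine, ℂ)) (f : WithLp 2 (L2 × L2))
    (h0 : Tendsto (fun n => toL2 (ψ n)) atTop (𝓝 0))
    (hf : Tendsto (fun n => hardyOp (ψ n)) atTop (𝓝 f)) : f = 0 := by
  have h1 : Tendsto (fun n => secondOrderL2 (ψ n)) atTop (𝓝 f.fst) :=
    ((WithLp.fstL 2 ℂ L2 L2).continuous.tendsto f).comp hf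
  have h2 : Tendsto (fun n => firstOrderL2 (ψ n)) atTop (𝓝 f.snd) :=
    ((WithLp.sndL 2 ℂ L2 L2).continuous.tendsto f).comp hf
  have h3 : f.fst = 0 :=
    eq_zero_of_tendsto_toLp memLp_secondOrder integral_conj_mul_secondOrder h0 h1
  have hs : ((√(5 / 2) : ℝ) : ℂ) ≠ 0 := by
    rw [Complex.ofReal_ne_zero]; positivity
  have h4 : Tendsto (fun n => (memLp_firstOrder (ψ n)).toLp (firstOrder (ψ n))) atTop
      (𝓝 (((√(5 / 2) : ℝ) : ℂ)⁻¹ • f.snd)) := by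
    refine (h2.const_smul (((√(5 / 2) : ℝ) : ℂ)⁻¹)).congr fun n => ?_
    exact inv_smul_smul₀ hs _
  have h5 := eq_zero_of_tendsto_toLp memLp_firstOrder integral_conj_mul_firstOrder h0 h4
  have h6 : f.snd = 0 := (smul_eq_zero.1 h5).resolve_left (inv_ne_zero hs)
  have h7 := WithLp.prod_norm_sq_eq_of_L2 f
  rw [h3, h6] at h7
  simpa using h7

end GroundState

/-! ### Pointwise bounds on an interval -/

section Pointwise

/-- The Cauchy–Schwarz inequality on an interval. -/
theorem sq_intervalIntegral_le {f : ℝ → ℝ} (hf : Continuous f) {α β : ℝ} (h : α ≤ β) :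
    (∫ s in α..β, f s) ^ 2 ≤ (β - α) * ∫ s in α..β, f s ^ 2 := by
  rcases h.eq_or_lt with rfl | hlt
  · simp
  set I := ∫ s in α..β, f s with hI
  have hσ : 0 < β - α := sub_pos.2 hlt
  -- The inequality is nonnegativity of the variance, with `m` the mean of `f`.
  set m := I / (β - α) with hm
  have h0 : 0 ≤ ∫ s in α..β, (f s - m) ^ 2 :=
    intervalIntegral.integral_nonneg h fun s _ => sq_nonneg _
  have h1 : ∫ s in α..β, (f s - m) ^ 2 = (∫ s in α..β, f s ^ 2) - 2 * m * I + (β - α) * m ^ 2 := by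
    have : ∀ s, (f s - m) ^ 2 = f s ^ 2 - 2 * m * f s + m ^ 2 := fun s => by ring
    simp_rw [this]
    rw [intervalIntegral.integral_add, intervalIntegral.integral_sub,
      intervalIntegral.integral_const_mul, intervalIntegral.integral_const, smul_eq_mul]
    all_goals exact Continuous.intervalIntegrable (by fun_prop) _ _
  rw [h1] at h0
  have h2 : m * (β - α) = I := div_mul_cancel₀ _ hσ.ne'
  nlinarith

variable {w w₁ w₂ : ℝ → ℂ}

theorem norm_sub_le_intervalIntegral (hw : ∀ s, HasDerivAt w (w₁ s) s) (hw₁ : Continuous w₁)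
    {α β s t : ℝ} (hs : s ∈ Icc α β) (ht : t ∈ Icc α β) :
    ‖w t - w s‖ ≤ ∫ r in α..β, ‖w₁ r‖ := by
  wlog hst : s ≤ t generalizing s t
  · rw [norm_sub_rev]; exact this ht hs (le_of_not_ge hst)
  rw [← intervalIntegral.integral_eq_sub_of_hasDerivAt (fun r _ => hw r)
    (hw₁.intervalIntegrable _ _)]
  refine (intervalIntegral.norm_integral_le_integral_norm hst).trans ?_
  exact intervalIntegral.integral_mono_interval hs.1 hst ht.2
    (Eventually.of_forall fun r => norm_nonneg _) (hw₁.norm.intervalIntegrable _ _)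

/-- A Sobolev inequality: `w` is controlled by its values at two points and by `w''`. -/
theorem norm_sq_le_of_two_points (hw : ∀ s, HasDerivAt w (w₁ s) s)
    (hw₁ : ∀ s, HasDerivAt w₁ (w₂ s) s) (hw₂ : Continuous w₂) {α β P Q s : ℝ}
    (hs : s ∈ Icc α β) (hP : P ∈ Icc α β) (hQ : Q ∈ Icc α β) (hPQ : P < Q)
    (hσ : β - α ≤ 6 * (Q - P)) :
    ‖w s‖ ^ 2 ≤ 147 * (‖w P‖ ^ 2 + ‖w Q‖ ^ 2) +
      3 * (β - α) ^ 3 * ∫ r in α..β, ‖w₂ r‖ ^ 2 := by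
  have hαβ : α ≤ β := hs.1.trans hs.2
  have hw₁c : Continuous w₁ := continuous_iff_continuousAt.2 fun s => (hw₁ s).continuousAt
  set I := ∫ r in α..β, ‖w₂ r‖ with hI
  have hI0 : 0 ≤ I := intervalIntegral.integral_nonneg hαβ fun _ _ => norm_nonneg _
  have hQP : 0 < Q - P := sub_pos.2 hPQ
  have hPQu : ∀ r ∈ uIcc P s, r ∈ Icc α β := fun r hr => uIcc_subset_Icc hP hs hr
  -- `m` is the chord slope, the mean of `w₁` over `[P, Q]`, so `w₁` differs from it by at most the
  -- total variation `I`. Integrating from `P`, `w` stays close to the chord.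
  set m : ℂ := (Q - P)⁻¹ • (w Q - w P) with hm
  have hslope : ∀ t ∈ Icc α β, ‖w₁ t - m‖ ≤ I := by
    intro t ht
    have h1 : (Q - P) • (w₁ t - m) = ∫ r in P..Q, (w₁ t - w₁ r) := by
      rw [intervalIntegral.integral_sub (by simp) (hw₁c.intervalIntegrable _ _),
        intervalIntegral.integral_const,
        intervalIntegral.integral_eq_sub_of_hasDerivAt (fun r _ => hw r)
          (hw₁c.intervalIntegrable _ _), smul_sub, hm, smul_inv_smul₀ hQP.ne']
    have h2 : ‖∫ r in P..Q, (w₁ t - w₁ r)‖ ≤ I * |Q - P| := by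
      refine intervalIntegral.norm_integral_le_of_norm_le_const fun r hr => ?_
      rw [uIoc_of_le hPQ.le] at hr
      exact norm_sub_le_intervalIntegral hw₁ hw₂ ⟨hP.1.trans hr.1.le, hr.2.trans hQ.2⟩ ht
    rw [← h1, norm_smul, Real.norm_eq_abs, mul_comm] at h2
    exact le_of_mul_le_mul_right h2 (abs_pos.2 hQP.ne')
  have hrem : ‖w s - w P - (s - P) • m‖ ≤ I * (β - α) := by
    have h1 : w s - w P - (s - P) • m = ∫ r in P..s, (w₁ r - m) := by
      rw [intervalIntegral.integral_sub (hw₁c.intervalIntegrable _ _) (by simp),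
        intervalIntegral.integral_const,
        intervalIntegral.integral_eq_sub_of_hasDerivAt (fun r _ => hw r)
          (hw₁c.intervalIntegrable _ _)]
    rw [h1]
    refine (intervalIntegral.norm_integral_le_of_norm_le_const (C := I) fun r hr =>
      hslope r (hPQu r (uIoc_subset_uIcc hr))).trans ?_
    gcongr
    rw [abs_le]
    constructor <;> linarith [hs.1, hs.2, hP.1, hP.2]
  -- The chord is extrapolated by a factor `|s - P| / (Q - P) ≤ 6`. Together with `w P` itself this
  -- gives the coefficients 7 and 6 below, and 147 = 3 · 7².
  have hmn : ‖(s - P) • m‖ ≤ 6 * (‖w P‖ + ‖w Q‖) := by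
    rw [hm, smul_smul, norm_smul]
    have h1 : ‖(s - P) * (Q - P)⁻¹‖ ≤ 6 := by
      rw [Real.norm_eq_abs, abs_mul, abs_inv, abs_of_pos hQP, ← div_eq_mul_inv,
        div_le_iff₀ hQP, abs_le]
      constructor <;> linarith [hs.1, hs.2, hP.1, hP.2]
    have h2 : ‖w Q - w P‖ ≤ ‖w P‖ + ‖w Q‖ := by
      rw [add_comm]; exact norm_sub_le _ _
    gcongr
  have htot : ‖w s‖ ≤ 7 * ‖w P‖ + 6 * ‖w Q‖ + I * (β - α) := by
    have h1 : w s = (w s - w P - (s - P) • m) + w P + (s - P) • m := by ring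
    rw [h1]
    refine (norm_add₃_le).trans ?_
    linarith
  have hCS : I ^ 2 ≤ (β - α) * ∫ r in α..β, ‖w₂ r‖ ^ 2 := sq_intervalIntegral_le hw₂.norm hαβ
  have hsq : ‖w s‖ ^ 2 ≤ (7 * ‖w P‖ + 6 * ‖w Q‖ + I * (β - α)) ^ 2 := by gcongr
  have h3 : (7 * ‖w P‖ + 6 * ‖w Q‖ + I * (β - α)) ^ 2 ≤
      3 * (49 * ‖w P‖ ^ 2 + 36 * ‖w Q‖ ^ 2 + I ^ 2 * (β - α) ^ 2) := by
    nlinarith [sq_nonneg (7 * ‖w P‖ - 6 * ‖w Q‖), sq_nonneg (7 * ‖w P‖ - I * (β - α)),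
      sq_nonneg (6 * ‖w Q‖ - I * (β - α))]
  have h4 : I ^ 2 * (β - α) ^ 2 ≤ (β - α) ^ 3 * ∫ r in α..β, ‖w₂ r‖ ^ 2 := by
    calc I ^ 2 * (β - α) ^ 2 ≤ ((β - α) * ∫ r in α..β, ‖w₂ r‖ ^ 2) * (β - α) ^ 2 := by gcongr
      _ = _ := by ring
  nlinarith [sq_nonneg ‖w Q‖]

/-- The function `w = x ^ (-3/2) u` in the variable `s = log x`. -/
def logProfile (u : ℝ → ℂ) (s : ℝ) : ℂ := Real.exp (-(3 / 2) * s) • u (Real.exp s)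

variable (u : 𝓓(halfLine, ℂ))

theorem hasDerivAt_exp_mul (c s : ℝ) :
    HasDerivAt (fun s => Real.exp (c * s)) (c * Real.exp (c * s)) s := by
  have := ((hasDerivAt_id s).const_mul c).exp
  simpa [mul_comm] using this

/-- Since d/ds = x d/dx, this derivative is `D w`; the factor `exp (s / 2)` undoes the `x ^ (-1/2)`
in `firstOrder`. -/
theorem hasDerivAt_logProfile (s : ℝ) :
    HasDerivAt (logProfile u) (Real.exp (1 / 2 * s) • firstOrder u (Real.exp s)) s := by
  have h1 := (hasDerivAt_test u (Real.exp s)).scomp s (Real.hasDerivAt_exp s)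
  have h2 := (hasDerivAt_exp_mul (-(3 / 2)) s).smul h1
  convert! h2 using 1
  have e1 : Real.exp (1 / 2 * s) = Real.exp (-(3 / 2) * s) * Real.exp s ^ 2 := by
    rw [← Real.exp_nat_mul, ← Real.exp_add]; congr 1; push_cast; ring
  have h0 : ((Real.exp s : ℝ) : ℂ) ≠ 0 := Complex.ofReal_ne_zero.2 (Real.exp_pos s).ne'
  rw [firstOrder, e1]
  simp only [Function.comp_apply, Complex.real_smul]
  generalize Real.exp s = y at *
  generalize Real.exp (-(3 / 2) * s) = z at *
  push_cast
  field_simp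
  ring

theorem hasDerivAt_deriv_logProfile (s : ℝ) :
    HasDerivAt (fun s => Real.exp (1 / 2 * s) • firstOrder u (Real.exp s))
      (Real.exp (1 / 2 * s) • secondOrder u (Real.exp s)) s := by
  have hy := Real.exp_pos s
  have hf : HasDerivAt (firstOrder u) ((1 / Real.exp s) • deriv (deriv u) (Real.exp s)
      - (5 / 2 / Real.exp s ^ 2) • deriv u (Real.exp s)
      + (3 / Real.exp s ^ 3) • u (Real.exp s)) (Real.exp s) := by
    generalize Real.exp s = y at *
    have h1 := ((hasDerivAt_const y (1 : ℝ)).div (hasDerivAt_id y) hy.ne').smul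
      (hasDerivAt_deriv_test u y)
    have h2 := ((hasDerivAt_const y (3 / 2 : ℝ)).div ((hasDerivAt_id y).pow 2)
      (pow_ne_zero 2 hy.ne')).smul (hasDerivAt_test u y)
    convert! h1.sub h2 using 1
    have h0 : (y : ℂ) ≠ 0 := Complex.ofReal_ne_zero.2 hy.ne'
    simp only [Complex.real_smul, id, Pi.pow_apply, Pi.div_apply]
    push_cast
    field_simp
    ring
  have h2 := (hasDerivAt_exp_mul (1 / 2) s).smul (hf.scomp s (Real.hasDerivAt_exp s))
  convert! h2 using 1
  have h0 : ((Real.exp s : ℝ) : ℂ) ≠ 0 := Complex.ofReal_ne_zero.2 hy.ne'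
  rw [secondOrder]
  simp only [Function.comp_apply, Complex.real_smul, firstOrder]
  generalize Real.exp s = y at *
  generalize Real.exp (1 / 2 * s) = z at *
  push_cast
  field_simp
  ring

theorem norm_sq_eq_logProfile {x : ℝ} (hx : 0 < x) :
    ‖u x‖ ^ 2 = x ^ 3 * ‖logProfile u (Real.log x)‖ ^ 2 := by
  rw [logProfile, Real.exp_log hx, norm_smul, mul_pow, Real.norm_eq_abs, sq_abs,
    ← Real.exp_nat_mul, ← mul_assoc]
  have : x ^ 3 * Real.exp (((2 : ℕ) : ℝ) * (-(3 / 2) * Real.log x)) = 1 := by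
    nth_rw 1 [← Real.exp_log hx]
    rw [← Real.exp_nat_mul, ← Real.exp_add, Real.exp_eq_one_iff]
    push_cast
    ring
  rw [this, one_mul]

/-- The square of `exp (s / 2)` is the Jacobian of `x = exp s`. -/
theorem intervalIntegral_log {f : ℝ → ℂ} (hf : Continuous f) {a b : ℝ} (ha : 0 < a) (hb : 0 < b) :
    ∫ s in Real.log a..Real.log b, ‖Real.exp (1 / 2 * s) • f (Real.exp s)‖ ^ 2 =
      ∫ x in a..b, ‖f x‖ ^ 2 := by
  have h := intervalIntegral.integral_comp_mul_deriv (a := Real.log a) (b := Real.log b)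
    (f := Real.exp) (f' := Real.exp) (g := fun x => ‖f x‖ ^ 2)
    (fun s _ => Real.hasDerivAt_exp s) Real.continuous_exp.continuousOn (by fun_prop)
  rw [Real.exp_log ha, Real.exp_log hb] at h
  rw [← h]
  refine intervalIntegral.integral_congr fun s _ => ?_
  simp only [Function.comp_apply]
  rw [norm_smul, mul_pow, Real.norm_eq_abs, sq_abs, ← Real.exp_nat_mul, mul_comm]
  congr 2
  push_cast
  ring

theorem firstOrder_le_hardyDensity (x : ℝ) : ‖firstOrder u x‖ ^ 2 ≤ hardyDensity u x := by
  rw [hardyDensity]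
  nlinarith [sq_nonneg ‖firstOrder u x‖, sq_nonneg ‖secondOrder u x‖]

theorem secondOrder_le_hardyDensity (x : ℝ) : ‖secondOrder u x‖ ^ 2 ≤ hardyDensity u x := by
  rw [hardyDensity]
  nlinarith [sq_nonneg ‖firstOrder u x‖]

/-- Long intervals: `w` is controlled by one value and by `D w`. -/
theorem norm_logProfile_sub_le {a b x q : ℝ} (ha : 0 ≤ a) (hx : x ∈ Ioc a b) (hq : q ∈ Ioc a b) :
    ‖logProfile u (Real.log x) - logProfile u (Real.log q)‖ ^ 2 ≤
      |Real.log x - Real.log q| * ∫ t in a..b, hardyDensity u t := by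
  wlog hxq : q ≤ x generalizing x q
  · rw [norm_sub_rev, abs_sub_comm]; exact this hq hx (le_of_not_ge hxq)
  have hq0 : 0 < q := ha.trans_lt hq.1
  have hx0 : 0 < x := ha.trans_lt hx.1
  have hlog : Real.log q ≤ Real.log x := Real.log_le_log hq0 hxq
  have hc := continuous_firstOrder u
  have hcw : Continuous fun s => Real.exp (1 / 2 * s) • firstOrder u (Real.exp s) := by fun_prop
  have h1 := norm_sub_le_intervalIntegral (hasDerivAt_logProfile u) hcw
    (left_mem_Icc.2 hlog) (right_mem_Icc.2 hlog)
  have h2 := sq_intervalIntegral_le hcw.norm hlog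
  rw [intervalIntegral_log hc hq0 hx0] at h2
  have h3 : ∫ t in q..x, ‖firstOrder u t‖ ^ 2 ≤ ∫ t in a..b, hardyDensity u t := by
    have h4 : ∫ t in q..x, ‖firstOrder u t‖ ^ 2 ≤ ∫ t in q..x, hardyDensity u t :=
      intervalIntegral.integral_mono_on hxq (Continuous.intervalIntegrable (by fun_prop) _ _)
        ((continuous_hardyDensity u).intervalIntegrable _ _)
        fun t _ => firstOrder_le_hardyDensity u t
    refine h4.trans (intervalIntegral.integral_mono_interval hq.1.le hxq hx.2
      (Eventually.of_forall fun r => hardyDensity_nonneg _ _)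
      ((continuous_hardyDensity u).intervalIntegrable _ _))
  rw [abs_of_nonneg (sub_nonneg.2 hlog)]
  calc _ ≤ (∫ s in Real.log q..Real.log x,
          ‖Real.exp (1 / 2 * s) • firstOrder u (Real.exp s)‖) ^ 2 := by gcongr
    _ ≤ _ := h2
    _ ≤ _ := by
      have := sub_nonneg.2 hlog
      gcongr

/-- As `b ≤ 2 a`, the factor `x ^ 3` relating `u` and `w` is constant up to 8, and the logarithm
distorts lengths boundedly: `log b - log a ≤ (b - a) / a`, while `log q - log p ≥ (b - a) / (6 a)`.
So the two-point Sobolev inequality applies to `w` in the variable `log x`, and 1176 = 8 · 147. -/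
theorem norm_sq_le_of_short {a b x p q : ℝ} (hab : a < b) (hℓ : b - a ≤ a)
    (hx : x ∈ Ioc a b) (hp : p ∈ Icc a (a + (b - a) / 3)) (hq : q ∈ Icc (b - (b - a) / 3) b) :
    ‖u x‖ ^ 2 ≤ 1176 * (‖u p‖ ^ 2 + ‖u q‖ ^ 2 +
      (b - a) ^ 3 * ∫ t in a..b, hardyDensity u t) := by
  have ha : 0 < a := by linarith
  have hb : 0 < b := by linarith
  have hx0 : 0 < x := ha.trans hx.1
  have hp0 : 0 < p := ha.trans_le hp.1
  have hpq : p < q := by linarith [hp.2, hq.1]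
  have hq0 : 0 < q := hp0.trans hpq
  have hpb : p ≤ b := by linarith [hp.2]
  have haq : a ≤ q := by linarith [hq.1]
  have hσ1 : Real.log b - Real.log a ≤ (b - a) / a := by
    rw [← Real.log_div hb.ne' ha.ne']
    refine (Real.log_le_sub_one_of_pos (by positivity)).trans (le_of_eq ?_)
    field_simp
  have hσ0 : 0 ≤ Real.log b - Real.log a := sub_nonneg.2 (Real.log_le_log ha hab.le)
  have hσ2 : Real.log b - Real.log a ≤ 6 * (Real.log q - Real.log p) := by
    have h1 : 1 - p / q ≤ Real.log q - Real.log p := by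
      have := Real.one_sub_inv_le_log_of_pos (x := q / p) (by positivity)
      rwa [inv_div, Real.log_div hq0.ne' hp0.ne'] at this
    have h2 : (b - a) / 3 / (2 * a) ≤ 1 - p / q := by
      have h3 : 1 - p / q = (q - p) / q := by field_simp
      rw [h3]
      have : q ≤ 2 * a := by linarith [hq.2]
      have h5 : (b - a) / 3 ≤ q - p := by linarith [hp.2, hq.1]
      have h6 : 0 ≤ q - p := by linarith
      gcongr
    have h4 : (b - a) / a = 6 * ((b - a) / 3 / (2 * a)) := by field_simp; ring
    linarith
  have hcw : Continuous fun s => Real.exp (1 / 2 * s) • secondOrder u (Real.exp s) := by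
    have := continuous_secondOrder u
    fun_prop
  have key := norm_sq_le_of_two_points (hasDerivAt_logProfile u) (hasDerivAt_deriv_logProfile u)
    hcw (s := Real.log x) (P := Real.log p) (Q := Real.log q)
    ⟨Real.log_le_log ha hx.1.le, Real.log_le_log hx0 hx.2⟩
    ⟨Real.log_le_log ha hp.1, Real.log_le_log hp0 hpb⟩
    ⟨Real.log_le_log ha haq, Real.log_le_log hq0 hq.2⟩ (Real.log_lt_log hp0 hpq) hσ2
  rw [intervalIntegral_log (continuous_secondOrder u) ha hb] at key
  have hD : ∫ t in a..b, ‖secondOrder u t‖ ^ 2 ≤ ∫ t in a..b, hardyDensity u t :=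
    intervalIntegral.integral_mono_on hab.le
      (Continuous.intervalIntegrable (by have := continuous_secondOrder u; fun_prop) _ _)
      ((continuous_hardyDensity u).intervalIntegrable _ _)
      fun t _ => secondOrder_le_hardyDensity u t
  have hD0 : 0 ≤ ∫ t in a..b, hardyDensity u t :=
    intervalIntegral.integral_nonneg hab.le fun t _ => hardyDensity_nonneg _ t
  set D := ∫ t in a..b, hardyDensity u t with hDdef
  set σ := Real.log b - Real.log a with hσ
  have hup := norm_sq_eq_logProfile u hp0
  have huq := norm_sq_eq_logProfile u hq0
  have hux := norm_sq_eq_logProfile u hx0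
  have hx3 : x ^ 3 ≤ 8 * a ^ 3 := by
    calc x ^ 3 ≤ (2 * a) ^ 3 := by gcongr; linarith [hx.2]
      _ = 8 * a ^ 3 := by ring
  have hp3 : a ^ 3 * ‖logProfile u (Real.log p)‖ ^ 2 ≤ ‖u p‖ ^ 2 := by
    rw [hup]; gcongr; exact hp.1
  have hq3 : a ^ 3 * ‖logProfile u (Real.log q)‖ ^ 2 ≤ ‖u q‖ ^ 2 := by
    rw [huq]; gcongr
  have hσ3 : a ^ 3 * σ ^ 3 ≤ (b - a) ^ 3 := by
    rw [← mul_pow]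
    gcongr
    rw [le_div_iff₀ ha] at hσ1
    linarith
  calc ‖u x‖ ^ 2 = x ^ 3 * ‖logProfile u (Real.log x)‖ ^ 2 := hux
    _ ≤ 8 * a ^ 3 * (147 * (‖logProfile u (Real.log p)‖ ^ 2 + ‖logProfile u (Real.log q)‖ ^ 2)
        + 3 * σ ^ 3 * D) := by
      have : 3 * σ ^ 3 * ∫ t in a..b, ‖secondOrder u t‖ ^ 2 ≤ 3 * σ ^ 3 * D := by gcongr
      have h9 := key.trans (by gcongr : _ ≤ 147 * (‖logProfile u (Real.log p)‖ ^ 2 +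
        ‖logProfile u (Real.log q)‖ ^ 2) + 3 * σ ^ 3 * D)
      gcongr
    _ = 1176 * (a ^ 3 * ‖logProfile u (Real.log p)‖ ^ 2 + a ^ 3 * ‖logProfile u (Real.log q)‖ ^ 2)
        + 24 * (a ^ 3 * σ ^ 3) * D := by ring
    _ ≤ 1176 * (‖u p‖ ^ 2 + ‖u q‖ ^ 2) + 24 * (b - a) ^ 3 * D := by gcongr
    _ ≤ _ := by
      have : 0 ≤ (b - a) ^ 3 * D := mul_nonneg (pow_nonneg (by linarith) 3) hD0
      linarith

/-- Meant for intervals comparable with their distance from the origin or longer, including `a = 0`.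
Only `D w` is used: it allows `|w|²` to grow like `log (b / x)` as `x → 0`, and `x ^ κ` absorbs this
by `log t ≤ t ^ κ / κ`. -/
theorem norm_sq_le_of_long {κ : ℝ} (hκ : 0 < κ) {a b x q : ℝ} (ha : 0 ≤ a) (hab : a < b)
    (hx : x ∈ Ioc a b) (hq : q ∈ Icc (b - (b - a) / 3) b) :
    x ^ κ * ‖logProfile u (Real.log x)‖ ^ 2 ≤ b ^ κ * (16 * ((b - a)⁻¹ ^ 3 * ‖u q‖ ^ 2) +
      (2 + 2 / κ) * ∫ t in a..b, hardyDensity u t) := by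
  have hb : 0 < b := by linarith
  have hx0 : 0 < x := ha.trans_lt hx.1
  have hqb : b / 2 ≤ q := by linarith [hq.1]
  have hq0 : 0 < q := by linarith
  have hℓ0 : 0 < b - a := by linarith
  have h1 := norm_logProfile_sub_le u ha hx (q := q) ⟨by linarith [hq.1], hq.2⟩
  set D := ∫ t in a..b, hardyDensity u t with hD
  have hD0 : 0 ≤ D := intervalIntegral.integral_nonneg hab.le fun t _ => hardyDensity_nonneg _ t
  set W := logProfile u (Real.log x)
  set Wq := logProfile u (Real.log q) with hWq
  have h2 : ‖W‖ ^ 2 ≤ 2 * ‖Wq‖ ^ 2 + 2 * ‖W - Wq‖ ^ 2 := by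
    have h3 : ‖W‖ ≤ ‖Wq‖ + ‖W - Wq‖ := by
      have := norm_add_le Wq (W - Wq)
      rwa [add_sub_cancel] at this
    have h4 : ‖W‖ ^ 2 ≤ (‖Wq‖ + ‖W - Wq‖) ^ 2 := by gcongr
    nlinarith [sq_nonneg (‖Wq‖ - ‖W - Wq‖)]
  have h3 : ‖Wq‖ ^ 2 ≤ 8 * ((b - a)⁻¹ ^ 3 * ‖u q‖ ^ 2) := by
    rw [norm_sq_eq_logProfile u hq0, ← mul_assoc, ← mul_assoc]
    have : 1 ≤ 8 * (b - a)⁻¹ ^ 3 * q ^ 3 := by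
      have h5 : (1 : ℝ) ≤ 2 * (b - a)⁻¹ * q := by
        rw [mul_right_comm, ← div_eq_mul_inv, le_div_iff₀ hℓ0]
        linarith
      calc (1 : ℝ) ≤ (2 * (b - a)⁻¹ * q) ^ 3 := one_le_pow₀ h5
        _ = _ := by ring
    exact le_mul_of_one_le_left (sq_nonneg _) this
  have hlog : |Real.log x - Real.log q| ≤ 1 + Real.log (b / x) := by
    have h2' : Real.log 2 ≤ 1 := by linarith [Real.log_two_lt_d9]
    rw [Real.log_div hb.ne' hx0.ne']
    have e1 : Real.log q ≤ Real.log b := Real.log_le_log hq0 hq.2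
    have e2 : Real.log x ≤ Real.log b := Real.log_le_log hx0 hx.2
    have e3 : Real.log b - Real.log 2 ≤ Real.log q := by
      rw [← Real.log_div hb.ne' (by norm_num)]
      exact Real.log_le_log (by positivity) hqb
    rw [abs_le]
    constructor <;> linarith
  have hpow : x ^ κ * |Real.log x - Real.log q| ≤ b ^ κ * (1 + 1 / κ) := by
    have e1 : Real.log (b / x) ≤ (b / x) ^ κ / κ := Real.log_le_rpow_div (by positivity) hκ
    have e2 : x ^ κ * (b / x) ^ κ = b ^ κ := by
      rw [← Real.mul_rpow hx0.le (by positivity), mul_div_cancel₀ _ hx0.ne']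
    have e3 : x ^ κ ≤ b ^ κ := Real.rpow_le_rpow hx0.le hx.2 hκ.le
    have e4 : 0 ≤ x ^ κ := by positivity
    calc x ^ κ * |Real.log x - Real.log q| ≤ x ^ κ * (1 + (b / x) ^ κ / κ) := by
          gcongr; linarith
      _ = x ^ κ + (x ^ κ * (b / x) ^ κ) / κ := by ring
      _ ≤ b ^ κ + b ^ κ / κ := by rw [e2]; gcongr
      _ = _ := by ring
  have e3 : x ^ κ ≤ b ^ κ := Real.rpow_le_rpow hx0.le hx.2 hκ.le
  have e4 : 0 ≤ x ^ κ := by positivity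
  calc x ^ κ * ‖W‖ ^ 2 ≤ x ^ κ * (2 * ‖Wq‖ ^ 2 + 2 * (|Real.log x - Real.log q| * D)) := by
        gcongr; linarith
    _ = 2 * (x ^ κ * ‖Wq‖ ^ 2) + 2 * ((x ^ κ * |Real.log x - Real.log q|) * D) := by ring
    _ ≤ 2 * (b ^ κ * (8 * ((b - a)⁻¹ ^ 3 * ‖u q‖ ^ 2))) + 2 * ((b ^ κ * (1 + 1 / κ)) * D) := by
      gcongr
    _ = _ := by ring

/-- The pointwise bound on an interval, uniform with respect to its position. -/
theorem norm_sq_le_on_interval {ν : ℝ} (hν₀ : 0 ≤ ν) (hν₃ : ν < 3) {a b x p q : ℝ} (ha : 0 ≤ a)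
    (hab : a < b) (hx : x ∈ Ioc a b) (hp : p ∈ Icc a (a + (b - a) / 3))
    (hq : q ∈ Icc (b - (b - a) / 3) b) :
    ‖u x‖ ^ 2 ≤ (1176 + 16 / (3 - ν)) * (x ^ ν * (b - a) ^ (3 - ν) *
      ((∫ t in a..b, hardyDensity u t) + (b - a)⁻¹ ^ 3 * (‖u p‖ ^ 2 + ‖u q‖ ^ 2))) := by
  have hκ : 0 < 3 - ν := by linarith
  have hℓ : 0 < b - a := by linarith
  have hx0 : 0 < x := ha.trans_lt hx.1
  set D := ∫ t in a..b, hardyDensity u t with hD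
  have hD0 : 0 ≤ D := intervalIntegral.integral_nonneg hab.le fun t _ => hardyDensity_nonneg _ t
  set Y := (b - a)⁻¹ ^ 3 * (‖u p‖ ^ 2 + ‖u q‖ ^ 2) with hY
  have hY0 : 0 ≤ Y := by positivity
  have hxν : 0 ≤ x ^ ν := by positivity
  have hℓκ : 0 ≤ (b - a) ^ (3 - ν) := by positivity
  rcases le_total (b - a) a with hshort | hlong
  · have h1 := norm_sq_le_of_short u hab hshort hx hp hq
    -- Here `b - a ≤ a < x`, so `ν` powers of the length may be replaced by `x ^ ν`, as `ν ≥ 0`.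
    have h2 : (b - a) ^ 3 ≤ x ^ ν * (b - a) ^ (3 - ν) := by
      have e1 : (b - a) ^ 3 = (b - a) ^ ν * (b - a) ^ (3 - ν) := by
        rw [← Real.rpow_add hℓ, ← Real.rpow_natCast]
        norm_num
      rw [e1]
      gcongr
      linarith [hx.1]
    have h3 : ‖u p‖ ^ 2 + ‖u q‖ ^ 2 + (b - a) ^ 3 * D = (b - a) ^ 3 * (D + Y) := by
      rw [hY]
      field_simp
      ring
    rw [h3] at h1
    refine h1.trans ?_
    have h4 : (b - a) ^ 3 * (D + Y) ≤ x ^ ν * (b - a) ^ (3 - ν) * (D + Y) := by gcongr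
    have h5 : 0 ≤ 16 / (3 - ν) * (x ^ ν * (b - a) ^ (3 - ν) * (D + Y)) := by positivity
    linarith
  · have h1 := norm_sq_le_of_long u hκ ha hab hx hq
    have h2 : ‖u x‖ ^ 2 = x ^ ν * (x ^ (3 - ν) * ‖logProfile u (Real.log x)‖ ^ 2) := by
      rw [norm_sq_eq_logProfile u hx0, ← mul_assoc, ← Real.rpow_add hx0, ← Real.rpow_natCast]
      norm_num
    -- Here `a ≤ b - a`, so `b ≤ 2 (b - a)`, and the exponent is at most 3.
    have hb : b ^ (3 - ν) ≤ 8 * (b - a) ^ (3 - ν) := by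
      calc b ^ (3 - ν) ≤ (2 * (b - a)) ^ (3 - ν) :=
            Real.rpow_le_rpow (by linarith) (by linarith) hκ.le
        _ = 2 ^ (3 - ν) * (b - a) ^ (3 - ν) := Real.mul_rpow (by norm_num) hℓ.le
        _ ≤ 8 * (b - a) ^ (3 - ν) := by
          gcongr
          calc (2 : ℝ) ^ (3 - ν) ≤ 2 ^ (3 : ℝ) :=
                Real.rpow_le_rpow_of_exponent_le (by norm_num) (by linarith)
            _ = 8 := by norm_num
    have hq' : (b - a)⁻¹ ^ 3 * ‖u q‖ ^ 2 ≤ Y := by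
      rw [hY]; gcongr; linarith [sq_nonneg ‖u p‖]
    rw [h2]
    calc x ^ ν * (x ^ (3 - ν) * ‖logProfile u (Real.log x)‖ ^ 2)
        ≤ x ^ ν * (b ^ (3 - ν) * (16 * ((b - a)⁻¹ ^ 3 * ‖u q‖ ^ 2) + (2 + 2 / (3 - ν)) * D)) := by
          gcongr
      _ ≤ x ^ ν * (8 * (b - a) ^ (3 - ν) * (16 * Y + (2 + 2 / (3 - ν)) * D)) := by gcongr
      _ = x ^ ν * (b - a) ^ (3 - ν) * (128 * Y + (16 + 16 / (3 - ν)) * D) := by ring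
      _ ≤ x ^ ν * (b - a) ^ (3 - ν) * ((1176 + 16 / (3 - ν)) * (D + Y)) := by
        have : 0 ≤ 16 / (3 - ν) * Y := by positivity
        gcongr
        linarith
      _ = _ := by ring

end Pointwise

/-! ### A partition of the half-line adapted to the potential -/

section Partition

theorem exists_le_intervalIntegral {f : ℝ → ℝ} (hf : Continuous f) {a b : ℝ} (hab : a ≤ b) :
    ∃ p ∈ Icc a b, (b - a) * f p ≤ ∫ x in a..b, f x := by
  obtain ⟨p, hp, hmin⟩ := isCompact_Icc.exists_isMinOn (nonempty_Icc.2 hab) hf.continuousOn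
  refine ⟨p, hp, ?_⟩
  have h1 : ∫ _ in a..b, f p ≤ ∫ x in a..b, f x :=
    intervalIntegral.integral_mono_on hab (by simp) (hf.intervalIntegrable _ _) fun x hx => hmin hx
  simpa using h1

variable {ν : ℝ}

/-- The constant in the pointwise bound. -/
def boundConst (ν : ℝ) : ℝ := 1176 + 16 / (3 - ν)

theorem boundConst_pos (hν₃ : ν < 3) : 0 < boundConst ν := by
  have : 0 < 3 - ν := by linarith
  rw [boundConst]; positivity

/-- The points `p`, `q` are free in the outer thirds, so they can be chosen where `|u|²` is at most
its mean there. Each third contributes a factor 3, whence the 6. -/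
theorem norm_sq_le_of_average (u : 𝓓(halfLine, ℂ)) (hν₀ : 0 ≤ ν) (hν₃ : ν < 3) {a b x : ℝ}
    (ha : 0 ≤ a) (hab : a < b) (hx : x ∈ Ioc a b) :
    ‖u x‖ ^ 2 ≤ boundConst ν * (x ^ ν * (b - a) ^ (3 - ν) *
      ((∫ t in a..b, hardyDensity u t) + 6 * (b - a)⁻¹ ^ 4 * ∫ t in a..b, ‖u t‖ ^ 2)) := by
  have hℓ : 0 < b - a := by linarith
  have hc : Continuous fun t => ‖u t‖ ^ 2 := by have := u.continuous; fun_prop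
  obtain ⟨p, hp, hpi⟩ := exists_le_intervalIntegral hc (a := a) (b := a + (b - a) / 3) (by linarith)
  obtain ⟨q, hq, hqi⟩ := exists_le_intervalIntegral hc (a := b - (b - a) / 3) (b := b) (by linarith)
  have key := norm_sq_le_on_interval u hν₀ hν₃ ha hab hx hp hq
  have hx0 : 0 < x := ha.trans_lt hx.1
  set N := ∫ t in a..b, ‖u t‖ ^ 2 with hN
  have h1 : ∫ t in a..(a + (b - a) / 3), ‖u t‖ ^ 2 ≤ N :=
    intervalIntegral.integral_mono_interval le_rfl (by linarith) (by linarith)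
      (Eventually.of_forall fun t => by positivity) (hc.intervalIntegrable _ _)
  have h2 : ∫ t in (b - (b - a) / 3)..b, ‖u t‖ ^ 2 ≤ N :=
    intervalIntegral.integral_mono_interval (by linarith) (by linarith) le_rfl
      (Eventually.of_forall fun t => by positivity) (hc.intervalIntegrable _ _)
  have h3 : (b - a) * (‖u p‖ ^ 2 + ‖u q‖ ^ 2) ≤ 6 * N := by linarith
  have h4 : (b - a)⁻¹ ^ 3 * (‖u p‖ ^ 2 + ‖u q‖ ^ 2) ≤ 6 * (b - a)⁻¹ ^ 4 * N := by
    have e1 : (b - a)⁻¹ ^ 3 * (‖u p‖ ^ 2 + ‖u q‖ ^ 2) =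
        (b - a)⁻¹ ^ 4 * ((b - a) * (‖u p‖ ^ 2 + ‖u q‖ ^ 2)) := by
      field_simp
    rw [e1]
    calc _ ≤ (b - a)⁻¹ ^ 4 * (6 * N) := by gcongr
      _ = _ := by ring
  have hC := (boundConst_pos hν₃).le
  refine key.trans ?_
  change boundConst ν * _ ≤ _
  gcongr

theorem intervalIntegral_le_Ioi {f : ℝ → ℝ} (hf : IntegrableOn f (Ioi 0))
    (hf0 : ∀ᵐ x ∂(volume : Measure ℝ).restrict (Ioi 0), 0 ≤ f x) {a b : ℝ} (ha : 0 ≤ a)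
    (hab : a ≤ b) : ∫ x in a..b, f x ≤ ∫ x in Ioi 0, f x := by
  rw [intervalIntegral.integral_of_le hab]
  exact setIntegral_mono_set hf hf0
    (Eventually.of_forall fun x hx => lt_of_le_of_lt ha hx.1)

/-- Point evaluations are bounded in the form norm. -/
theorem exists_norm_sq_eval_le (x : ℝ) : ∃ C, ∀ u : 𝓓(halfLine, ℂ),
    ‖u x‖ ^ 2 ≤ C * (‖toL2 u‖ ^ 2 + ‖hardyOp u‖ ^ 2) := by
  rcases le_or_gt x 0 with hx | hx
  · refine ⟨0, fun u => ?_⟩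
    rw [test_eq_zero fun h => (tsupport_test u h).not_ge hx]
    simp
  refine ⟨boundConst 0 * (x ^ (3 : ℝ) * (1 + 6 * x⁻¹ ^ 4)), fun u => ?_⟩
  have h1 := norm_sq_le_of_average u le_rfl (by norm_num : (0 : ℝ) < 3) le_rfl hx
    (right_mem_Ioc.2 hx)
  have h2 := intervalIntegral_le_Ioi (integrable_hardyDensity u).integrableOn
    (Eventually.of_forall fun t => hardyDensity_nonneg _ t) le_rfl hx.le
  have h3 := intervalIntegral_le_Ioi (integrableOn_norm_sq (memLp_test u))
    (Eventually.of_forall fun t => by positivity) le_rfl hx.le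
  rw [← norm_sq_hardyOp] at h2
  rw [← norm_sq_toL2] at h3
  have hC := (boundConst_pos (by norm_num : (0 : ℝ) < 3)).le
  simp only [sub_zero, Real.rpow_zero, one_mul] at h1
  have h4 : 6 * x⁻¹ ^ 4 * ∫ t in 0..x, ‖u t‖ ^ 2 ≤ 6 * x⁻¹ ^ 4 * ‖toL2 u‖ ^ 2 := by gcongr
  have h5 : 0 ≤ 6 * x⁻¹ ^ 4 * ‖hardyOp u‖ ^ 2 := by positivity
  have h6 : 0 ≤ ‖toL2 u‖ ^ 2 := by positivity
  have h7 : (∫ t in 0..x, hardyDensity u t) + 6 * x⁻¹ ^ 4 * ∫ t in 0..x, ‖u t‖ ^ 2 ≤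
      (1 + 6 * x⁻¹ ^ 4) * (‖toL2 u‖ ^ 2 + ‖hardyOp u‖ ^ 2) := by linarith
  refine h1.trans ?_
  rw [mul_assoc (boundConst 0), mul_assoc (x ^ (3 : ℝ))]
  gcongr

/-- Intermediate value theorem: as a function of `b`, the left-hand side is continuous, vanishes at
`b = a` and eventually exceeds `ε`. -/
theorem exists_next {g : ℝ → ℝ} (hg : IntegrableOn g (Ioi 0))
    (hg0 : ∀ᵐ x ∂(volume : Measure ℝ).restrict (Ioi 0), 0 ≤ g x)
    (hpos : ∀ a b, 0 ≤ a → a < b → 0 < ∫ x in a..b, g x)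
    {κ ε : ℝ} (hκ : 0 < κ) (hε : 0 < ε) {a : ℝ} (ha : 0 ≤ a) :
    ∃ b, a < b ∧ (b - a) ^ κ * ∫ x in a..b, g x = ε := by
  set f : ℝ → ℝ := fun b => (b - a) ^ κ * ∫ x in a..b, g x with hf
  have hint : ∀ c d : ℝ, 0 ≤ c → c ≤ d → IntervalIntegrable g volume c d := fun c d hc hcd =>
    (intervalIntegrable_iff_integrableOn_Ioc_of_le hcd).2
      (hg.mono_set fun x hx => lt_of_le_of_lt hc hx.1)
  have hm := hpos a (a + 1) ha (by linarith)
  set m := ∫ x in a..(a + 1), g x with hmdef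
  -- `R ≥ 1` ensures mass at least `m` on `[a, a + R]`, and then `R ^ κ ≥ ε / m` makes the product
  -- at least `ε`.
  set R := max 1 ((ε / m) ^ κ⁻¹) with hR
  have hR1 : 1 ≤ R := le_max_left _ _
  have hcont : ContinuousOn f (Icc a (a + R)) := by
    refine ContinuousOn.mul ?_ ?_
    · exact ((continuous_id.sub continuous_const).rpow_const fun _ => Or.inr hκ.le).continuousOn
    · have := intervalIntegral.continuousOn_primitive_interval' (a := a) (b₁ := a) (b₂ := a + R)
        (hint a (a + R) ha (by linarith)) left_mem_uIcc
      rwa [uIcc_of_le (by linarith)] at this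
  have h0 : f a = 0 := by simp [hf]
  have h1 : ε ≤ f (a + R) := by
    have e1 : m ≤ ∫ x in a..(a + R), g x := by
      refine intervalIntegral.integral_mono_interval le_rfl (by linarith) (by linarith) ?_
        (hint a (a + R) ha (by linarith))
      exact ae_restrict_of_ae_restrict_of_subset (fun x hx => lt_of_le_of_lt ha hx.1) hg0
    have e2 : ε / m ≤ R ^ κ := by
      calc ε / m = ((ε / m) ^ κ⁻¹) ^ κ := by
            rw [← Real.rpow_mul (by positivity), inv_mul_cancel₀ hκ.ne', Real.rpow_one]
        _ ≤ R ^ κ := Real.rpow_le_rpow (by positivity) (le_max_right _ _) hκ.le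
    rw [div_le_iff₀ hm] at e2
    simp only [hf, add_sub_cancel_left]
    refine e2.trans ?_
    gcongr
  obtain ⟨b, hb, hfb⟩ := intermediate_value_Icc (by linarith : a ≤ a + R) hcont
    (show ε ∈ Icc (f a) (f (a + R)) by rw [h0]; exact ⟨hε.le, h1⟩)
  refine ⟨b, lt_of_le_of_ne hb.1 ?_, hfb⟩
  rintro rfl
  rw [h0] at hfb
  exact hε.ne hfb

/-- A partition of the half-line such that `|I| ^ κ ∫_I g = ε` for each of its intervals `I`. -/
theorem exists_partition {g : ℝ → ℝ} (hg : IntegrableOn g (Ioi 0))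
    (hg0 : ∀ᵐ x ∂(volume : Measure ℝ).restrict (Ioi 0), 0 ≤ g x)
    (hpos : ∀ a b, 0 ≤ a → a < b → 0 < ∫ x in a..b, g x)
    {κ ε : ℝ} (hκ : 0 < κ) (hε : 0 < ε) :
    ∃ b : ℕ → ℝ, b 0 = 0 ∧ StrictMono b ∧ Tendsto b atTop atTop ∧
      ∀ k, (b (k + 1) - b k) ^ κ * ∫ x in b k..b (k + 1), g x = ε := by
  choose! F hF1 hF2 using fun (a : ℝ) (ha : 0 ≤ a) => exists_next hg hg0 hpos hκ hε ha
  let b : ℕ → ℝ := fun n => Nat.rec 0 (fun _ a => F a) n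
  have hb0 : b 0 = 0 := rfl
  have hbs : ∀ n, b (n + 1) = F (b n) := fun n => rfl
  have hbn : ∀ n, 0 ≤ b n := by
    intro n
    induction n with
    | zero => exact hb0.ge
    | succ n ih => rw [hbs]; exact ih.trans (hF1 _ ih).le
  have hmono : StrictMono b := strictMono_nat_of_lt_succ fun n => by
    rw [hbs]; exact hF1 _ (hbn n)
  have hmass : ∀ k, (b (k + 1) - b k) ^ κ * ∫ x in b k..b (k + 1), g x = ε := fun k => by
    rw [hbs]; exact hF2 _ (hbn k)
  refine ⟨b, hb0, hmono, ?_, hmass⟩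
  set M := ∫ x in Ioi 0, g x with hM
  have hMpos : 0 < M := (hpos 0 1 le_rfl one_pos).trans_le
    (intervalIntegral_le_Ioi hg hg0 le_rfl zero_le_one)
  -- No interval has mass above `M`, so none is shorter than `d`; hence the endpoints tend to
  -- infinity.
  set d := (ε / M) ^ κ⁻¹ with hd
  have hd0 : 0 < d := by positivity
  have hstep : ∀ k, d ≤ b (k + 1) - b k := by
    intro k
    have hℓ : 0 < b (k + 1) - b k := sub_pos.2 (hmono (Nat.lt_succ_self k))
    have h1 : ε / M ≤ (b (k + 1) - b k) ^ κ := by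
      rw [div_le_iff₀ hMpos, ← hmass k]
      gcongr
      exact intervalIntegral_le_Ioi hg hg0 (hbn k) (hmono (Nat.lt_succ_self k)).le
    calc d ≤ ((b (k + 1) - b k) ^ κ) ^ κ⁻¹ :=
          Real.rpow_le_rpow (by positivity) h1 (by positivity)
      _ = b (k + 1) - b k := by
        rw [← Real.rpow_mul hℓ.le, mul_inv_cancel₀ hκ.ne', Real.rpow_one]
  have hlow : ∀ n : ℕ, n * d ≤ b n := by
    intro n
    induction n with
    | zero => simp [hb0]
    | succ n ih => have := hstep n; push_cast; linarith
  exact tendsto_atTop_mono hlow (tendsto_natCast_atTop_atTop.atTop_mul_const hd0)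

end Partition

/-! ### Domination of the potential by the Hardy–Rellich form -/

section PotentialBound

variable {ν : ℝ} {U : ℝ → ℝ}

/-- The support of `u` stays away from the origin, so `x ^ (-ν) |u|²` is bounded. -/
theorem integrableOn_mul_norm_sq (hU : IntegrableOn (fun x => U x * x ^ ν) (Ioi 0))
    (u : 𝓓(halfLine, ℂ)) : IntegrableOn (fun x => U x * ‖u x‖ ^ 2) (Ioi 0) := by
  have hc : ContinuousOn (fun x : ℝ => x ^ (-ν)) (Ioi 0) :=
    continuousOn_id.rpow_const fun x hx => Or.inl (ne_of_gt hx)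
  have hsub : tsupport (fun x => ‖u x‖ ^ 2) ⊆ tsupport u :=
    closure_mono fun x hx => by simpa using hx
  have hcont : Continuous fun x : ℝ => x ^ (-ν) • ‖u x‖ ^ 2 :=
    continuous_smul_of_tsupport hc (by have := u.continuous; fun_prop) (hsub.trans (tsupport_test u))
  obtain ⟨C, hC⟩ := hcont.bounded_above_of_compact_support
    (HasCompactSupport.intro u.hasCompactSupport fun x hx => by simp [test_eq_zero hx])
  have h1 := hU.mul_bdd (c := C) hcont.aestronglyMeasurable (Eventually.of_forall hC)
  refine (integrableOn_congr_fun (fun x hx => ?_) measurableSet_Ioi).1 h1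
  have hx0 : (0 : ℝ) < x := hx
  simp only [smul_eq_mul]
  rw [mul_assoc, ← mul_assoc (x ^ ν), ← Real.rpow_add hx0, add_neg_cancel, Real.rpow_zero, one_mul]

/-- On a partition adapted to the potential `U`, the form `∫ U |u|²` is dominated by the
Hardy–Rellich form, up to corrections by point evaluations on short intervals. -/
theorem exists_partition_bound (hν₀ : 0 ≤ ν) (hν₃ : ν < 3)
    (hU0 : ∀ᵐ x ∂(volume : Measure ℝ).restrict (Ioi 0), 0 ≤ U x)
    (hU : IntegrableOn (fun x => U x * x ^ ν) (Ioi 0)) {δ : ℝ} (hδ : 0 < δ) :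
    ∃ b : ℕ → ℝ, StrictMono b ∧
      (∀ n, ∑ k ∈ Finset.range n, ((b (k + 1) - b k) ^ (3 - ν))⁻¹ ≤
        boundConst ν * ((∫ x in Ioi 0, U x * x ^ ν) + δ)) ∧
      ∀ (τ : ℝ) (S : Finset ℕ), 0 ≤ τ → (∀ k ∉ S, 6 * (b (k + 1) - b k)⁻¹ ^ 4 ≤ τ) →
        ∀ u : 𝓓(halfLine, ℂ), ∫ x in Ioi 0, U x * ‖u x‖ ^ 2 ≤
          ‖hardyOp u‖ ^ 2 + τ * ‖toL2 u‖ ^ 2 +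
            ∑ k ∈ S, (b (k + 1) - b k)⁻¹ ^ 3 * (‖u (b k)‖ ^ 2 + ‖u (b (k + 1))‖ ^ 2) := by
  have hκ : 0 < 3 - ν := by linarith
  have hK := boundConst_pos hν₃
  -- The added exponential gives every interval positive mass, so the partition can continue where
  -- `U` vanishes; it costs exactly `δ` in total mass.
  set g : ℝ → ℝ := fun x => U x * x ^ ν + δ * Real.exp (-x) with hg
  have hUx0 : ∀ᵐ x ∂(volume : Measure ℝ).restrict (Ioi 0), 0 ≤ U x * x ^ ν := by
    filter_upwards [hU0, ae_restrict_mem measurableSet_Ioi] with x hx hx0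
    exact mul_nonneg hx (Real.rpow_nonneg (le_of_lt hx0) _)
  have hexp : IntegrableOn (fun x : ℝ => δ * Real.exp (-x)) (Ioi 0) :=
    (integrableOn_exp_neg_Ioi 0).const_mul δ
  have hgi : IntegrableOn g (Ioi 0) := hU.add hexp
  have hUg : ∀ x, U x * x ^ ν ≤ g x := fun x => by
    simp only [hg]; linarith [mul_pos hδ (Real.exp_pos (-x))]
  have hg0 : ∀ᵐ x ∂(volume : Measure ℝ).restrict (Ioi 0), 0 ≤ g x := by
    filter_upwards [hUx0] with x hx
    exact hx.trans (hUg x)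
  have hgM : ∫ x in Ioi 0, g x = (∫ x in Ioi 0, U x * x ^ ν) + δ := by
    rw [hg, integral_add hU hexp, integral_const_mul, integral_exp_neg_Ioi_zero, mul_one]
  have hii : ∀ {f : ℝ → ℝ}, IntegrableOn f (Ioi 0) → ∀ c d : ℝ, 0 ≤ c → c ≤ d →
      IntervalIntegrable f volume c d := fun hf c d hc hcd =>
    (intervalIntegrable_iff_integrableOn_Ioc_of_le hcd).2
      (hf.mono_set fun x hx => lt_of_le_of_lt hc hx.1)
  have hres : ∀ {c d : ℝ}, 0 ≤ c → Ioc c d ⊆ Ioi 0 := fun hc x hx => lt_of_le_of_lt hc hx.1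
  have hpos : ∀ a b, 0 ≤ a → a < b → 0 < ∫ x in a..b, g x := by
    intro a b ha hab
    have h1 : 0 < ∫ x in a..b, δ * Real.exp (-x) :=
      intervalIntegral.intervalIntegral_pos_of_pos (Continuous.intervalIntegrable (by fun_prop) _ _)
        (fun x => mul_pos hδ (Real.exp_pos _)) hab
    refine h1.trans_le (intervalIntegral.integral_mono_ae_restrict hab.le (hii hexp a b ha hab.le)
      (hii hgi a b ha hab.le) ?_)
    rw [← restrict_Ioc_eq_restrict_Icc]
    filter_upwards [ae_restrict_of_ae_restrict_of_subset (hres ha) hUx0] with x hx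
    simp only [hg]
    linarith
  -- With `ε = 1 / boundConst ν` the constant of the pointwise bound cancels, and the energy on each
  -- interval appears with coefficient exactly one.
  obtain ⟨b, hb0, hmono, htop, hmass⟩ := exists_partition hgi hg0 hpos hκ (inv_pos.2 hK)
  have hbn : ∀ n, 0 ≤ b n := fun n => hb0 ▸ hmono.monotone (Nat.zero_le n)
  have hlt : ∀ k, b k < b (k + 1) := fun k => hmono (Nat.lt_succ_self k)
  have hℓ : ∀ k, 0 < b (k + 1) - b k := fun k => sub_pos.2 (hlt k)
  have hsum : ∀ {f : ℝ → ℝ}, IntegrableOn f (Ioi 0) → ∀ n,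
      ∑ k ∈ Finset.range n, ∫ x in b k..b (k + 1), f x = ∫ x in 0..b n, f x := fun hf n => by
    rw [intervalIntegral.sum_integral_adjacent_intervals fun k _ =>
      hii hf _ _ (hbn k) (hlt k).le, hb0]
  refine ⟨b, hmono, fun n => ?_, fun τ S hτ hS u => ?_⟩
  · have h1 : ∀ k ∈ Finset.range n, ((b (k + 1) - b k) ^ (3 - ν))⁻¹ =
        boundConst ν * ∫ x in b k..b (k + 1), g x := fun k _ => by
      have h2 := hmass k
      have h3 : 0 < (b (k + 1) - b k) ^ (3 - ν) := Real.rpow_pos_of_pos (hℓ k) _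
      field_simp
      field_simp at h2
      linarith
    rw [Finset.sum_congr rfl h1, ← Finset.mul_sum, hsum hgi, ← hgM]
    gcongr
    exact intervalIntegral_le_Ioi hgi hg0 le_rfl (hbn n)
  · have hUu := integrableOn_mul_norm_sq hU u
    have hloc : ∀ (k : ℕ) (Y : ℝ), 0 ≤ Y → (∀ x ∈ Ioc (b k) (b (k + 1)),
        ‖u x‖ ^ 2 ≤ boundConst ν * (x ^ ν * (b (k + 1) - b k) ^ (3 - ν) * Y)) →
        ∫ x in b k..b (k + 1), U x * ‖u x‖ ^ 2 ≤ Y := by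
      intro k Y hY hb
      have hc0 : 0 ≤ boundConst ν * (b (k + 1) - b k) ^ (3 - ν) * Y := by
        have := hℓ k
        positivity
      have h1 : ∫ x in b k..b (k + 1), U x * ‖u x‖ ^ 2 ≤
          ∫ x in b k..b (k + 1), boundConst ν * (b (k + 1) - b k) ^ (3 - ν) * Y * g x := by
        refine intervalIntegral.integral_mono_ae_restrict (hlt k).le
          (hii hUu _ _ (hbn k) (hlt k).le) ((hii hgi _ _ (hbn k) (hlt k).le).const_mul _) ?_
        rw [← restrict_Ioc_eq_restrict_Icc]
        filter_upwards [ae_restrict_of_ae_restrict_of_subset (hres (hbn k)) hU0,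
          ae_restrict_mem measurableSet_Ioc] with x hx0 hx
        calc U x * ‖u x‖ ^ 2 ≤
              U x * (boundConst ν * (x ^ ν * (b (k + 1) - b k) ^ (3 - ν) * Y)) := by
              gcongr; exact hb x hx
          _ = boundConst ν * (b (k + 1) - b k) ^ (3 - ν) * Y * (U x * x ^ ν) := by ring
          _ ≤ boundConst ν * (b (k + 1) - b k) ^ (3 - ν) * Y * g x := by
              gcongr; exact hUg x
      refine h1.trans (le_of_eq ?_)
      rw [intervalIntegral.integral_const_mul]
      calc _ = boundConst ν * ((b (k + 1) - b k) ^ (3 - ν) * ∫ x in b k..b (k + 1), g x) * Y := by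
            ring
        _ = Y := by rw [hmass k, mul_inv_cancel₀ hK.ne', one_mul]
    obtain ⟨m, R, hm, hmR, hsupp⟩ := exists_support_Ioo u.hasCompactSupport (tsupport_test u)
    -- Only the first `n` intervals meet the support of `u`, so all sums below are finite.
    obtain ⟨n, hn⟩ := (htop.eventually_ge_atTop R).exists
    have hD := (integrable_hardyDensity u).integrableOn (s := Ioi 0)
    have hN := integrableOn_norm_sq (memLp_test u)
    set p : ℕ → ℝ := fun k =>
      (b (k + 1) - b k)⁻¹ ^ 3 * (‖u (b k)‖ ^ 2 + ‖u (b (k + 1))‖ ^ 2) with hp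
    have hp0 : ∀ k, 0 ≤ p k := fun k => by
      have := hℓ k
      simp only [hp]; positivity
    have hD0 : ∀ k, 0 ≤ ∫ x in b k..b (k + 1), hardyDensity u x := fun k =>
      intervalIntegral.integral_nonneg (hlt k).le fun t _ => hardyDensity_nonneg _ t
    have hN0 : ∀ k, 0 ≤ ∫ x in b k..b (k + 1), ‖u x‖ ^ 2 := fun k =>
      intervalIntegral.integral_nonneg (hlt k).le fun t _ => by positivity
    have hk : ∀ k ∈ Finset.range n, ∫ x in b k..b (k + 1), U x * ‖u x‖ ^ 2 ≤
        ((∫ x in b k..b (k + 1), hardyDensity u x) + τ * ∫ x in b k..b (k + 1), ‖u x‖ ^ 2) +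
          if k ∈ S then p k else 0 := by
      intro k _
      -- On the intervals in `S` the bound is used with `p`, `q` the endpoints, which leaves point
      -- values. On the others it is used with averages, whose coefficient is at most `τ`.
      split_ifs with hkS
      · have h1 := hloc k _ (add_nonneg (hD0 k) (hp0 k)) fun x hx =>
          norm_sq_le_on_interval u hν₀ hν₃ (hbn k) (hlt k) hx (p := b k) (q := b (k + 1))
            ⟨le_rfl, by linarith [hℓ k]⟩ ⟨by linarith [hℓ k], le_rfl⟩
        have h2 := mul_nonneg hτ (hN0 k)
        linarith
      · have h1 := hloc k _ (add_nonneg (hD0 k) (mul_nonneg (by have := hℓ k; positivity) (hN0 k)))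
          fun x hx => norm_sq_le_of_average u hν₀ hν₃ (hbn k) (hlt k) hx
        have h2 := mul_le_mul_of_nonneg_right (hS k hkS) (hN0 k)
        linarith
    rw [integral_Ioi_eq_intervalIntegral le_rfl (hbn n) fun x hx => by
      rw [test_eq_zero fun h => hx ⟨hm.trans (hsupp h).1, (hsupp h).2.trans_le hn⟩]; simp,
      ← hsum hUu n]
    refine (Finset.sum_le_sum hk).trans ?_
    rw [Finset.sum_add_distrib, Finset.sum_add_distrib, ← Finset.mul_sum, hsum hD, hsum hN,
      norm_sq_hardyOp, norm_sq_toL2]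
    gcongr
    · exact intervalIntegral_le_Ioi hD (Eventually.of_forall fun t => hardyDensity_nonneg _ t)
        le_rfl (hbn n)
    · exact intervalIntegral_le_Ioi hN (Eventually.of_forall fun t => by positivity) le_rfl (hbn n)
    · rw [← Finset.sum_filter]
      exact Finset.sum_le_sum_of_subset_of_nonneg (fun k hk => (Finset.mem_filter.1 hk).2)
        fun k _ _ => hp0 k

end PotentialBound

/-! ### Form boundedness of the potential -/

section Potential

variable {ν : ℝ} {V : ℝ → ℝ}

/-- The potentials under consideration, as far as the definition of the form is concerned. -/
structure IsAdmissible (V : ℝ → ℝ) : Prop where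
  aemeasurable : AEMeasurable V ((volume : Measure ℝ).restrict (Ioi 0))
  nonneg : ∀ᵐ x ∂(volume : Measure ℝ).restrict (Ioi 0), 0 ≤ V x
  integrable : ∀ u : 𝓓(halfLine, ℂ), IntegrableOn (fun x => V x * ‖u x‖ ^ 2) (Ioi 0)

theorem norm_sq_sqrt_mul {v : ℝ} (hv : 0 ≤ v) (z : ℂ) :
    ‖((√v : ℝ) : ℂ) * z‖ ^ 2 = v * ‖z‖ ^ 2 := by
  rw [norm_mul, mul_pow, Complex.norm_real, Real.norm_eq_abs, sq_abs, Real.sq_sqrt hv]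

theorem IsAdmissible.memLp (hV : IsAdmissible V) (u : 𝓓(halfLine, ℂ)) :
    MemLp (fun x => ((√(V x) : ℝ) : ℂ) * u x) 2 ((volume : Measure ℝ).restrict (Ioi 0)) := by
  have hm : AEStronglyMeasurable (fun x => ((√(V x) : ℝ) : ℂ) * u x)
      ((volume : Measure ℝ).restrict (Ioi 0)) := by
    refine AEStronglyMeasurable.mul ?_ u.continuous.aestronglyMeasurable
    exact (Complex.measurable_ofReal.comp_aemeasurable
      (Real.continuous_sqrt.measurable.comp_aemeasurable hV.aemeasurable)).aestronglyMeasurable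
  rw [memLp_two_iff_integrable_sq_norm hm]
  refine (hV.integrable u).congr ?_
  filter_upwards [hV.nonneg] with x hx
  rw [norm_sq_sqrt_mul hx]

/-- Multiplication by `V ^ (1/2)`, from test functions to `L²(0, ∞)`. -/
def potOp (hV : IsAdmissible V) : 𝓓(halfLine, ℂ) →ₗ[ℂ] L2 :=
  toL2Of (fun u x => ((√(V x) : ℝ) : ℂ) * u x)
    (fun u v => by funext x; exact mul_add _ _ _)
    (fun c u => by funext x; exact mul_left_comm _ _ _)
    hV.memLp

theorem norm_sq_potOp (hV : IsAdmissible V) (u : 𝓓(halfLine, ℂ)) :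
    ‖potOp hV u‖ ^ 2 = ∫ x in Ioi 0, V x * ‖u x‖ ^ 2 := by
  refine (norm_sq_toLp (hV.memLp u)).trans (integral_congr_ae ?_)
  filter_upwards [hV.nonneg] with x hx
  rw [norm_sq_sqrt_mul hx]

theorem integrableOn_hardyRellich (u : 𝓓(halfLine, ℂ)) :
    IntegrableOn (fun x => ‖deriv (deriv u) x‖ ^ 2
      - hardyRellichConst * (‖u x‖ ^ 2 / x ^ 4)) (Ioi 0) :=
  (integrable_hardyRellich u).integrableOn

theorem IsAdmissible.integrableOn_energyDensity (hV : IsAdmissible V) (u : 𝓓(halfLine, ℂ)) :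
    IntegrableOn (energyDensity V u) (Ioi 0) :=
  (integrableOn_hardyRellich u).sub (hV.integrable u)

theorem IsAdmissible.energy_eq (hV : IsAdmissible V) (u : 𝓓(halfLine, ℂ)) :
    energy V u = ‖hardyOp u‖ ^ 2 - ‖potOp hV u‖ ^ 2 := by
  rw [norm_sq_hardyOp, norm_sq_potOp, ← integral_hardyDensity]
  exact integral_sub (integrableOn_hardyRellich u) (hV.integrable u)

theorem boundedBelowUpToRank_of_sum {H K K' E : Type*} [NormedAddCommGroup H]
    [InnerProductSpace ℂ H] [NormedAddCommGroup K] [InnerProductSpace ℂ K]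
    [NormedAddCommGroup K'] [InnerProductSpace ℂ K'] [AddCommGroup E] [Module ℂ E]
    {j : E →ₗ[ℂ] H} {A : E →ₗ[ℂ] K} {B : E →ₗ[ℂ] K'} {τ : ℝ} {ι : Type*} [Fintype ι]
    (ℓ : ι → E →ₗ[ℂ] ℂ) (hℓ : ∀ i, ∃ C, ∀ u, ‖ℓ i u‖ ^ 2 ≤ C * (‖j u‖ ^ 2 + ‖A u‖ ^ 2))
    (h : ∀ u, ‖B u‖ ^ 2 ≤ ‖A u‖ ^ 2 + τ * ‖j u‖ ^ 2 + ∑ i, ‖ℓ i u‖ ^ 2) :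
    BoundedBelowUpToRank j A B τ (Fintype.card ι) := by
  let e := Fintype.equivFin ι
  let L : E →ₗ[ℂ] EuclideanSpace ℂ (Fin (Fintype.card ι)) :=
    (WithLp.linearEquiv 2 ℂ (Fin (Fintype.card ι) → ℂ)).symm.toLinearMap ∘ₗ
      LinearMap.pi fun i => ℓ (e.symm i)
  have hL : ∀ u, ‖L u‖ ^ 2 = ∑ i, ‖ℓ i u‖ ^ 2 := fun u => by
    rw [EuclideanSpace.norm_sq_eq, ← Equiv.sum_comp e.symm]
    rfl
  choose C hC using hℓ
  refine ⟨L, ⟨∑ i, C i, fun u => ?_⟩, fun u => ?_⟩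
  · rw [hL, Finset.sum_mul]
    exact Finset.sum_le_sum fun i _ => hC i u
  · rw [hL]; exact h u

/-- Point evaluation, as a linear functional on test functions. -/
def evalTest (x : ℝ) : 𝓓(halfLine, ℂ) →ₗ[ℂ] ℂ where
  toFun u := u x
  map_add' _ _ := rfl
  map_smul' _ _ := rfl

/-- A version of `exists_partition_bound` for a potential `V ≤ U + σ`. -/
theorem IsAdmissible.exists_boundedBelowUpToRank (hV : IsAdmissible V) (hν₀ : 0 ≤ ν) (hν₃ : ν < 3)
    {U : ℝ → ℝ} {σ : ℝ} (hVU : ∀ᵐ x ∂(volume : Measure ℝ).restrict (Ioi 0), V x ≤ U x + σ)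
    (hU0 : ∀ᵐ x ∂(volume : Measure ℝ).restrict (Ioi 0), 0 ≤ U x)
    (hU : IntegrableOn (fun x => U x * x ^ ν) (Ioi 0)) {δ : ℝ} (hδ : 0 < δ) :
    ∃ b : ℕ → ℝ, StrictMono b ∧
      (∀ n, ∑ k ∈ Finset.range n, ((b (k + 1) - b k) ^ (3 - ν))⁻¹ ≤
        boundConst ν * ((∫ x in Ioi 0, U x * x ^ ν) + δ)) ∧
      ∀ (τ : ℝ) (S : Finset ℕ), 0 ≤ τ → (∀ k ∉ S, 6 * (b (k + 1) - b k)⁻¹ ^ 4 ≤ τ) →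
        BoundedBelowUpToRank toL2 hardyOp (potOp hV) (σ + τ) (2 * S.card) := by
  obtain ⟨b, hmono, hsum, hb⟩ := exists_partition_bound hν₀ hν₃ hU0 hU hδ
  refine ⟨b, hmono, hsum, fun τ S hτ hS => ?_⟩
  have hℓ : ∀ k, 0 ≤ (b (k + 1) - b k)⁻¹ ^ 3 := fun k => by
    have : 0 < b (k + 1) - b k := sub_pos.2 (hmono (Nat.lt_succ_self k))
    positivity
  -- Two functionals per interval, one for each endpoint; an endpoint shared by two intervals is
  -- counted twice.
  let ℓ : (S ⊕ S) → 𝓓(halfLine, ℂ) →ₗ[ℂ] ℂ := Sum.elim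
    (fun k => ((√((b (k + 1) - b k)⁻¹ ^ 3) : ℝ) : ℂ) • evalTest (b k))
    (fun k => ((√((b (k + 1) - b k)⁻¹ ^ 3) : ℝ) : ℂ) • evalTest (b (k + 1)))
  have hnl : ∀ (k : ℕ) (x : ℝ) (u : 𝓓(halfLine, ℂ)),
      ‖(((√((b (k + 1) - b k)⁻¹ ^ 3) : ℝ) : ℂ) • evalTest x) u‖ ^ 2 =
        (b (k + 1) - b k)⁻¹ ^ 3 * ‖u x‖ ^ 2 := fun k x u =>
    norm_sq_sqrt_mul (hℓ k) (u x)
  have hbd : ∀ (k : ℕ) (x : ℝ), ∃ C, ∀ u : 𝓓(halfLine, ℂ),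
      ‖(((√((b (k + 1) - b k)⁻¹ ^ 3) : ℝ) : ℂ) • evalTest x) u‖ ^ 2 ≤
        C * (‖toL2 u‖ ^ 2 + ‖hardyOp u‖ ^ 2) := fun k x => by
    obtain ⟨C, hC⟩ := exists_norm_sq_eval_le x
    refine ⟨(b (k + 1) - b k)⁻¹ ^ 3 * C, fun u => ?_⟩
    rw [hnl, mul_assoc]
    exact mul_le_mul_of_nonneg_left (hC u) (hℓ k)
  have hcard : Fintype.card (S ⊕ S) = 2 * S.card := by
    rw [Fintype.card_sum, Fintype.card_coe, two_mul]
  rw [← hcard]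
  refine boundedBelowUpToRank_of_sum ℓ ?_ fun u => ?_
  · rintro (k | k)
    · exact hbd k _
    · exact hbd k _
  · have hsumℓ : ∑ i, ‖ℓ i u‖ ^ 2 =
        ∑ k ∈ S, (b (k + 1) - b k)⁻¹ ^ 3 * (‖u (b k)‖ ^ 2 + ‖u (b (k + 1))‖ ^ 2) := by
      rw [Fintype.sum_sum_type, ← Finset.sum_coe_sort S, ← Finset.sum_add_distrib]
      refine Finset.sum_congr rfl fun k _ => ?_
      rw [mul_add, ← hnl, ← hnl]
      rfl
    have h1 := hb τ S hτ hS u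
    have h2 : ∫ x in Ioi 0, V x * ‖u x‖ ^ 2 ≤
        ∫ x in Ioi 0, (U x * ‖u x‖ ^ 2 + σ * ‖u x‖ ^ 2) := by
      refine integral_mono_ae (hV.integrable u) ((integrableOn_mul_norm_sq hU u).add
        ((integrableOn_norm_sq (memLp_test u)).const_mul σ)) ?_
      filter_upwards [hVU] with x hx
      rw [← add_mul]
      gcongr
    rw [integral_add (integrableOn_mul_norm_sq hU u)
      ((integrableOn_norm_sq (memLp_test u)).const_mul σ), integral_const_mul,
      ← norm_sq_toL2, ← norm_sq_potOp hV] at h2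
    rw [hsumℓ]
    linarith

/-- The partition needs a weight linear in the potential, while only `V ^ p` is integrable against
`x ^ ν`. Where `v > σ`, the factor `v ^ (1 - p)` is at most `σ ^ (1 - p)`, so truncation bridges the
gap. -/
theorem max_sub_zero_le {v σ p : ℝ} (hv : 0 ≤ v) (hσ : 0 < σ) (hp : 1 ≤ p) :
    max (v - σ) 0 ≤ σ ^ (1 - p) * v ^ p := by
  have h0 : 0 ≤ σ ^ (1 - p) * v ^ p := by positivity
  rcases le_or_gt v σ with h | h
  · rw [max_eq_right (by linarith)]; exact h0
  · refine max_le ?_ h0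
    have hv0 : 0 < v := hσ.trans h
    have h1 : v ^ (1 - p) ≤ σ ^ (1 - p) := Real.rpow_le_rpow_of_nonpos hσ h.le (by linarith)
    calc v - σ ≤ v := by linarith
      _ = v ^ (1 - p) * v ^ p := by rw [← Real.rpow_add hv0]; simp
      _ ≤ _ := by gcongr

theorem inv_pow_four_le {ℓ κ Q : ℝ} (hℓ : 0 < ℓ) (hκ : 0 < κ) (h : (ℓ ^ κ)⁻¹ ≤ Q) :
    ℓ⁻¹ ^ 4 ≤ Q ^ (4 / κ) := by
  have h1 : ℓ⁻¹ ^ 4 = ((ℓ ^ κ)⁻¹) ^ (4 / κ) := by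
    rw [← Real.inv_rpow hℓ.le, ← Real.rpow_mul (by positivity), mul_div_cancel₀ _ hκ.ne',
      ← Real.rpow_natCast]
    norm_num
  rw [h1]
  exact Real.rpow_le_rpow (by positivity) h (by positivity)

variable {p : ℝ} (hp : 1 ≤ p) (hV0 : ∀ᵐ x ∂(volume : Measure ℝ).restrict (Ioi 0), 0 ≤ V x)
  (hVp : IntegrableOn (fun x : ℝ => V x ^ p * x ^ ν) (Ioi 0))

include hp hV0 hVp

/-- Measurability of `V` is not assumed; it is recovered by solving for `V` in the integrable
function `V ^ p x ^ ν`. -/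
theorem aemeasurable_of_rpow : AEMeasurable V ((volume : Measure ℝ).restrict (Ioi 0)) := by
  have h1 : AEMeasurable (fun x : ℝ => ((V x ^ p * x ^ ν) * x ^ (-ν)) ^ p⁻¹)
      ((volume : Measure ℝ).restrict (Ioi 0)) :=
    ((hVp.aestronglyMeasurable.aemeasurable).mul
      (measurable_id.pow_const (-ν)).aemeasurable).pow_const _
  refine h1.congr ?_
  filter_upwards [hV0, ae_restrict_mem measurableSet_Ioi] with x hx hx0
  have hx0' : (0 : ℝ) < x := hx0
  rw [mul_assoc, ← Real.rpow_add hx0', add_neg_cancel, Real.rpow_zero, mul_one,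
    ← Real.rpow_mul hx, mul_inv_cancel₀ (by linarith), Real.rpow_one]

theorem integrableOn_max_sub {σ : ℝ} (hσ : 0 < σ) :
    IntegrableOn (fun x => max (V x - σ) 0 * x ^ ν) (Ioi 0) := by
  have hm := aemeasurable_of_rpow hp hV0 hVp
  refine (hVp.const_mul (σ ^ (1 - p))).mono' ?_ ?_
  · exact (((hm.sub_const σ).max aemeasurable_const).mul
      (measurable_id.pow_const ν).aemeasurable).aestronglyMeasurable
  · filter_upwards [hV0, ae_restrict_mem measurableSet_Ioi] with x hx hx0
    have hx0' : (0 : ℝ) < x := hx0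
    rw [Real.norm_eq_abs, abs_of_nonneg (by positivity), ← mul_assoc]
    gcongr
    exact max_sub_zero_le hx hσ hp

theorem isAdmissible_of_rpow : IsAdmissible V := by
  have hm := aemeasurable_of_rpow hp hV0 hVp
  refine ⟨hm, hV0, fun u => ?_⟩
  have h1 := (integrableOn_mul_norm_sq (integrableOn_max_sub hp hV0 hVp one_pos) u).add
    (integrableOn_norm_sq (memLp_test u))
  refine Integrable.mono' h1 (hm.aestronglyMeasurable.mul
    (by have := u.continuous; fun_prop : Continuous fun x => ‖u x‖ ^ 2).aestronglyMeasurable) ?_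
  filter_upwards [hV0] with x hx
  rw [Real.norm_eq_abs, abs_of_nonneg (by positivity)]
  have : V x ≤ max (V x - 1) 0 + 1 := by linarith [le_max_left (V x - 1) 0]
  calc V x * ‖u x‖ ^ 2 ≤ (max (V x - 1) 0 + 1) * ‖u x‖ ^ 2 := by gcongr
    _ = _ := by simp [add_mul]

/-- The potential is form bounded with respect to the Hardy–Rellich form. -/
theorem exists_relative_bound (hν₀ : 0 ≤ ν) (hν₃ : ν < 3) (hV : IsAdmissible V) :
    ∃ c, ∀ u, ‖potOp hV u‖ ^ 2 ≤ (1 / 2) * ‖hardyOp u‖ ^ 2 + c * ‖toL2 u‖ ^ 2 := by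
  have hU := integrableOn_max_sub hp hV0 hVp one_pos
  -- Twice the truncated potential is dominated with coefficient one, which yields the relative
  -- bound 1/2.
  have hU2 : IntegrableOn (fun x => (2 * max (V x - 1) 0) * x ^ ν) (Ioi 0) := by
    simp only [mul_assoc]
    exact hU.const_mul 2
  obtain ⟨b, hmono, hsum, hb⟩ := exists_partition_bound hν₀ hν₃
    (Eventually.of_forall fun x => by positivity) hU2 one_pos
  have hℓ : ∀ k, 0 < b (k + 1) - b k := fun k => sub_pos.2 (hmono (Nat.lt_succ_self k))
  set Q := boundConst ν * ((∫ x in Ioi 0, (2 * max (V x - 1) 0) * x ^ ν) + 1) with hQ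
  have hk : ∀ k, ((b (k + 1) - b k) ^ (3 - ν))⁻¹ ≤ Q := fun k => by
    refine le_trans ?_ (hsum (k + 1))
    refine Finset.single_le_sum (f := fun k => ((b (k + 1) - b k) ^ (3 - ν))⁻¹) (fun i _ => ?_)
      (Finset.self_mem_range_succ k)
    have := hℓ i
    positivity
  have hκ : 0 < 3 - ν := by linarith
  have hQ0 : 0 ≤ Q := le_trans (by have := hℓ 0; positivity) (hk 0)
  refine ⟨6 * Q ^ (4 / (3 - ν)) / 2 + 1, fun u => ?_⟩
  -- The bounded sum of `(length ^ (3 - ν))⁻¹` bounds all lengths below, so for this `τ` no interval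
  -- needs point evaluations.
  have h1 := hb (6 * Q ^ (4 / (3 - ν))) ∅ (by positivity)
    (fun k _ => by have := inv_pow_four_le (hℓ k) hκ (hk k); linarith) u
  rw [Finset.sum_empty, add_zero] at h1
  have hi := integrableOn_mul_norm_sq hU2 u
  have hi1 := (hi.const_mul (1 / 2)).add (integrableOn_norm_sq (memLp_test u))
  have h2 : ∫ x in Ioi 0, V x * ‖u x‖ ^ 2 ≤
      ∫ x in Ioi 0, (1 / 2 * (2 * max (V x - 1) 0 * ‖u x‖ ^ 2) + ‖u x‖ ^ 2) := by
    refine integral_mono (hV.integrable u) hi1 fun x => ?_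
    have : V x ≤ max (V x - 1) 0 + 1 := by linarith [le_max_left (V x - 1) 0]
    calc V x * ‖u x‖ ^ 2 ≤ (max (V x - 1) 0 + 1) * ‖u x‖ ^ 2 := by gcongr
      _ = _ := by ring
  rw [integral_add (hi.const_mul (1 / 2)) (integrableOn_norm_sq (memLp_test u)),
    integral_const_mul, ← norm_sq_toL2, ← norm_sq_potOp hV] at h2
  linarith

end Potential

/-! ### Moments of the negative eigenvalues -/

section Trace

/-- The layer cake representation of a power. -/
theorem lintegral_layer {γ : ℝ} (hγ : 0 < γ) {R : ℝ} (hR : 0 ≤ R) :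
    ∫⁻ τ in Ioi (0 : ℝ), ENNReal.ofReal (γ * τ ^ (γ - 1)) * (Iio R).indicator 1 τ =
      ENNReal.ofReal (R ^ γ) := by
  have h1 : ∀ τ : ℝ, ENNReal.ofReal (γ * τ ^ (γ - 1)) * (Iio R).indicator 1 τ =
      (Iio R).indicator (fun τ => ENNReal.ofReal (γ * τ ^ (γ - 1))) τ := fun τ => by
    by_cases h : τ ∈ Iio R <;> simp [h]
  simp_rw [h1]
  rw [lintegral_indicator measurableSet_Iio, Measure.restrict_restrict measurableSet_Iio,
    Iio_inter_Ioi, restrict_Ioo_eq_restrict_Ioc,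
    ← ofReal_integral_eq_lintegral_ofReal]
  · rw [← intervalIntegral.integral_of_le hR, intervalIntegral.integral_const_mul,
      integral_rpow (Or.inl (by linarith)), sub_add_cancel, Real.zero_rpow hγ.ne', sub_zero,
      mul_div_cancel₀ _ hγ.ne']
  · exact ((intervalIntegrable_iff_integrableOn_Ioc_of_le hR).1
      (intervalIntegral.intervalIntegrable_rpow' (by linarith))).const_mul γ
  · filter_upwards [ae_restrict_mem measurableSet_Ioc] with τ hτ
    have := hτ.1
    positivity

variable {H : Type*} [NormedAddCommGroup H] [InnerProductSpace ℂ H]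

/-- A bound on the number of eigenvalues below `-τ`, for each `τ > 0`, implies a bound on the
moments of the negative eigenvalues. -/
theorem negTrace_le_lintegral {T : H →ₗ.[ℂ] H} {γ : ℝ} (hγ : 0 < γ) {N : ℝ → ℝ≥0∞}
    (hfin : ∀ r : ℝ, r < 0 → FiniteDimensional ℂ (eigenspace T r))
    (hN : ∀ τ : ℝ, 0 < τ → ∀ s : Finset ℝ, (∀ r ∈ s, r < -τ) →
      ((∑ r ∈ s, Module.finrank ℂ (eigenspace T (r : ℝ)) : ℕ) : ℝ≥0∞) ≤ N τ) :
    negTrace T γ ≤ ∫⁻ τ in Ioi (0 : ℝ), ENNReal.ofReal (γ * τ ^ (γ - 1)) * N τ := by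
  classical
  rw [negTrace, ENNReal.tsum_eq_iSup_sum]
  refine iSup_le fun s => ?_
  have hmeas : Measurable fun τ : ℝ => ENNReal.ofReal (γ * τ ^ (γ - 1)) :=
    ((measurable_id.pow_const (γ - 1)).const_mul γ).ennreal_ofReal
  have hterm : ∀ r ∈ s, ((Cardinal.toENat (Module.rank ℂ (eigenspace T ((r : ℝ) : ℂ)))) : ℝ≥0∞) *
      ENNReal.ofReal (|(r : ℝ)| ^ γ) =
      ∫⁻ τ in Ioi (0 : ℝ), (Module.finrank ℂ (eigenspace T ((r : ℝ) : ℂ)) : ℝ≥0∞) *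
        (ENNReal.ofReal (γ * τ ^ (γ - 1)) * (Iio |(r : ℝ)|).indicator 1 τ) := by
    intro r _
    have := hfin r r.2
    rw [lintegral_const_mul, lintegral_layer hγ (abs_nonneg _)]
    · rw [← Module.finrank_eq_rank, Cardinal.toENat_nat, ENat.toENNReal_coe]
    · exact hmeas.mul (measurable_one.indicator measurableSet_Iio)
  rw [Finset.sum_congr rfl hterm, ← lintegral_finsetSum]
  · refine setLIntegral_mono' measurableSet_Ioi fun τ hτ => ?_
    -- At level `τ` exactly the eigenvalues below `-τ` contribute, so the integrand is a counting
    -- function.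
    have h1 : ∀ r ∈ s, (Module.finrank ℂ (eigenspace T ((r : ℝ) : ℂ)) : ℝ≥0∞) *
        (ENNReal.ofReal (γ * τ ^ (γ - 1)) * (Iio |(r : ℝ)|).indicator 1 τ) =
        ENNReal.ofReal (γ * τ ^ (γ - 1)) *
          if (r : ℝ) < -τ then (Module.finrank ℂ (eigenspace T ((r : ℝ) : ℂ)) : ℝ≥0∞) else 0 := by
      intro r _
      have hr := r.2
      have hiff : τ ∈ Iio |(r : ℝ)| ↔ (r : ℝ) < -τ := by
        rw [mem_Iio, abs_of_neg hr]
        constructor <;> intro h <;> linarith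
      by_cases h : (r : ℝ) < -τ
      · rw [indicator_of_mem (hiff.2 h), if_pos h, Pi.one_apply, mul_one, mul_comm]
      · rw [indicator_of_notMem (fun h' => h (hiff.1 h')), if_neg h]
        simp
    rw [Finset.sum_congr rfl h1, ← Finset.mul_sum]
    gcongr
    refine le_trans (le_of_eq ?_) (hN τ hτ 
      ((s.filter fun r : {r : ℝ // r < 0} => (r : ℝ) < -τ).image Subtype.val) ?_)
    · rw [Finset.sum_image (fun _ _ _ _ h => Subtype.ext h), ← Finset.sum_filter]
      push_cast
      rfl
    · intro r hr
      obtain ⟨r', hr', rfl⟩ := Finset.mem_image.1 hr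
      exact (Finset.mem_filter.1 hr').2
  · intro r _
    exact (hmeas.mul (measurable_one.indicator measurableSet_Iio)).const_mul _

end Trace

/-! ### Counting the short intervals of the partition -/

section Counting

variable {ℓ : ℕ → ℝ} {κ Q : ℝ}

theorem rpow_eq_six_mul {x κ : ℝ} (hx : 0 < x) :
    (6 * x⁻¹ ^ 4) ^ (κ / 4) = 6 ^ (κ / 4) * (x ^ κ)⁻¹ := by
  rw [Real.mul_rpow (by norm_num) (by positivity), ← Real.rpow_natCast x⁻¹ 4,
    ← Real.rpow_mul (by positivity), Real.inv_rpow hx.le]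
  congr 3
  push_cast
  ring

/-- Only finitely many intervals of the partition are shorter than a given length, and their number
is controlled. -/
theorem finite_short_intervals (hκ : 0 < κ) (hℓ : ∀ k, 0 < ℓ k)
    (hsum : ∀ n, ∑ k ∈ Finset.range n, (ℓ k ^ κ)⁻¹ ≤ Q) {τ : ℝ} (hτ : 0 < τ) :
    ∃ S : Finset ℕ, (∀ k, k ∈ S ↔ τ < 6 * (ℓ k)⁻¹ ^ 4) ∧
      (S.card : ℝ) ≤ 6 ^ (κ / 4) * Q * τ ^ (-(κ / 4)) := by
  have hnn : ∀ k, 0 ≤ (ℓ k ^ κ)⁻¹ := fun k => by have := hℓ k; positivity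
  have hsm : Summable fun k => (ℓ k ^ κ)⁻¹ := summable_of_sum_range_le hnn hsum
  have hlow : ∀ k, τ < 6 * (ℓ k)⁻¹ ^ 4 → τ ^ (κ / 4) ≤ 6 ^ (κ / 4) * (ℓ k ^ κ)⁻¹ := fun k hk => by
    rw [← rpow_eq_six_mul (hℓ k)]
    exact Real.rpow_le_rpow hτ.le hk.le (by positivity)
  have hτ' : 0 < τ ^ (κ / 4) := by positivity
  have h6 : (0 : ℝ) < 6 ^ (κ / 4) := by positivity
  have hfin : {k | τ < 6 * (ℓ k)⁻¹ ^ 4}.Finite := by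
    have h1 := (hsm.mul_left (6 ^ (κ / 4))).tendsto_cofinite_zero.eventually_lt_const hτ'
    rw [eventually_cofinite] at h1
    exact h1.subset fun k hk => not_lt.2 (hlow k hk)
  refine ⟨hfin.toFinset, fun k => by simp, ?_⟩
  -- Chebyshev's inequality: each short interval contributes at least `τ ^ (κ / 4)` to a sum bounded
  -- by `6 ^ (κ / 4) * Q`.
  have h2 : (hfin.toFinset.card : ℝ) * τ ^ (κ / 4) ≤ 6 ^ (κ / 4) * Q := by
    calc (hfin.toFinset.card : ℝ) * τ ^ (κ / 4) = ∑ k ∈ hfin.toFinset, τ ^ (κ / 4) := by simp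
      _ ≤ ∑ k ∈ hfin.toFinset, 6 ^ (κ / 4) * (ℓ k ^ κ)⁻¹ :=
        Finset.sum_le_sum fun k hk => hlow k (by simpa using hk)
      _ = 6 ^ (κ / 4) * ∑ k ∈ hfin.toFinset, (ℓ k ^ κ)⁻¹ := by rw [Finset.mul_sum]
      _ ≤ 6 ^ (κ / 4) * Q := by
        gcongr
        exact (hsm.sum_le_tsum _ fun k _ => hnn k).trans (Real.tsum_le_of_sum_range_le hnn hsum)
  rw [Real.rpow_neg hτ.le, ← div_eq_mul_inv, le_div_iff₀ hτ']
  exact h2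

/-- The integrated form of `finite_short_intervals`, in the critical case. -/
theorem lintegral_short_intervals (hκ : 0 < κ) (hℓ : ∀ k, 0 < ℓ k)
    (hsum : ∀ n, ∑ k ∈ Finset.range n, (ℓ k ^ κ)⁻¹ ≤ Q) :
    ∫⁻ τ in Ioi (0 : ℝ), ENNReal.ofReal (κ / 4 * τ ^ (κ / 4 - 1)) *
      (2 * ∑' k, (Iio (6 * (ℓ k)⁻¹ ^ 4)).indicator 1 τ) ≤
        ENNReal.ofReal (2 * 6 ^ (κ / 4) * Q) := by
  have hnn : ∀ k, 0 ≤ (ℓ k ^ κ)⁻¹ := fun k => by have := hℓ k; positivity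
  have hsm : Summable fun k => (ℓ k ^ κ)⁻¹ := summable_of_sum_range_le hnn hsum
  have hmeas : Measurable fun τ : ℝ => ENNReal.ofReal (κ / 4 * τ ^ (κ / 4 - 1)) :=
    ((measurable_id.pow_const (κ / 4 - 1)).const_mul (κ / 4)).ennreal_ofReal
  have h1 : ∀ τ : ℝ, ENNReal.ofReal (κ / 4 * τ ^ (κ / 4 - 1)) *
      (2 * ∑' k, (Iio (6 * (ℓ k)⁻¹ ^ 4)).indicator (1 : ℝ → ℝ≥0∞) τ) =
      2 * ∑' k, ENNReal.ofReal (κ / 4 * τ ^ (κ / 4 - 1)) *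
        (Iio (6 * (ℓ k)⁻¹ ^ 4)).indicator 1 τ := fun τ => by
    rw [ENNReal.tsum_mul_left]; ring
  have hm : ∀ k, Measurable fun τ : ℝ => ENNReal.ofReal (κ / 4 * τ ^ (κ / 4 - 1)) *
      (Iio (6 * (ℓ k)⁻¹ ^ 4)).indicator 1 τ := fun k =>
    hmeas.mul (measurable_one.indicator measurableSet_Iio)
  simp_rw [h1]
  rw [lintegral_const_mul _ (Measurable.tsum hm),
    lintegral_tsum fun k => (hm k).aemeasurable]
  -- The exponent `κ / 4` is the one for which the moment of the threshold `6 ℓ⁻⁴` is a multiple of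
  -- `ℓ ^ (-κ)`, the quantity whose sum is controlled.
  have h2 : ∀ k, ∫⁻ τ in Ioi (0 : ℝ), ENNReal.ofReal (κ / 4 * τ ^ (κ / 4 - 1)) *
      (Iio (6 * (ℓ k)⁻¹ ^ 4)).indicator 1 τ =
      ENNReal.ofReal (6 ^ (κ / 4)) * ENNReal.ofReal ((ℓ k ^ κ)⁻¹) := fun k => by
    have := hℓ k
    rw [lintegral_layer (by positivity) (by positivity), rpow_eq_six_mul (hℓ k),
      ENNReal.ofReal_mul (by positivity)]
  simp_rw [h2]
  rw [ENNReal.tsum_mul_left, ← ENNReal.ofReal_tsum_of_nonneg hnn hsm, mul_assoc,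
    ENNReal.ofReal_mul (by norm_num : (0 : ℝ) ≤ 2), ENNReal.ofReal_mul (by positivity),
    ENNReal.ofReal_ofNat]
  gcongr
  exact Real.tsum_le_of_sum_range_le hnn hsum

end Counting

/-! ### Eigenvalue moments at and above the critical exponent -/

section Moments

variable {ν p : ℝ} {V : ℝ → ℝ}

/-- The eigenvalues of `T` below `-τ` number at most `n` whenever the form is bounded below by `-τ`
up to a correction of rank `n`. -/
def CountsEigenvalues (hV : IsAdmissible V) (T : L2 →ₗ.[ℂ] L2) : Prop :=
  ∀ (τ : ℝ) (n : ℕ), BoundedBelowUpToRank toL2 hardyOp (potOp hV) τ n →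
    ∀ s : Finset ℝ, (∀ r ∈ s, r < -τ) →
      (∀ r ∈ s, FiniteDimensional ℂ (eigenspace T (r : ℝ))) ∧
        ∑ r ∈ s, Module.finrank ℂ (eigenspace T (r : ℝ)) ≤ n

/-- The constant in the bound on the number of eigenvalues. -/
def countConst (ν : ℝ) : ℝ := 2 * 6 ^ ((3 - ν) / 4) * boundConst ν

theorem countConst_pos (hν₃ : ν < 3) : 0 < countConst ν := by
  have := boundConst_pos hν₃
  rw [countConst]
  positivity

/-- Half of `τ` is spent on `V ≤ (V - τ/2)_+ + τ/2`, the other half on the long intervals of the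
partition for `(V - τ/2)_+`. -/
theorem exists_boundedBelowUpToRank_max (hν₀ : 0 ≤ ν) (hν₃ : ν < 3) (hp : 1 ≤ p)
    (hV : IsAdmissible V) (hVp : IntegrableOn (fun x : ℝ => V x ^ p * x ^ ν) (Ioi 0))
    {τ δ : ℝ} (hτ : 0 < τ) (hδ : 0 < δ) :
    ∃ n : ℕ, BoundedBelowUpToRank toL2 hardyOp (potOp hV) τ n ∧
      (n : ℝ) ≤ countConst ν * (τ / 2) ^ (-((3 - ν) / 4)) *
        ((∫ x in Ioi 0, max (V x - τ / 2) 0 * x ^ ν) + δ) := by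
  have hκ : 0 < 3 - ν := by linarith
  obtain ⟨b, hmono, hsum, hb⟩ := hV.exists_boundedBelowUpToRank hν₀ hν₃
    (U := fun x => max (V x - τ / 2) 0) (σ := τ / 2)
    (Eventually.of_forall fun x => by linarith [le_max_left (V x - τ / 2) 0])
    (Eventually.of_forall fun x => le_max_right _ _)
    (integrableOn_max_sub hp hV.nonneg hVp (half_pos hτ)) hδ
  obtain ⟨S, hS, hcard⟩ := finite_short_intervals hκ
    (ℓ := fun k => b (k + 1) - b k) (fun k => sub_pos.2 (hmono (Nat.lt_succ_self k))) hsum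
    (half_pos hτ)
  refine ⟨2 * S.card, ?_, ?_⟩
  · have := hb (τ / 2) S (half_pos hτ).le fun k hk => not_lt.1 fun h => hk ((hS k).2 h)
    rwa [add_halves] at this
  · push_cast
    calc (2 : ℝ) * S.card ≤ 2 * _ := mul_le_mul_of_nonneg_left hcard (by norm_num)
      _ = _ := by rw [countConst]; ring

theorem CountsEigenvalues.finiteDimensional {hV : IsAdmissible V} {T : L2 →ₗ.[ℂ] L2}
    (hT : CountsEigenvalues hV T) (hν₀ : 0 ≤ ν) (hν₃ : ν < 3) (hp : 1 ≤ p)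
    (hVp : IntegrableOn (fun x : ℝ => V x ^ p * x ^ ν) (Ioi 0)) (r : ℝ) (hr : r < 0) :
    FiniteDimensional ℂ (eigenspace T r) := by
  obtain ⟨n, hn, -⟩ := exists_boundedBelowUpToRank_max hν₀ hν₃ hp hV hVp
    (τ := -r / 2) (by linarith) one_pos
  exact (hT _ n hn {r} (by intro r' hr'; rw [Finset.mem_singleton.1 hr']; linarith)).1 r (by simp)

/-- The bound in the critical case. -/
theorem CountsEigenvalues.negTrace_le_critical {hV : IsAdmissible V} {T : L2 →ₗ.[ℂ] L2}
    (hT : CountsEigenvalues hV T) (hν₀ : 0 ≤ ν) (hν₃ : ν < 3)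
    (hVi : IntegrableOn (fun x : ℝ => V x * x ^ ν) (Ioi 0)) :
    negTrace T ((3 - ν) / 4) ≤ ENNReal.ofReal (countConst ν * ∫ x in Ioi 0, V x * x ^ ν) := by
  have hκ : 0 < 3 - ν := by linarith
  have hC := countConst_pos hν₃
  set M := ∫ x in Ioi 0, V x * x ^ ν with hM
  have hM0 : 0 ≤ M := by
    refine integral_nonneg_of_ae ?_
    filter_upwards [hV.nonneg, ae_restrict_mem measurableSet_Ioi] with x hx hx0
    exact mul_nonneg hx (Real.rpow_nonneg (le_of_lt hx0) _)
  have hfin := hT.finiteDimensional hν₀ hν₃ le_rfl (by simpa using hVi)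
  have key : ∀ δ : ℝ, 0 < δ → negTrace T ((3 - ν) / 4) ≤
      ENNReal.ofReal (countConst ν * (M + δ)) := by
    intro δ hδ
    -- With `σ = 0` one partition serves all `τ`, so the count can be integrated interval by
    -- interval. The bound for each separate `τ` would lead to a divergent ∫ dτ / τ at this
    -- exponent.
    obtain ⟨b, hmono, hsum, hb⟩ := hV.exists_boundedBelowUpToRank hν₀ hν₃ (U := V) (σ := 0)
      (Eventually.of_forall fun x => by simp) hV.nonneg hVi hδ
    have hℓ : ∀ k, 0 < b (k + 1) - b k := fun k => sub_pos.2 (hmono (Nat.lt_succ_self k))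
    refine (negTrace_le_lintegral (by positivity) hfin
      (N := fun τ => 2 * ∑' k, (Iio (6 * (b (k + 1) - b k)⁻¹ ^ 4)).indicator 1 τ) ?_).trans
      ((lintegral_short_intervals hκ hℓ hsum).trans (le_of_eq ?_))
    · intro τ hτ s hs
      obtain ⟨S, hS, -⟩ := finite_short_intervals hκ hℓ hsum hτ
      have h1 := hb τ S hτ.le fun k hk => not_lt.1 fun h => hk ((hS k).2 h)
      rw [zero_add] at h1
      have h2 := (hT τ _ h1 s hs).2
      refine (Nat.cast_le.2 h2).trans ?_
      push_cast
      gcongr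
      refine le_trans (le_of_eq ?_) (ENNReal.sum_le_tsum S)
      rw [Finset.sum_congr rfl fun k hk => indicator_of_mem (mem_Iio.2 ((hS k).1 hk)) _]
      simp
    · congr 1
      rw [countConst, hM]
      ring
  refine ENNReal.le_of_forall_pos_le_add fun ε hε _ => ?_
  have hδ : 0 < (ε : ℝ) / countConst ν := div_pos hε hC
  refine (key _ hδ).trans (le_of_eq ?_)
  rw [mul_add, mul_div_cancel₀ _ hC.ne', ENNReal.ofReal_add (by positivity) (by positivity),
    ENNReal.ofReal_coe_nnreal]

/-- The rank depends on `δ`, but the number of eigenvalues does not, so `δ` can be sent to zero. -/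
theorem CountsEigenvalues.sum_finrank_le {hV : IsAdmissible V} {T : L2 →ₗ.[ℂ] L2}
    (hT : CountsEigenvalues hV T) (hν₀ : 0 ≤ ν) (hν₃ : ν < 3) (hp : 1 ≤ p)
    (hVp : IntegrableOn (fun x : ℝ => V x ^ p * x ^ ν) (Ioi 0)) {τ : ℝ} (hτ : 0 < τ)
    (s : Finset ℝ) (hs : ∀ r ∈ s, r < -τ) :
    ((∑ r ∈ s, Module.finrank ℂ (eigenspace T (r : ℝ)) : ℕ) : ℝ) ≤
      countConst ν * (τ / 2) ^ (-((3 - ν) / 4)) *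
        ∫ x in Ioi 0, max (V x - τ / 2) 0 * x ^ ν := by
  have hC := countConst_pos hν₃
  have hc : 0 < countConst ν * (τ / 2) ^ (-((3 - ν) / 4)) := by positivity
  refine le_of_forall_pos_le_add fun ε hε => ?_
  obtain ⟨n, hn, hle⟩ := exists_boundedBelowUpToRank_max hν₀ hν₃ hp hV hVp hτ (div_pos hε hc)
  rw [mul_add, mul_div_cancel₀ _ hc.ne'] at hle
  exact (Nat.cast_le.2 (hT τ n hn s hs).2).trans hle

/-- The left side vanishes unless `τ < 2 v`. There `(v - τ/2)_+ ≤ v` leaves the power `τ ^ (γ - γ₀ -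
1)`, integrable at zero because `γ > γ₀`; it is normalised so that `lintegral_layer` applies with `R
= 2 v`. -/
theorem layer_bound {v τ γ γ₀ c₀ y : ℝ} (hv : 0 ≤ v) (hτ : 0 < τ) (hγ₀ : γ₀ < γ) (hγ : 0 < γ)
    (hc₀ : 0 < c₀) (hy : 0 ≤ y) :
    ENNReal.ofReal (γ * τ ^ (γ - 1)) *
      (ENNReal.ofReal (c₀ * τ ^ (-γ₀)) * ENNReal.ofReal (max (v - τ / 2) 0 * y)) ≤
    ENNReal.ofReal (γ * c₀ / (γ - γ₀) * (v * y)) *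
      (ENNReal.ofReal ((γ - γ₀) * τ ^ (γ - γ₀ - 1)) * (Iio (2 * v)).indicator 1 τ) := by
  have hγ' : 0 < γ - γ₀ := by linarith
  by_cases h : τ < 2 * v
  · rw [indicator_of_mem (mem_Iio.2 h), Pi.one_apply, mul_one, ← ENNReal.ofReal_mul (by positivity),
      ← ENNReal.ofReal_mul (by positivity), ← ENNReal.ofReal_mul (by positivity)]
    refine ENNReal.ofReal_le_ofReal ?_
    have h1 : τ ^ (γ - 1) * τ ^ (-γ₀) = τ ^ (γ - γ₀ - 1) := by
      rw [← Real.rpow_add hτ]; congr 1; ring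
    have h2 : max (v - τ / 2) 0 ≤ v := max_le (by linarith) hv
    calc γ * τ ^ (γ - 1) * (c₀ * τ ^ (-γ₀) * (max (v - τ / 2) 0 * y))
        = γ * c₀ * (τ ^ (γ - 1) * τ ^ (-γ₀)) * (max (v - τ / 2) 0 * y) := by ring
      _ ≤ γ * c₀ * τ ^ (γ - γ₀ - 1) * (v * y) := by rw [h1]; gcongr
      _ = _ := by field_simp
  · rw [max_eq_right (by linarith)]
    simp

/-- The bound above the critical exponent. -/
theorem CountsEigenvalues.negTrace_le_of_lt {hV : IsAdmissible V} {T : L2 →ₗ.[ℂ] L2}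
    (hT : CountsEigenvalues hV T) (hν₀ : 0 ≤ ν) (hν₃ : ν < 3) {γ : ℝ} (hγ : (3 - ν) / 4 < γ)
    (hVp : IntegrableOn (fun x : ℝ => V x ^ (γ + (1 + ν) / 4) * x ^ ν) (Ioi 0)) :
    negTrace T γ ≤ ENNReal.ofReal ((γ * (countConst ν * 2 ^ ((3 - ν) / 4)) / (γ - (3 - ν) / 4) *
      2 ^ (γ - (3 - ν) / 4)) * ∫ x in Ioi 0, V x ^ (γ + (1 + ν) / 4) * x ^ ν) := by
  have hκ : 0 < 3 - ν := by linarith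
  have hγpos : 0 < γ := by linarith
  have hp : 1 ≤ γ + (1 + ν) / 4 := by linarith
  have hC := countConst_pos hν₃
  set p := γ + (1 + ν) / 4 with hpdef
  set γ₀ := (3 - ν) / 4 with hγ₀
  have hγ' : 0 < γ - γ₀ := by linarith
  set c₀ := countConst ν * 2 ^ γ₀ with hc₀
  have hc₀pos : 0 < c₀ := by positivity
  have hfin := hT.finiteDimensional hν₀ hν₃ hp hVp
  set μ := (volume : Measure ℝ).restrict (Ioi 0) with hμ
  have hVm : AEMeasurable V μ := hV.aemeasurable
  refine (negTrace_le_lintegral hγpos hfin (N := fun τ => ENNReal.ofReal (c₀ * τ ^ (-γ₀)) *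
    ∫⁻ x in Ioi 0, ENNReal.ofReal (max (V x - τ / 2) 0 * x ^ ν)) ?_).trans ?_
  · intro τ hτ s hs
    have h1 := hT.sum_finrank_le hν₀ hν₃ hp hVp hτ s hs
    have hi := integrableOn_max_sub hp hV.nonneg hVp (half_pos hτ)
    have h0 : 0 ≤ᵐ[μ] fun x => max (V x - τ / 2) 0 * x ^ ν := by
      filter_upwards [ae_restrict_mem measurableSet_Ioi] with x hx
      have : (0 : ℝ) < x := hx
      positivity
    have h2 : (τ / 2) ^ (-γ₀) = 2 ^ γ₀ * τ ^ (-γ₀) := by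
      rw [Real.div_rpow hτ.le (by norm_num), Real.rpow_neg (by norm_num : (0 : ℝ) ≤ 2), div_inv_eq_mul,
        mul_comm]
    rw [← ofReal_integral_eq_lintegral_ofReal hi h0, ← ENNReal.ofReal_mul (by positivity),
      ← ENNReal.ofReal_natCast]
    refine ENNReal.ofReal_le_ofReal (h1.trans (le_of_eq ?_))
    rw [h2, hc₀]
    ring
  · have hjoint : AEMeasurable (Function.uncurry fun τ x : ℝ =>
        ENNReal.ofReal (γ * τ ^ (γ - 1)) * (ENNReal.ofReal (c₀ * τ ^ (-γ₀)) *
          ENNReal.ofReal (max (V x - τ / 2) 0 * x ^ ν))) (μ.prod μ) := by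
      have hV2 : AEMeasurable (fun z : ℝ × ℝ => V z.2) (μ.prod μ) := hVm.comp_snd
      have m1 : Measurable fun z : ℝ × ℝ => ENNReal.ofReal (γ * z.1 ^ (γ - 1)) :=
        ((measurable_fst.pow_const _).const_mul _).ennreal_ofReal
      have m2 : Measurable fun z : ℝ × ℝ => ENNReal.ofReal (c₀ * z.1 ^ (-γ₀)) :=
        ((measurable_fst.pow_const _).const_mul _).ennreal_ofReal
      have m3 : AEMeasurable (fun z : ℝ × ℝ => max (V z.2 - z.1 / 2) 0 * z.2 ^ ν) (μ.prod μ) :=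
        ((hV2.sub (measurable_fst.div_const 2).aemeasurable).max aemeasurable_const).mul
          (measurable_snd.pow_const ν).aemeasurable
      exact m1.aemeasurable.mul (m2.aemeasurable.mul m3.ennreal_ofReal)
    have hin : ∀ τ : ℝ, ENNReal.ofReal (γ * τ ^ (γ - 1)) * (ENNReal.ofReal (c₀ * τ ^ (-γ₀)) *
        ∫⁻ x, ENNReal.ofReal (max (V x - τ / 2) 0 * x ^ ν) ∂μ) =
        ∫⁻ x, ENNReal.ofReal (γ * τ ^ (γ - 1)) * (ENNReal.ofReal (c₀ * τ ^ (-γ₀)) *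
          ENNReal.ofReal (max (V x - τ / 2) 0 * x ^ ν)) ∂μ := fun τ => by
      rw [lintegral_const_mul' _ _ ENNReal.ofReal_ne_top,
        lintegral_const_mul' _ _ ENNReal.ofReal_ne_top]
    refine (le_of_eq (lintegral_congr hin)).trans ?_
    -- By Tonelli the integral over `τ` is done first, at fixed `x`, where `layer_bound` applies.
    rw [lintegral_lintegral_swap hjoint, ← integral_const_mul,
      ofReal_integral_eq_lintegral_ofReal (hVp.const_mul _)]
    · refine lintegral_mono_ae ?_
      filter_upwards [hV.nonneg, ae_restrict_mem measurableSet_Ioi] with x hx hx0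
      have hx0' : (0 : ℝ) < x := hx0
      calc ∫⁻ τ, ENNReal.ofReal (γ * τ ^ (γ - 1)) * (ENNReal.ofReal (c₀ * τ ^ (-γ₀)) *
            ENNReal.ofReal (max (V x - τ / 2) 0 * x ^ ν)) ∂μ
          ≤ ∫⁻ τ, ENNReal.ofReal (γ * c₀ / (γ - γ₀) * (V x * x ^ ν)) *
            (ENNReal.ofReal ((γ - γ₀) * τ ^ (γ - γ₀ - 1)) * (Iio (2 * V x)).indicator 1 τ) ∂μ := by
            refine setLIntegral_mono' measurableSet_Ioi fun τ hτ => ?_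
            exact layer_bound hx hτ hγ hγpos hc₀pos (by positivity)
        _ = ENNReal.ofReal (γ * c₀ / (γ - γ₀) * (V x * x ^ ν)) *
            ENNReal.ofReal ((2 * V x) ^ (γ - γ₀)) := by
            rw [lintegral_const_mul' _ _ ENNReal.ofReal_ne_top,
              lintegral_layer hγ' (by positivity)]
        _ ≤ _ := by
            rw [← ENNReal.ofReal_mul (by positivity), Real.mul_rpow (by norm_num) hx]
            refine ENNReal.ofReal_le_ofReal (le_of_eq ?_)
            -- One power of `V` comes from the truncated potential and `γ - γ₀` powers from the
            -- integral over `τ < 2 V`; they add up to `p`.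
            have e1 : V x ^ p = V x * V x ^ (γ - γ₀) := by
              rw [show p = 1 + (γ - γ₀) by rw [hpdef, hγ₀]; ring,
                Real.rpow_add_of_nonneg hx zero_le_one hγ'.le, Real.rpow_one]
            rw [e1]
            ring
    · filter_upwards [hV.nonneg, ae_restrict_mem measurableSet_Ioi] with x hx hx0
      have hx0' : (0 : ℝ) < x := hx0
      positivity

theorem exists_operator (hν₀ : 0 ≤ ν) (hν₃ : ν < 3) (hp : 1 ≤ p) (hV : IsAdmissible V)
    (hVp : IntegrableOn (fun x : ℝ => V x ^ p * x ^ ν) (Ioi 0)) :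
    ∃ (h : Form L2) (T : L2 →ₗ.[ℂ] L2), h.IsClosureOf toL2 (energy V) ∧ IsAssociated T h ∧
      IsSelfAdjoint T ∧ HasDiscreteNegSpectrum T ∧ CountsEigenvalues hV T := by
  obtain ⟨c, hc⟩ := exists_relative_bound hp hV.nonneg hVp hν₀ hν₃ hV
  refine exists_closure_and_operator hV.energy_eq denseRange_toL2 hardyOp_closable hc
    fun τ hτ => ?_
  obtain ⟨n, hn, -⟩ := exists_boundedBelowUpToRank_max hν₀ hν₃ hp hV hVp hτ one_pos
  exact ⟨n, hn⟩

theorem exists_lower_bound (hν₀ : 0 ≤ ν) (hν₃ : ν < 3) (hp : 1 ≤ p) (hV : IsAdmissible V)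
    (hVp : IntegrableOn (fun x : ℝ => V x ^ p * x ^ ν) (Ioi 0)) :
    ∃ c : ℝ, ∀ u : 𝓓(halfLine, ℂ), c * ∫ x in Ioi (0 : ℝ), ‖u x‖ ^ 2 ≤ energy V u := by
  obtain ⟨c, hc⟩ := exists_relative_bound hp hV.nonneg hVp hν₀ hν₃ hV
  refine ⟨-c, fun u => ?_⟩
  rw [hV.energy_eq, ← norm_sq_toL2]
  have := hc u
  have h0 : 0 ≤ ‖hardyOp u‖ ^ 2 := by positivity
  linarith

end Moments

end

end LiebThirring

theorem theorem1 (ν γ : ℝ) (hν₀ : 0 ≤ ν) (hν₃ : ν < 3) (hγ : (3 - ν) / 4 ≤ γ) :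
    ∃ C : ℝ, 0 < C ∧ ∀ V : ℝ → ℝ,
      (∀ᵐ x ∂(volume : Measure ℝ).restrict (Ioi 0), 0 ≤ V x) →
      IntegrableOn (fun x : ℝ => V x ^ (γ + (1 + ν) / 4) * x ^ ν) (Ioi 0) volume →
      -- the form is well defined and lower semi-bounded on the test functions
      (∀ u : 𝓓(LiebThirring.halfLine, ℂ),
        IntegrableOn (LiebThirring.energyDensity V u) (Ioi 0) volume) ∧
      (∃ c : ℝ, ∀ u : 𝓓(LiebThirring.halfLine, ℂ),
        c * ∫ x in Ioi (0 : ℝ), ‖u x‖ ^ 2 ≤ LiebThirring.energy V u) ∧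
      -- it has a closure `h`, which is the form of a self-adjoint operator `T`
      ∃ (h : LiebThirring.Form LiebThirring.L2)
        (T : LiebThirring.L2 →ₗ.[ℂ] LiebThirring.L2),
        h.IsClosureOf LiebThirring.toL2 (LiebThirring.energy V) ∧
        LiebThirring.IsAssociated T h ∧
        IsSelfAdjoint T ∧
        LiebThirring.HasDiscreteNegSpectrum T ∧
        LiebThirring.negTrace T γ ≤
          ENNReal.ofReal (C * ∫ x in Ioi (0 : ℝ), V x ^ (γ + (1 + ν) / 4) * x ^ ν) := by
  have hp : 1 ≤ γ + (1 + ν) / 4 := by linarith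
  have hK := LiebThirring.countConst_pos hν₃
  -- The constant of the second case contains `1 / (γ - (3 - ν) / 4)` and blows up at the critical
  -- exponent, which therefore has its own argument.
  rcases hγ.eq_or_lt with rfl | hlt
  · refine ⟨LiebThirring.countConst ν, hK, fun V hV0 hVp => ?_⟩
    have hV := LiebThirring.isAdmissible_of_rpow hp hV0 hVp
    obtain ⟨h, T, h1, h2, h3, h4, h5⟩ := LiebThirring.exists_operator hν₀ hν₃ hp hV hVp
    refine ⟨hV.integrableOn_energyDensity, LiebThirring.exists_lower_bound hν₀ hν₃ hp hV hVp,
      h, T, h1, h2, h3, h4, ?_⟩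
    have he : (3 - ν) / 4 + (1 + ν) / 4 = 1 := by ring
    simp only [he, Real.rpow_one] at hVp ⊢
    exact h5.negTrace_le_critical hν₀ hν₃ hVp
  · have hγ' : 0 < γ - (3 - ν) / 4 := by linarith
    have hγ0 : 0 < γ := by linarith
    refine ⟨γ * (LiebThirring.countConst ν * 2 ^ ((3 - ν) / 4)) / (γ - (3 - ν) / 4) *
      2 ^ (γ - (3 - ν) / 4), by positivity, fun V hV0 hVp => ?_⟩
    have hV := LiebThirring.isAdmissible_of_rpow hp hV0 hVp
    obtain ⟨h, T, h1, h2, h3, h4, h5⟩ := LiebThirring.exists_operator hν₀ hν₃ hp hV hVp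
    exact ⟨hV.integrableOn_energyDensity, LiebThirring.exists_lower_bound hν₀ hν₃ hp hV hVp,
      h, T, h1, h2, h3, h4, h5.negTrace_le_of_lt hν₀ hν₃ hlt hVp⟩
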